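/- Let $m\ge 1$, $d\ge 1$, $0\le l\le m$ and $0<\epsilon<1$. Notation. Write $x\in(\mathbb R^d)^{2m}$ as $x=(x^0,x^1)=(x^0_1,\dots,x^0_m,x^1_1,\dots,x^1_m)$ with $x^0_i,x^1_i\in\mathbb R^d$. Let $Q$ be the set of functions $j:\{1,\dots,m\}\to\{0,1\}$, and for $j\in Q$ let $\Pi_j x=(x_1^{j(1)},\dots,x_m^{j(m)})\in(\mathbb R^d)^m$; we identify $\Pi_j$ with the corresponding $m\times 2m$ matrix. Real matrices act on block vectors by $(By)_i=\sum_n b_{in}y_n$. For $1\le i\le m$ let $i*j\in Q$ be given by $(i*j)(i)=1-j(i)$ and $(i*j)(k)=j(k)$ for $k\ne i$. $\|A\|_{HS}$ is the Hilbert–Schmidt norm, $\widehat f(\xi)=\int f(x)e^{-2\pi i x\cdot\xi}\,dx$, and $g(x)=e^{-\pi|x|^2}$ on $\mathbb R^{2dm}$. For an $m\times m$ matrix $A$, a tuple $(F_j)_{j\in Q}$ of real-valued Schwartz functions on $(\mathbb R^d)^m$ and a tempered distribution $K$ on $(\mathbb R^d)^m$, put $$\Lambda(K,A)=\int_{(\mathbb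 R^d)^{2m}}\Big(\prod_{j\in Q}F_j(\Pi_jx)\Big)K((I\ A)x)\,dx ,$$ that is, $K$ is paired with the Schwartz function $y\mapsto\int_{(\mathbb R^d)^m}\prod_{j\in Q}F_j(\Pi_j(y-Az,z))\,dz$. Then there is a constant $C$, depending only on $m,d,l,\epsilon$, such that the following holds. Let $A$ be a real $m\times m$ matrix with $$|\det((I\ A)\Pi_j^T)|>\epsilon\ \text{ for all } j\in Q,\qquad \|A\|_{HS}\le\epsilon^{-1},$$ whose first $l$ rows coincide with the first $l$ rows of $-I$. Let $(F_j)_{j\in Q}$ be a tuple of real-valued Schwartz functions on $(\mathbb R^d)^m$ with $\|F_j\|_{2^m}=1$ for all $j\in Q$, and $F_j=F_{i*j}$ for all $j\in Q$ and $1\le i\le l$. Then: 1. Let $K$ be a tempered distribution whose Fourier transform is a function $\widehat K$ that is $3dm$ times continuously differentiable on $(\mathbb R^d)^m\setminus\{0\}$, with $|\partial^\alpha\widehat K(\xi)|\le|\xi|^{-|\alpha|}$ for all $\xi\ne0$ and all multi-indices $\alpha\in\mathbb N_0^{dm}$ with $|\alpha|\le 3dm$, and with $\widehat K(\xi)=0$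 for all $\xi=(\xi_1,\dots,\xi_m)\neq0$ such that $\xi_k=0$ for all $k>l$. Then $|\Lambda(K,A)|\le C$. 2. Let $l<i\le m$, $1\le k_1,k_2\le d$, $u\in\mathbb R^{dm}$, and let $c\in L^\infty(0,\infty)$ be complex-valued with $\|c\|_\infty=1$. Put $g_{i,k_1,k_2}=\partial_{(i-1)d+k_1}\partial_{(i+m-1)d+k_2}\,g$ (one derivative in the $k_1$-th coordinate of $x_i^0$ and one in the $k_2$-th coordinate of $x_i^1$). Then the integral $$\widehat K(\xi)=\int_0^\infty c_t\,\widehat{g_{i,k_1,k_2}}\big((I\ A)^T(t\xi)\big)\,e^{2\pi i u\cdot t\xi}\,\frac{dt}t$$ converges absolutely for every $\xi$ and is the Fourier transform of a tempered distribution $K$, and $$|\Lambda(K,A)|\le C(1+\|u\|)^{2d(m-1)}.$$ -/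

import Mathlib

open MeasureTheory Set
open scoped SchwartzMap FourierTransform ENNReal

noncomputable section

namespace CubicalBL

/-! ### Integrating a Schwartz function over one group of variables -/

section FiberIntegral

/-- The partial differential in the first variable of a Schwartz function of two variables. -/
def partialFst {Y Z V : Type} [NormedAddCommGroup Y] [NormedSpace ℝ Y]
    [NormedAddCommGroup Z] [NormedSpace ℝ Z] [NormedAddCommGroup V] [NormedSpace ℝ V]
    (S : 𝓢(Y × Z, V)) : 𝓢(Y × Z, Y →L[ℝ] V) :=
  SchwartzMap.postcompCLM
    ((ContinuousLinearMap.compL ℝ Y (Y × Z) V).flip (ContinuousLinearMap.inl ℝ Y Z))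
    (SchwartzMap.fderivCLM ℝ (Y × Z) V S)

variable {Y Z V : Type} [NormedAddCommGroup Y] [NormedSpace ℝ Y]
  [NormedAddCommGroup Z] [NormedSpace ℝ Z] [NormedAddCommGroup V] [NormedSpace ℝ V]
  [MeasureSpace Z]

theorem fiber_bound (S : 𝓢(Y × Z, V)) (k : ℕ) : ∃ C : ℝ, ∀ y z,
    ‖y‖ ^ k * ‖S (y, z)‖ ≤
      C * (1 + ‖z‖) ^ (-((volume : Measure Z).integrablePower : ℝ)) := by
  set p := (volume : Measure Z).integrablePower
  refine ⟨2 ^ (k + p) * (Finset.Iic (k + p, 0)).sup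
    (fun m => SchwartzMap.seminorm ℝ m.1 m.2) S, fun y z => ?_⟩
  · rw [Real.rpow_neg (by positivity), Real.rpow_natCast, ← div_eq_mul_inv,
      le_div_iff₀ (by positivity)]
    have h := SchwartzMap.one_add_le_sup_seminorm_apply (𝕜 := ℝ) (m := (k + p, 0))
      (k := k + p) (n := 0) le_rfl le_rfl S (y, z)
    rw [norm_iteratedFDeriv_zero] at h
    refine le_trans ?_ h
    have h1 : ‖y‖ ≤ 1 + ‖(y, z)‖ := by
      have := norm_fst_le (y, z)
      simp only at this
      linarith
    have h2 : 1 + ‖z‖ ≤ 1 + ‖(y, z)‖ := by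
      have := norm_snd_le (y, z)
      simp only at this
      linarith
    calc ‖y‖ ^ k * ‖S (y, z)‖ * (1 + ‖z‖) ^ p
        = ‖y‖ ^ k * (1 + ‖z‖) ^ p * ‖S (y, z)‖ := by ring
      _ ≤ (1 + ‖(y, z)‖) ^ k * (1 + ‖(y, z)‖) ^ p * ‖S (y, z)‖ := by gcongr
      _ = _ := by rw [pow_add]

variable [BorelSpace Z] [SecondCountableTopology Z] [(volume : Measure Z).HasTemperateGrowth]

theorem fiber_integrable (S : 𝓢(Y × Z, V)) (y : Y) : Integrable (fun z => S (y, z)) := by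
  obtain ⟨C, hC⟩ := fiber_bound S 0
  refine ((volume : Measure Z).integrable_pow_neg_integrablePower.const_mul C).mono'
    (by fun_prop) ?_
  filter_upwards with z
  simpa using hC y z

theorem fiber_hasFDerivAt (S : 𝓢(Y × Z, V)) (y : Y) :
    HasFDerivAt (fun y => ∫ z, S (y, z)) (∫ z, partialFst S (y, z)) y := by
  obtain ⟨C, hC⟩ := fiber_bound (partialFst S) 0
  refine hasFDerivAt_integral_of_dominated_of_fderiv_le (s := Set.univ)
    (F := fun y z => S (y, z)) (F' := fun y z => partialFst S (y, z))
    (bound := fun z => C * (1 + ‖z‖) ^ (-((volume : Measure Z).integrablePower : ℝ)))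
    Filter.univ_mem ?_ (fiber_integrable S y)
    (fiber_integrable (partialFst S) y).aestronglyMeasurable ?_
    ((volume : Measure Z).integrable_pow_neg_integrablePower.const_mul C) ?_
  · filter_upwards with y using (fiber_integrable S y).aestronglyMeasurable
  · filter_upwards with z y _
    simpa using hC y z
  · filter_upwards with z y _
    have h1 : HasFDerivAt S (fderiv ℝ S (y, z)) (y, z) :=
      S.differentiableAt.hasFDerivAt
    exact h1.comp y (hasFDerivAt_prodMk_left y z)

theorem fiber_fderiv (S : 𝓢(Y × Z, V)) :
    fderiv ℝ (fun y => ∫ z, S (y, z)) = fun y => ∫ z, partialFst S (y, z) :=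
  funext fun y => (fiber_hasFDerivAt S y).fderiv

end FiberIntegral

theorem fiber_contDiff {Y Z : Type} [NormedAddCommGroup Y] [NormedSpace ℝ Y]
    [NormedAddCommGroup Z] [NormedSpace ℝ Z] [MeasureSpace Z] [BorelSpace Z]
    [SecondCountableTopology Z] [(volume : Measure Z).HasTemperateGrowth] (n : ℕ) :
    ∀ {V : Type} [NormedAddCommGroup V] [NormedSpace ℝ V] (S : 𝓢(Y × Z, V)),
      ContDiff ℝ n (fun y => ∫ z, S (y, z)) := by
  induction n with
  | zero =>
    intro V _ _ S
    have h : Differentiable ℝ (fun y => ∫ z, S (y, z)) :=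
      fun y => (fiber_hasFDerivAt S y).differentiableAt
    exact contDiff_zero.2 h.continuous
  | succ n ih =>
    intro V _ _ S
    rw [Nat.cast_succ, contDiff_succ_iff_fderiv]
    refine ⟨fun y => (fiber_hasFDerivAt S y).differentiableAt, by simp, ?_⟩
    rw [fiber_fderiv]
    exact ih _

theorem fiber_decay {Y Z : Type} [NormedAddCommGroup Y] [NormedSpace ℝ Y]
    [NormedAddCommGroup Z] [NormedSpace ℝ Z] [MeasureSpace Z] [BorelSpace Z]
    [SecondCountableTopology Z] [(volume : Measure Z).HasTemperateGrowth] (k n : ℕ) :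
    ∀ {V : Type} [NormedAddCommGroup V] [NormedSpace ℝ V] (S : 𝓢(Y × Z, V)),
      ∃ C : ℝ, ∀ y, ‖y‖ ^ k * ‖iteratedFDeriv ℝ n (fun y => ∫ z, S (y, z)) y‖ ≤ C := by
  induction n with
  | zero =>
    intro V _ _ S
    obtain ⟨C, hC⟩ := fiber_bound S k
    refine ⟨∫ z : Z, C * (1 + ‖z‖) ^ (-((volume : Measure Z).integrablePower : ℝ)),
      fun y => ?_⟩
    rw [norm_iteratedFDeriv_zero]
    calc ‖y‖ ^ k * ‖∫ z, S (y, z)‖ ≤ ‖y‖ ^ k * ∫ z, ‖S (y, z)‖ := by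
          gcongr
          exact norm_integral_le_integral_norm _
      _ = ∫ z, ‖y‖ ^ k * ‖S (y, z)‖ := (integral_const_mul _ _).symm
      _ ≤ _ := integral_mono ((fiber_integrable S y).norm.const_mul _)
          ((volume : Measure Z).integrable_pow_neg_integrablePower.const_mul C) (hC y)
  | succ n ih =>
    intro V _ _ S
    obtain ⟨C, hC⟩ := ih (partialFst S)
    refine ⟨C, fun y => ?_⟩
    rw [← norm_iteratedFDeriv_fderiv, fiber_fderiv]
    exact hC y

/-! ### Block vectors, block matrices and the cube -/

/-- `(ℝ^d)^ι` with its Euclidean norm: `y (i, k)` is the `k`-th coordinate of `y_i ∈ ℝ^d`. -/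
abbrev BlockVec (ι : Type) (d : ℕ) : Type := EuclideanSpace ℝ (ι × Fin d)

/-- The action `M ⊗ I` of a real matrix `M` on block vectors: `(M y)_i = ∑ n, M i n • y_n`. -/
def blockAct {ι κ : Type} [Fintype ι] [Fintype κ] {d : ℕ} (M : Matrix ι κ ℝ) :
    BlockVec κ d →L[ℝ] BlockVec ι d :=
  LinearMap.toContinuousLinearMap
    { toFun := fun y => WithLp.toLp 2 fun p => ∑ n, M p.1 n * y (n, p.2)
      map_add' := fun y z => by
        ext p
        simp [mul_add, Finset.sum_add_distrib]
      map_smul' := fun c y => by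
        ext p
        simp [Finset.mul_sum, mul_left_comm] }

theorem blockAct_apply {ι κ : Type} [Fintype ι] [Fintype κ] {d : ℕ} (M : Matrix ι κ ℝ)
    (y : BlockVec κ d) (i : ι) (k : Fin d) :
    blockAct M y (i, k) = ∑ n, M i n * y (n, k) := rfl

/-- The discrete cube `Q` of functions `{1, …, m} → {0, 1}` (`false` is `0`, `true` is `1`). -/
abbrev Cube (m : ℕ) : Type := Fin m → Bool

/-- The reflection `i * j`, which changes the `i`-th entry of `j`. -/
def Cube.reflect {m : ℕ} (i : Fin m) (j : Cube m) : Cube m := Function.update j i (!j i)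

/-- The projection `Π_j`, as an `m × 2m` matrix. The columns `Sum.inl i` belong to the entries
`x_i^0` and the columns `Sum.inr i` to the entries `x_i^1`; thus `Π_j x = (x_i^{j(i)})_i`. -/
def projMat {m : ℕ} (j : Cube m) : Matrix (Fin m) (Fin m ⊕ Fin m) ℝ :=
  Matrix.of fun i p => if p = (if j i then Sum.inr i else Sum.inl i) then 1 else 0

theorem projMat_act {m d : ℕ} (j : Cube m) (x : BlockVec (Fin m ⊕ Fin m) d) (i : Fin m)
    (k : Fin d) :
    blockAct (projMat j) x (i, k) = x (if j i then Sum.inr i else Sum.inl i, k) := by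
  simp [blockAct_apply, projMat]

/-- The `m × 2m` block matrix `(I A)`. -/
def pairMat {m : ℕ} (A : Matrix (Fin m) (Fin m) ℝ) : Matrix (Fin m) (Fin m ⊕ Fin m) ℝ :=
  Matrix.fromCols 1 A

/-- The Hilbert-Schmidt norm of a matrix. -/
def hsNorm {m : ℕ} (A : Matrix (Fin m) (Fin m) ℝ) : ℝ := Real.sqrt (∑ i, ∑ j, A i j ^ 2)

/-! ### The singular Brascamp-Lieb form -/

/-- The product `∏_{j ∈ Q} F_j(Π_j x)`. -/
def cubeProd {m d : ℕ} (F : Cube m → 𝓢(BlockVec (Fin m) d, ℝ))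
    (x : BlockVec (Fin m ⊕ Fin m) d) : ℝ :=
  ∏ j, F j (blockAct (projMat j) x)

/-- The linear map `(y, z) ↦ x = (x^0, x^1) = (y - A z, z)`. It has determinant one and
parametrizes, for fixed `y`, the fibre `{x | (I A) x = y}`. -/
def fiberPt {m d : ℕ} (A : Matrix (Fin m) (Fin m) ℝ) :
    BlockVec (Fin m) d × BlockVec (Fin m) d →L[ℝ] BlockVec (Fin m ⊕ Fin m) d :=
  LinearMap.toContinuousLinearMap
    { toFun := fun w => WithLp.toLp 2 fun p =>
        Sum.elim (fun i => (w.1 - blockAct A w.2) (i, p.2)) (fun i => w.2 (i, p.2)) p.1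
      map_add' := fun v w => by
        ext ⟨p | p, k⟩ <;> simp
        ring
      map_smul' := fun c w => by
        ext ⟨p | p, k⟩ <;> simp
        ring }

theorem fiberPt_inl {m d : ℕ} (A : Matrix (Fin m) (Fin m) ℝ) (y z : BlockVec (Fin m) d)
    (i : Fin m) (k : Fin d) :
    fiberPt A (y, z) (Sum.inl i, k) = y (i, k) - blockAct A z (i, k) := rfl

theorem fiberPt_inr {m d : ℕ} (A : Matrix (Fin m) (Fin m) ℝ) (y z : BlockVec (Fin m) d)
    (i : Fin m) (k : Fin d) :
    fiberPt A (y, z) (Sum.inr i, k) = z (i, k) := rfl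

theorem pairMat_fiberPt {m d : ℕ} (A : Matrix (Fin m) (Fin m) ℝ) (y z : BlockVec (Fin m) d) :
    blockAct (pairMat A) (fiberPt A (y, z)) = y := by
  ext ⟨i, k⟩
  simp [blockAct_apply, pairMat, Fintype.sum_sum_type, fiberPt_inl, fiberPt_inr,
    Matrix.fromCols_apply_inl, Matrix.fromCols_apply_inr, Matrix.one_apply]

theorem norm_le_proj {m d : ℕ} (x : BlockVec (Fin m ⊕ Fin m) d) :
    ‖x‖ ≤ 2 * ∏ j : Cube m, (1 + ‖blockAct (projMat j) x‖) := by
  have hle : ∀ j : Cube m, 1 + ‖blockAct (projMat j) x‖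
      ≤ ∏ j : Cube m, (1 + ‖blockAct (projMat j) x‖) := by
    intro j
    have h := Finset.prod_le_prod (s := Finset.univ)
      (f := fun i : Cube m => if i = j then 1 + ‖blockAct (projMat i) x‖ else 1)
      (g := fun i : Cube m => 1 + ‖blockAct (projMat i) x‖)
      (fun i _ => by split_ifs <;> positivity)
      (fun i _ => by split_ifs <;> simp)
    simpa using h
  have h0 := hle (fun _ => false)
  have h1 := hle (fun _ => true)
  have hx : ‖x‖ ≤ ‖blockAct (projMat (fun _ => false)) x‖
      + ‖blockAct (projMat (fun _ => true)) x‖ := by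
    have hsq : ‖x‖ ^ 2 = ‖blockAct (projMat (fun _ => false)) x‖ ^ 2
        + ‖blockAct (projMat (fun _ => true)) x‖ ^ 2 := by
      simp [EuclideanSpace.norm_sq_eq, Fintype.sum_prod_type, projMat_act]
    refine le_of_sq_le_sq ?_ (by positivity)
    nlinarith [norm_nonneg (blockAct (projMat (fun _ => false)) x),
      norm_nonneg (blockAct (projMat (fun _ => true)) x)]
  linarith

theorem cubeProd_contDiff {m d : ℕ} (F : Cube m → 𝓢(BlockVec (Fin m) d, ℝ)) :
    ContDiff ℝ (⊤ : ℕ∞) (cubeProd F) :=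
  contDiff_prod fun j _ => ((F j).smooth ⊤).comp (blockAct (projMat j)).contDiff

theorem cubeProd_decay {m d : ℕ} (F : Cube m → 𝓢(BlockVec (Fin m) d, ℝ)) (k n : ℕ) :
    ∃ C : ℝ, ∀ x, ‖x‖ ^ k * ‖iteratedFDeriv ℝ n (cubeProd F) x‖ ≤ C := by
  classical
  have hb : ∀ (j : Cube m) (c : ℕ), ∃ B : ℝ, ∀ x : BlockVec (Fin m ⊕ Fin m) d,
      (1 + ‖blockAct (projMat j) x‖) ^ k *
        ‖iteratedFDeriv ℝ c (fun x => F j (blockAct (projMat j) x)) x‖ ≤ B := by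
    intro j c
    refine ⟨‖(blockAct (projMat j) : BlockVec (Fin m ⊕ Fin m) d →L[ℝ] BlockVec (Fin m) d)‖ ^ c *
      (2 ^ k * (Finset.Iic (k, c)).sup (fun m => SchwartzMap.seminorm ℝ m.1 m.2) (F j)),
      fun x => ?_⟩
    have h := SchwartzMap.one_add_le_sup_seminorm_apply (𝕜 := ℝ) (m := (k, c))
      (k := k) (n := c) le_rfl le_rfl (F j) (blockAct (projMat j) x)
    have h2 : ‖iteratedFDeriv ℝ c (fun x => F j (blockAct (projMat j) x)) x‖ ≤
        ‖iteratedFDeriv ℝ c (F j) (blockAct (projMat j) x)‖ *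
        ‖(blockAct (projMat j) : BlockVec (Fin m ⊕ Fin m) d →L[ℝ] BlockVec (Fin m) d)‖ ^ c := by
      have := (blockAct (projMat j) :
        BlockVec (Fin m ⊕ Fin m) d →L[ℝ] BlockVec (Fin m) d).iteratedFDeriv_comp_right
        ((F j).smooth ⊤) x (i := c) (by exact_mod_cast le_top)
      change ‖iteratedFDeriv ℝ c (F j ∘ blockAct (projMat j)) x‖ ≤ _
      rw [this]
      refine (ContinuousMultilinearMap.norm_compContinuousLinearMap_le _ _).trans ?_
      simp
    calc _ ≤ (1 + ‖blockAct (projMat j) x‖) ^ k *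
          (‖iteratedFDeriv ℝ c (F j) (blockAct (projMat j) x)‖ *
          ‖(blockAct (projMat j) : BlockVec (Fin m ⊕ Fin m) d →L[ℝ] BlockVec (Fin m) d)‖ ^ c) := by
          gcongr
      _ = ‖(blockAct (projMat j) : BlockVec (Fin m ⊕ Fin m) d →L[ℝ] BlockVec (Fin m) d)‖ ^ c *
          ((1 + ‖blockAct (projMat j) x‖) ^ k *
          ‖iteratedFDeriv ℝ c (F j) (blockAct (projMat j) x)‖) := by ring
      _ ≤ _ := by gcongr
  choose B hB using hb
  refine ⟨2 ^ k * ∑ p ∈ (Finset.univ : Finset (Cube m)).sym n,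
    (p : Multiset (Cube m)).countPerms *
      ∏ j, B j ((p : Multiset (Cube m)).count j), fun x => ?_⟩
  have h1 : ‖iteratedFDeriv ℝ n (cubeProd F) x‖ ≤
      ∑ p ∈ (Finset.univ : Finset (Cube m)).sym n, (p : Multiset (Cube m)).countPerms *
        ∏ j, ‖iteratedFDeriv ℝ ((p : Multiset (Cube m)).count j)
          (fun x => F j (blockAct (projMat j) x)) x‖ :=
    norm_iteratedFDeriv_prod_le (N := (⊤ : ℕ∞))
      (fun j _ => ((F j).smooth ⊤).comp (blockAct (projMat j)).contDiff)
      (by exact_mod_cast le_top)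
  calc ‖x‖ ^ k * ‖iteratedFDeriv ℝ n (cubeProd F) x‖
      ≤ (2 * ∏ j : Cube m, (1 + ‖blockAct (projMat j) x‖)) ^ k *
        ∑ p ∈ (Finset.univ : Finset (Cube m)).sym n, (p : Multiset (Cube m)).countPerms *
        ∏ j, ‖iteratedFDeriv ℝ ((p : Multiset (Cube m)).count j)
          (fun x => F j (blockAct (projMat j) x)) x‖ := by
        gcongr
        exact norm_le_proj x
    _ = 2 ^ k * ∑ p ∈ (Finset.univ : Finset (Cube m)).sym n,
        (p : Multiset (Cube m)).countPerms *
        ∏ j, ((1 + ‖blockAct (projMat j) x‖) ^ k *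
          ‖iteratedFDeriv ℝ ((p : Multiset (Cube m)).count j)
          (fun x => F j (blockAct (projMat j) x)) x‖) := by
        rw [mul_pow, mul_assoc, Finset.mul_sum]
        congr 1
        refine Finset.sum_congr rfl fun p _ => ?_
        rw [Finset.prod_mul_distrib, Finset.prod_pow]
        ring
    _ ≤ _ := by
        gcongr with p _ j _
        exact hB j _ x

/-- The complex-valued Schwartz function `(y, z) ↦ ∏_{j ∈ Q} F_j(Π_j x)`, `x = (y - A z, z)`. -/
def cubeProdFiber {m d : ℕ} (A : Matrix (Fin m) (Fin m) ℝ)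
    (F : Cube m → 𝓢(BlockVec (Fin m) d, ℝ)) :
    𝓢(BlockVec (Fin m) d × BlockVec (Fin m) d, ℂ) :=
  SchwartzMap.postcompCLM Complex.ofRealCLM
    (SchwartzMap.compCLM ℝ (g := fiberPt A) (fiberPt A).hasTemperateGrowth
      (by
        refine ⟨1, 1 + ‖(blockAct (pairMat A) :
          BlockVec (Fin m ⊕ Fin m) d →L[ℝ] BlockVec (Fin m) d)‖, fun w => ?_⟩
        have h1 : ‖w.1‖ ≤ ‖(blockAct (pairMat A) :
            BlockVec (Fin m ⊕ Fin m) d →L[ℝ] BlockVec (Fin m) d)‖ * ‖fiberPt A w‖ := by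
          conv_lhs => rw [← pairMat_fiberPt A w.1 w.2]
          exact ContinuousLinearMap.le_opNorm _ _
        have h2 : ‖w.2‖ ≤ ‖fiberPt A w‖ := by
          refine le_of_sq_le_sq ?_ (norm_nonneg _)
          rw [EuclideanSpace.norm_sq_eq, EuclideanSpace.norm_sq_eq, Fintype.sum_prod_type,
            Fintype.sum_prod_type, Fintype.sum_sum_type]
          have : 0 ≤ ∑ i : Fin m, ∑ k : Fin d, ‖fiberPt A w (Sum.inl i, k)‖ ^ 2 := by positivity
          have h3 : ∀ i k, fiberPt A w (Sum.inr i, k) = w.2 (i, k) := fun _ _ => rfl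
          simp only [h3]
          linarith
        have h0 := norm_nonneg (fiberPt A w)
        have h0' := norm_nonneg (blockAct (pairMat A) :
          BlockVec (Fin m ⊕ Fin m) d →L[ℝ] BlockVec (Fin m) d)
        rw [Prod.norm_def, pow_one]
        refine max_le ?_ ?_ <;> nlinarith)
      { toFun := cubeProd F
        smooth' := cubeProd_contDiff F
        decay' := cubeProd_decay F })

/-- The push-forward of `∏_{j ∈ Q} F_j(Π_j x)` under `x ↦ (I A) x`, that is, the Schwartz function
`y ↦ ∫_{(ℝ^d)^m} ∏_{j ∈ Q} F_j(Π_j (y - A z, z)) dz`. -/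
def pushforward {m d : ℕ} (A : Matrix (Fin m) (Fin m) ℝ)
    (F : Cube m → 𝓢(BlockVec (Fin m) d, ℝ)) : 𝓢(BlockVec (Fin m) d, ℂ) where
  toFun y := ∫ z : BlockVec (Fin m) d, (cubeProd F (fiberPt A (y, z)) : ℂ)
  smooth' := contDiff_infty.2 fun n => fiber_contDiff n (cubeProdFiber A F)
  decay' k n := fiber_decay k n (cubeProdFiber A F)

/-- The form `Λ(K, A) = ∫ (∏_{j ∈ Q} F_j(Π_j x)) K((I A) x) dx` for a tempered distribution `K`.
The integral against the distribution `x ↦ K((I A) x)` means the following: in the coordinates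
`y = (I A) x = x^0 + A x^1` and `z = x^1`, for which `dx = dy dz`, one integrates in `z` and then
pairs the resulting Schwartz function of `y` with `K`. -/
def form {m d : ℕ} (K : 𝓢'(BlockVec (Fin m) d, ℂ)) (A : Matrix (Fin m) (Fin m) ℝ)
    (F : Cube m → 𝓢(BlockVec (Fin m) d, ℝ)) : ℂ :=
  K (pushforward A F)

/-- The (distributional) Fourier transform of the tempered distribution `K` is the function
`M`. -/
def IsMultiplier {m d : ℕ} (K : 𝓢'(BlockVec (Fin m) d, ℂ)) (M : BlockVec (Fin m) d → ℂ) : Prop :=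
  ∀ φ : 𝓢(BlockVec (Fin m) d, ℂ),
    Integrable (fun ξ => M ξ * φ ξ) ∧ (𝓕 K) φ = ∫ ξ, M ξ * φ ξ

/-- The symbol estimates `|∂^α M(ξ)| ≤ |ξ|^{-|α|}` for all `ξ ≠ 0` and all `|α| ≤ N`, for a
function `M` that is `N` times continuously differentiable away from the origin. A partial
derivative of order `n` is written as the `n`-th differential applied to a sequence of `n`
standard basis vectors. -/
def SymbolEstimates {ι : Type} [Fintype ι] [DecidableEq ι] (N : ℕ)
    (M : EuclideanSpace ℝ ι → ℂ) : Prop :=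
  ContDiffOn ℝ N M {0}ᶜ ∧
    ∀ n ≤ N, ∀ q : Fin n → ι, ∀ ξ : EuclideanSpace ℝ ι, ξ ≠ 0 →
      ‖iteratedFDeriv ℝ n M ξ (fun r => EuclideanSpace.single (q r) 1)‖ ≤ (‖ξ‖ ^ n)⁻¹

/-! ### The Gaussian kernels -/

/-- The Gaussian `g(x) = exp(-π |x|²)`. -/
def gaussian {ι : Type} [Fintype ι] (x : EuclideanSpace ℝ ι) : ℝ :=
  Real.exp (-Real.pi * ‖x‖ ^ 2)

/-- The partial derivative in the coordinate `q`. -/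
def pderiv {ι : Type} [Fintype ι] [DecidableEq ι] (q : ι) (f : EuclideanSpace ℝ ι → ℝ)
    (x : EuclideanSpace ℝ ι) : ℝ :=
  lineDeriv ℝ f x (EuclideanSpace.single q 1)

/-- `g_{i,k₁,k₂}`: the Gaussian on `(ℝ^d)^{2m}`, differentiated once in the `k₁`-th coordinate of
`x_i^0` and once in the `k₂`-th coordinate of `x_i^1`. -/
def gaussianDeriv {m d : ℕ} (i : Fin m) (k₁ k₂ : Fin d) :
    BlockVec (Fin m ⊕ Fin m) d → ℝ :=
  pderiv (Sum.inl i, k₁) (pderiv (Sum.inr i, k₂) gaussian)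

/-- The integrand, with respect to `dt` on `(0, ∞)`, of the multiplier at `ξ`:
`c_t ĝ_{i,k₁,k₂}((I A)^T (tξ)) e^{2πi u·tξ} / t`. -/
def squareIntegrand {m d : ℕ} (A : Matrix (Fin m) (Fin m) ℝ) (i : Fin m) (k₁ k₂ : Fin d)
    (u : BlockVec (Fin m) d) (c : ℝ → ℂ) (ξ : BlockVec (Fin m) d) (t : ℝ) : ℂ :=
  c t * 𝓕 (fun x : BlockVec (Fin m ⊕ Fin m) d => (gaussianDeriv i k₁ k₂ x : ℂ))
      (blockAct (pairMat A).transpose (t • ξ)) *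
    Complex.exp (2 * Real.pi * Complex.I * (inner ℝ u (t • ξ) : ℝ)) / t

/-- The multiplier `ξ ↦ ∫_0^∞ c_t ĝ_{i,k₁,k₂}((I A)^T (tξ)) e^{2πi u·tξ} dt/t`. -/
def squareMultiplier {m d : ℕ} (A : Matrix (Fin m) (Fin m) ℝ) (i : Fin m) (k₁ k₂ : Fin d)
    (u : BlockVec (Fin m) d) (c : ℝ → ℂ) (ξ : BlockVec (Fin m) d) : ℂ :=
  ∫ t in Ioi (0 : ℝ), squareIntegrand A i k₁ k₂ u c ξ t

end CubicalBL

end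

noncomputable section

namespace CubicalBL

/-! ### Linear algebra of block matrices -/

section LinearAlgebra

variable {ι κ ν : Type} [Fintype ι] [Fintype κ] [Fintype ν] {d : ℕ}

/-! Write Φ for the push-forward of `∏ F_j(Π_j x)` under `(I A)`. The form is the integral of `K̂`
against the inverse Fourier transform of Φ (`form_eq_pairing`), so the proof concerns multipliers
only. It is an induction over a set `S` of slots in which `A` has the rows of `-I` and the tuple is
invariant under reflections. Two statements are proved together: `SymbolBound`, which is part 1 for
general `S`, and `SquareBound`, the absolute `dt/t`-integrability of the oscillations `osc` in the
slots outside `S`, with growth `(1 + |u|)^{2d(m-1)}` in the shift `u`.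

`SymbolBound` for `S ∪ {i}` implies the part of `SquareBound` for `S` with kernels in slot `i`. In
physical space `osc` integrates `g_{i,k₁,k₂}` against the product of the `F_j`. Factors with `j(i) =
0` do not see `x_i^1`, those with `j(i) = 1` do not see `x_i^0`, and `g_{i,k₁,k₂}` splits
accordingly. Cauchy-Schwarz in the remaining variables bounds `osc` by two oscillations of data
symmetric in slot `i` (`abs_energy_le`, `exists_norm_osc_le`); the shift is translated into the
Gaussian weight, dominated by a wider Gaussian, and rescaled away. Symmetric oscillations are
integrals of squares, hence nonnegative, and the sum of their scale integrals over all slots of `S ∪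
{i}` is the pairing with an explicit multiplier, homogeneous of degree zero (`levelMult`). Because
of the rows of `-I`, this multiplier equals `π` where the frequencies outside `S ∪ {i}` vanish. Its
difference with `π` is covered by `SymbolBound`, and the constant `π` contributes `π Φ(0)`, which is
bounded as in Hölder's inequality (`norm_pushforward_zero_le`). Nonnegativity then bounds each
summand by the sum.

`SquareBound` for `S` implies `SymbolBound` for `S`. Split `ξ` into the frequencies `ξ'` in `S` and
`ξ''` outside, and decompose frequency space into the cones `|ξ'| ~ 2^k |ξ''|`. Shrinking `ξ'` by
`2^{-k}` makes a cone isotropic and keeps the data admissible with the same constants; as the symbol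
vanishes on `ξ'' = 0`, it becomes of size `2^{-k}`. On an isotropic piece the squares of the
Gaussian symbols have a positive sum (`Admissible.symbSq_pos`), so the localized symbol is a
combination of Gaussian symbols with smooth coefficients. Expanding the coefficients in Fourier
integrals gives averages over `u` of oscillations with shift `u`, which `SquareBound` controls; the
cones sum as a geometric series.

The determinant hypothesis enters in the bound for Φ(0), in the nonvanishing of the pivot `A i i`,
and in the positivity of the sum of squares. Constants are uniform in `A` because the admissible
matrices form a compact set and every reduction stays in such a set. -/

theorem blockAct_mul (M : Matrix ι κ ℝ) (N : Matrix κ ν ℝ) (y : BlockVec ν d) :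
    blockAct (M * N) y = blockAct M (blockAct N y) := by
  ext ⟨i, k⟩
  simp only [blockAct_apply, Matrix.mul_apply, Finset.sum_mul, Finset.mul_sum]
  rw [Finset.sum_comm]
  simp only [mul_assoc]

theorem blockAct_one [DecidableEq ι] (y : BlockVec ι d) :
    blockAct (1 : Matrix ι ι ℝ) y = y := by
  ext ⟨i, k⟩
  simp [blockAct_apply, Matrix.one_apply]

theorem blockAct_diagonal [DecidableEq ι] (δ : ι → ℝ) (y : BlockVec ι d) (i : ι) (k : Fin d) :
    blockAct (Matrix.diagonal δ) y (i, k) = δ i * y (i, k) := by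
  simp [blockAct_apply, Matrix.diagonal_apply]

theorem inner_blockAct (M : Matrix ι κ ℝ) (y : BlockVec κ d) (z : BlockVec ι d) :
    inner ℝ (blockAct M y) z = inner ℝ y (blockAct M.transpose z) := by
  simp only [PiLp.inner_apply, Fintype.sum_prod_type, blockAct_apply, Matrix.transpose_apply,
    RCLike.inner_apply, conj_trivial, Finset.mul_sum, Finset.sum_mul]
  rw [Finset.sum_comm]
  conv_rhs => rw [Finset.sum_comm]
  refine Finset.sum_congr rfl fun k _ => ?_
  rw [Finset.sum_comm]
  refine Finset.sum_congr rfl fun i _ => Finset.sum_congr rfl fun n _ => ?_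
  ring

/-- In the standard basis the action is the Kronecker product of `M` with the identity of size `d`.
This is the origin of the exponent `d` on all determinants below. -/
theorem det_blockAct [DecidableEq ι] (M : Matrix ι ι ℝ) :
    LinearMap.det ((blockAct M : BlockVec ι d →L[ℝ] BlockVec ι d) :
      BlockVec ι d →ₗ[ℝ] BlockVec ι d) = M.det ^ d := by
  classical
  have h : ((blockAct M : BlockVec ι d →L[ℝ] BlockVec ι d) :
      BlockVec ι d →ₗ[ℝ] BlockVec ι d) =
      Matrix.toLin (EuclideanSpace.basisFun (ι × Fin d) ℝ).toBasis
        (EuclideanSpace.basisFun (ι × Fin d) ℝ).toBasis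
        (Matrix.kroneckerMap (· * ·) M (1 : Matrix (Fin d) (Fin d) ℝ)) := by
    rw [← LinearMap.toMatrix_symm, LinearEquiv.eq_symm_apply]
    ext ⟨i, k⟩ ⟨i', k'⟩
    simp only [LinearMap.toMatrix_apply, OrthonormalBasis.coe_toBasis, ContinuousLinearMap.coe_coe,
      OrthonormalBasis.coe_toBasis_repr_apply, EuclideanSpace.basisFun_apply,
      EuclideanSpace.basisFun_repr, blockAct_apply, Matrix.kroneckerMap_apply, Matrix.one_apply]
    rw [Finset.sum_eq_single i']
    · by_cases h : k = k' <;> simp [h]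
    · intro n _ hn
      simp [hn]
    · simp
  rw [h, LinearMap.det_toLin, Matrix.det_kronecker]
  simp

theorem map_blockAct [DecidableEq ι] (M : Matrix ι ι ℝ) (hM : M.det ≠ 0) :
    Measure.map (blockAct M : BlockVec ι d →L[ℝ] BlockVec ι d) volume =
      ENNReal.ofReal ((|M.det| ^ d)⁻¹) • volume := by
  have h := Measure.map_linearMap_addHaar_eq_smul_addHaar
    (μ := (volume : Measure (BlockVec ι d)))
    (f := ((blockAct M : BlockVec ι d →L[ℝ] BlockVec ι d) : BlockVec ι d →ₗ[ℝ] BlockVec ι d))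
    (by rw [det_blockAct]; exact pow_ne_zero _ hM)
  rw [det_blockAct, abs_inv, abs_pow] at h
  exact h

/-- An invertible matrix acts on block vectors by a continuous linear equivalence. -/
def blockEquiv [DecidableEq ι] (M : Matrix ι ι ℝ) (hM : M.det ≠ 0) :
    BlockVec ι d ≃L[ℝ] BlockVec ι d :=
  ContinuousLinearEquiv.equivOfInverse (blockAct M) (blockAct M⁻¹)
    (fun y => by
      rw [← blockAct_mul, Matrix.nonsing_inv_mul _ (isUnit_iff_ne_zero.2 hM), blockAct_one])
    (fun y => by
      rw [← blockAct_mul, Matrix.mul_nonsing_inv _ (isUnit_iff_ne_zero.2 hM), blockAct_one])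

theorem measurableEmbedding_blockAct [DecidableEq ι] (M : Matrix ι ι ℝ) (hM : M.det ≠ 0) :
    MeasurableEmbedding (blockAct M : BlockVec ι d →L[ℝ] BlockVec ι d) :=
  (blockEquiv M hM).toHomeomorph.measurableEmbedding

theorem integral_comp_blockAct [DecidableEq ι] {E : Type*} [NormedAddCommGroup E]
    [NormedSpace ℝ E] (M : Matrix ι ι ℝ) (hM : M.det ≠ 0) (f : BlockVec ι d → E) :
    ∫ y, f (blockAct M y) = (|M.det| ^ d)⁻¹ • ∫ y, f y := by
  rw [← (measurableEmbedding_blockAct M hM).integral_map, map_blockAct M hM,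
    integral_smul_measure, ENNReal.toReal_ofReal (by positivity)]

theorem lintegral_comp_blockAct [DecidableEq ι] (M : Matrix ι ι ℝ) (hM : M.det ≠ 0)
    (f : BlockVec ι d → ℝ≥0∞) :
    ∫⁻ y, f (blockAct M y) = ENNReal.ofReal ((|M.det| ^ d)⁻¹) * ∫⁻ y, f y := by
  rw [← (measurableEmbedding_blockAct M hM).lintegral_map, map_blockAct M hM,
    lintegral_smul_measure, smul_eq_mul]

theorem integrable_comp_blockAct [DecidableEq ι] {E : Type*} [NormedAddCommGroup E]
    (M : Matrix ι ι ℝ) (hM : M.det ≠ 0) {f : BlockVec ι d → E} (hf : Integrable f) :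
    Integrable (fun y => f (blockAct M y)) := by
  have h : Integrable f (Measure.map (blockAct M : BlockVec ι d →L[ℝ] BlockVec ι d) volume) := by
    rw [map_blockAct M hM]
    exact hf.smul_measure ENNReal.ofReal_ne_top
  exact (measurableEmbedding_blockAct M hM).integrable_map_iff.1 h

end LinearAlgebra

/-! ### The pairing with a multiplier, and anisotropic scaling -/

variable {m d : ℕ}

/-- The inverse Fourier transform of the push-forward. -/
def invPush (A : Matrix (Fin m) (Fin m) ℝ) (F : Cube m → 𝓢(BlockVec (Fin m) d, ℝ)) :
    𝓢(BlockVec (Fin m) d, ℂ) := 𝓕⁻ (pushforward A F)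

/-- The form whose kernel has Fourier transform `M`. -/
def pairing (M : BlockVec (Fin m) d → ℂ) (A : Matrix (Fin m) (Fin m) ℝ)
    (F : Cube m → 𝓢(BlockVec (Fin m) d, ℝ)) : ℂ := ∫ ξ, M ξ * invPush A F ξ

/-- Test the identity for `𝓕 K` with the inverse transform of the push-forward. From here on
distributions no longer occur, only multipliers. -/
theorem form_eq_pairing {K : 𝓢'(BlockVec (Fin m) d, ℂ)} {M : BlockVec (Fin m) d → ℂ}
    (h : IsMultiplier K M) (A : Matrix (Fin m) (Fin m) ℝ)
    (F : Cube m → 𝓢(BlockVec (Fin m) d, ℝ)) : form K A F = pairing M A F := by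
  have h2 := (h (invPush A F)).2
  rw [TemperedDistribution.fourier_apply] at h2
  rw [pairing, ← h2, form, invPush, FourierTransform.fourier_fourierInv_eq]

theorem pushforward_apply (A : Matrix (Fin m) (Fin m) ℝ)
    (F : Cube m → 𝓢(BlockVec (Fin m) d, ℝ)) (y : BlockVec (Fin m) d) :
    pushforward A F y = ∫ z : BlockVec (Fin m) d, (cubeProd F (fiberPt A (y, z)) : ℂ) := rfl

theorem det_diagonal_ne_zero {ι : Type} [Fintype ι] [DecidableEq ι] {δ : ι → ℝ}
    (hδ : ∀ r, 0 < δ r) : (Matrix.diagonal δ).det ≠ 0 := by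
  rw [Matrix.det_diagonal]
  exact Finset.prod_ne_zero_iff.2 fun r _ => (hδ r).ne'

/-- The tuple `F_j ∘ diag δ`, normalized so as to preserve the `L^{2^m}` norms. -/
def scaleTuple (δ : Fin m → ℝ) (hδ : ∀ r, 0 < δ r) (F : Cube m → 𝓢(BlockVec (Fin m) d, ℝ)) :
    Cube m → 𝓢(BlockVec (Fin m) d, ℝ) := fun j =>
  ((∏ r, δ r) ^ ((d : ℝ) / 2 ^ m)) •
    SchwartzMap.compCLMOfContinuousLinearEquiv ℝ
      (blockEquiv (Matrix.diagonal δ) (det_diagonal_ne_zero hδ)) (F j)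

theorem scaleTuple_apply (δ : Fin m → ℝ) (hδ : ∀ r, 0 < δ r)
    (F : Cube m → 𝓢(BlockVec (Fin m) d, ℝ)) (j : Cube m) (x : BlockVec (Fin m) d) :
    scaleTuple δ hδ F j x =
      ((∏ r, δ r) ^ ((d : ℝ) / 2 ^ m)) * F j (blockAct (Matrix.diagonal δ) x) := rfl

/-- The conjugate `D⁻¹ A D` of `A` by `D = diag δ`. -/
def scaleMat (δ : Fin m → ℝ) (A : Matrix (Fin m) (Fin m) ℝ) : Matrix (Fin m) (Fin m) ℝ :=
  Matrix.of fun r s => (δ r)⁻¹ * A r s * δ s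

theorem scaleMat_apply (δ : Fin m → ℝ) (A : Matrix (Fin m) (Fin m) ℝ) (r s : Fin m) :
    scaleMat δ A r s = (δ r)⁻¹ * A r s * δ s := rfl

theorem blockAct_scaleMat (δ : Fin m → ℝ) (hδ : ∀ r, 0 < δ r) (A : Matrix (Fin m) (Fin m) ℝ)
    (z : BlockVec (Fin m) d) :
    blockAct (Matrix.diagonal δ) (blockAct (scaleMat δ A) z) =
      blockAct A (blockAct (Matrix.diagonal δ) z) := by
  ext ⟨r, k⟩
  rw [blockAct_diagonal, blockAct_apply, blockAct_apply, Finset.mul_sum]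
  refine Finset.sum_congr rfl fun s _ => ?_
  rw [blockAct_diagonal, scaleMat_apply]
  have := (hδ r).ne'
  field_simp

/-- A tuple has `2^m` members, so the normalizing factors multiply up to the Jacobian of `diag δ` on
one copy of `(ℝ^d)^m`. -/
theorem pow_scale (δ : Fin m → ℝ) (hδ : ∀ r, 0 < δ r) :
    ((∏ r, δ r) ^ ((d : ℝ) / 2 ^ m)) ^ (2 ^ m) = (∏ r, δ r) ^ d := by
  have h : 0 ≤ ∏ r, δ r := Finset.prod_nonneg fun r _ => (hδ r).le
  rw [← Real.rpow_natCast, ← Real.rpow_mul h]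
  have h2 : (d : ℝ) / 2 ^ m * ((2 ^ m : ℕ) : ℝ) = d := by
    push_cast
    field_simp
  rw [h2, Real.rpow_natCast]

theorem cubeProd_scaleTuple (δ : Fin m → ℝ) (hδ : ∀ r, 0 < δ r)
    (F : Cube m → 𝓢(BlockVec (Fin m) d, ℝ)) (x : BlockVec (Fin m ⊕ Fin m) d) :
    cubeProd (scaleTuple δ hδ F) x =
      (∏ r, δ r) ^ d * cubeProd F (blockAct (Matrix.diagonal (Sum.elim δ δ)) x) := by
  simp only [cubeProd, scaleTuple_apply, Finset.prod_mul_distrib, Finset.prod_const]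
  congr 1
  · rw [Finset.card_univ, Fintype.card_fun, Fintype.card_bool, Fintype.card_fin, pow_scale δ hδ]
  · refine Finset.prod_congr rfl fun j _ => ?_
    congr 1
    ext ⟨i, k⟩
    rw [blockAct_diagonal, projMat_act, projMat_act, blockAct_diagonal]
    split_ifs <;> rfl

theorem scale_fiberPt (δ : Fin m → ℝ) (hδ : ∀ r, 0 < δ r) (A : Matrix (Fin m) (Fin m) ℝ)
    (y z : BlockVec (Fin m) d) :
    blockAct (Matrix.diagonal (Sum.elim δ δ)) (fiberPt (scaleMat δ A) (y, z)) =
      fiberPt A (blockAct (Matrix.diagonal δ) y, blockAct (Matrix.diagonal δ) z) := by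
  ext ⟨i | i, k⟩
  · rw [blockAct_diagonal, fiberPt_inl, fiberPt_inl, ← blockAct_scaleMat δ hδ, blockAct_diagonal,
      blockAct_diagonal]
    simp [mul_sub]
  · rw [blockAct_diagonal, fiberPt_inr, fiberPt_inr, blockAct_diagonal]
    simp

/-- The dilation maps the fibres of `(I D⁻¹AD)` to those of `(I A)`, and its Jacobian in the fibre
variable `z` is exactly the factor gained from normalizing the tuple. -/
theorem pushforward_scaleTuple (δ : Fin m → ℝ) (hδ : ∀ r, 0 < δ r)
    (A : Matrix (Fin m) (Fin m) ℝ) (F : Cube m → 𝓢(BlockVec (Fin m) d, ℝ))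
    (y : BlockVec (Fin m) d) :
    pushforward (scaleMat δ A) (scaleTuple δ hδ F) y =
      pushforward A F (blockAct (Matrix.diagonal δ) y) := by
  have hp : 0 < ∏ r, δ r := Finset.prod_pos fun r _ => hδ r
  simp only [pushforward_apply, cubeProd_scaleTuple, scale_fiberPt δ hδ]
  push_cast
  rw [integral_const_mul]
  rw [integral_comp_blockAct (Matrix.diagonal δ) (det_diagonal_ne_zero hδ)
    (fun z => (cubeProd F (fiberPt A (blockAct (Matrix.diagonal δ) y, z)) : ℂ)),
    Matrix.det_diagonal, abs_of_pos hp, Complex.real_smul, ← mul_assoc]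
  push_cast
  rw [mul_inv_cancel₀, one_mul]
  exact pow_ne_zero _ (by exact_mod_cast hp.ne')

theorem invPush_scaleTuple (δ : Fin m → ℝ) (hδ : ∀ r, 0 < δ r)
    (A : Matrix (Fin m) (Fin m) ℝ) (F : Cube m → 𝓢(BlockVec (Fin m) d, ℝ))
    (ξ : BlockVec (Fin m) d) :
    invPush A F ξ = ((∏ r, δ r) ^ d : ℝ) •
      invPush (scaleMat δ A) (scaleTuple δ hδ F) (blockAct (Matrix.diagonal δ) ξ) := by
  have hp : 0 < ∏ r, δ r := Finset.prod_pos fun r _ => hδ r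
  rw [invPush, invPush, SchwartzMap.fourierInv_coe, SchwartzMap.fourierInv_coe,
    Real.fourierInv_eq, Real.fourierInv_eq]
  have h := integral_comp_blockAct (Matrix.diagonal δ) (det_diagonal_ne_zero hδ)
    (fun y : BlockVec (Fin m) d => Real.fourierChar (inner ℝ y ξ) • pushforward A F y)
  rw [Matrix.det_diagonal, abs_of_pos hp] at h
  simp only [pushforward_scaleTuple]
  simp only [inner_blockAct, Matrix.diagonal_transpose] at h
  rw [h, smul_smul, mul_inv_cancel₀ (pow_ne_zero _ hp.ne'), one_smul]

/-- An anisotropic dilation of the multiplier can be traded for a conjugation of the matrix and a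
dilation of the tuple. Used with constant `δ` to reduce to scale one, and with unequal factors to
make thin cones isotropic. -/
theorem pairing_scaleTuple (δ : Fin m → ℝ) (hδ : ∀ r, 0 < δ r)
    (M : BlockVec (Fin m) d → ℂ)
    (A : Matrix (Fin m) (Fin m) ℝ) (F : Cube m → 𝓢(BlockVec (Fin m) d, ℝ)) :
    pairing M (scaleMat δ A) (scaleTuple δ hδ F) =
      pairing (fun ξ => M (blockAct (Matrix.diagonal δ) ξ)) A F := by
  have hp : 0 < ∏ r, δ r := Finset.prod_pos fun r _ => hδ r
  simp only [pairing, invPush_scaleTuple δ hδ A F, mul_smul_comm]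
  rw [integral_smul, integral_comp_blockAct (Matrix.diagonal δ) (det_diagonal_ne_zero hδ)
    (fun ξ => M ξ * invPush (scaleMat δ A) (scaleTuple δ hδ F) ξ), Matrix.det_diagonal,
    abs_of_pos hp, smul_smul, mul_inv_cancel₀ (pow_ne_zero _ hp.ne'), one_smul]

theorem scaleTuple_scaleTuple (δ δ' : Fin m → ℝ) (hδ : ∀ r, 0 < δ r) (hδ' : ∀ r, 0 < δ' r)
    (F : Cube m → 𝓢(BlockVec (Fin m) d, ℝ)) :
    scaleTuple δ hδ (scaleTuple δ' hδ' F) =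
      scaleTuple (fun r => δ' r * δ r) (fun r => mul_pos (hδ' r) (hδ r)) F := by
  funext j
  ext x
  simp only [scaleTuple_apply]
  rw [Finset.prod_mul_distrib, Real.mul_rpow (Finset.prod_nonneg fun r _ => (hδ' r).le)
    (Finset.prod_nonneg fun r _ => (hδ r).le), ← blockAct_mul, Matrix.diagonal_mul_diagonal]
  ring

/-! ### Admissible matrices and tuples -/

/-- The hypotheses on `A`, for an arbitrary set `S` of rows that coincide with those of `-I`. -/
structure Admissible (S : Finset (Fin m)) (ε R : ℝ) (A : Matrix (Fin m) (Fin m) ℝ) : Prop where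
  det : ∀ j : Cube m, ε ≤ |(pairMat A * (projMat j).transpose).det|
  entry : ∀ r s, |A r s| ≤ R
  row : ∀ r ∈ S, ∀ s, A r s = (-1 : Matrix (Fin m) (Fin m) ℝ) r s

/-- The hypotheses on `F`: invariance under the reflections in `S`, and `‖F_j‖_{2^m} ≤ 1`. -/
structure SymTuple (S : Finset (Fin m)) (F : Cube m → 𝓢(BlockVec (Fin m) d, ℝ)) : Prop where
  symm : ∀ i ∈ S, ∀ j : Cube m, F j = F (j.reflect i)
  norm : ∀ j, ∫⁻ x, ‖F j x‖ₑ ^ (2 ^ m) ≤ 1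

theorem pairMat_mul_projMat (A : Matrix (Fin m) (Fin m) ℝ) (j : Cube m) (r s : Fin m) :
    (pairMat A * (projMat j).transpose) r s =
      if j s then A r s else (1 : Matrix (Fin m) (Fin m) ℝ) r s := by
  rw [Matrix.mul_apply]
  simp only [Matrix.transpose_apply, projMat, Matrix.of_apply, mul_ite, mul_one, mul_zero,
    Finset.sum_ite_eq', Finset.mem_univ, if_true]
  split_ifs <;> simp [pairMat, Matrix.fromCols_apply_inl, Matrix.fromCols_apply_inr]

/-- The columns of the mixed matrix come from `I` or from `A`, and conjugation by `D` fixes `I`; so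
the whole mixed matrix is conjugated. -/
theorem det_pairMat_scaleMat (δ : Fin m → ℝ) (hδ : ∀ r, 0 < δ r)
    (A : Matrix (Fin m) (Fin m) ℝ) (j : Cube m) :
    (pairMat (scaleMat δ A) * (projMat j).transpose).det =
      (pairMat A * (projMat j).transpose).det := by
  have h : pairMat (scaleMat δ A) * (projMat j).transpose =
      Matrix.diagonal (fun r => (δ r)⁻¹) * (pairMat A * (projMat j).transpose) *
        Matrix.diagonal δ := by
    ext r s
    rw [Matrix.mul_diagonal, Matrix.diagonal_mul, pairMat_mul_projMat, pairMat_mul_projMat]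
    split_ifs
    · rfl
    · rw [Matrix.one_apply]
      split_ifs with h
      · subst h; field_simp [(hδ r).ne']
      · simp
  rw [h, Matrix.det_mul, Matrix.det_mul, Matrix.det_diagonal, Matrix.det_diagonal,
    Finset.prod_inv_distrib, mul_comm, ← mul_assoc, mul_inv_cancel₀, one_mul]
  exact Finset.prod_ne_zero_iff.2 fun r _ => (hδ r).ne'

theorem SymTuple.scaleTuple {S : Finset (Fin m)} {F : Cube m → 𝓢(BlockVec (Fin m) d, ℝ)}
    (h : SymTuple S F) (δ : Fin m → ℝ) (hδ : ∀ r, 0 < δ r) :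
    SymTuple S (scaleTuple δ hδ F) := by
  have hp : 0 < ∏ r, δ r := Finset.prod_pos fun r _ => hδ r
  refine ⟨fun i hi j => ?_, fun j => ?_⟩
  · simp only [CubicalBL.scaleTuple, ← h.symm i hi j]
  · simp only [scaleTuple_apply, enorm_mul, mul_pow]
    rw [lintegral_const_mul' _ _ (by finiteness),
      lintegral_comp_blockAct (Matrix.diagonal δ) (det_diagonal_ne_zero hδ)
        (fun x => ‖F j x‖ₑ ^ (2 ^ m)), ← enorm_pow, pow_scale δ hδ, Matrix.det_diagonal,
      abs_of_pos hp, ← mul_assoc, Real.enorm_of_nonneg (by positivity),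
      ← ENNReal.ofReal_mul (by positivity), mul_inv_cancel₀ (pow_ne_zero _ hp.ne'),
      ENNReal.ofReal_one, one_mul]
    exact h.norm j

end CubicalBL

end

noncomputable section

namespace CubicalBL

/-! ### The Gaussian and its derivatives -/

section Gaussian

variable {ι : Type} [Fintype ι]

theorem gaussian_pos (x : EuclideanSpace ℝ ι) : 0 < gaussian x := Real.exp_pos _

theorem continuous_gaussian : Continuous (gaussian : EuclideanSpace ℝ ι → ℝ) := by
  unfold gaussian
  fun_prop

theorem integrable_exp_neg_mul_norm_sq {b : ℝ} (hb : 0 < b) :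
    Integrable (fun x : EuclideanSpace ℝ ι => Real.exp (-b * ‖x‖ ^ 2)) := by
  have h := (GaussianFourier.integrable_cexp_neg_mul_sq_norm_add_of_euclideanSpace
    (b := (b : ℂ)) (by simpa using hb) 0 (0 : EuclideanSpace ℝ ι)).norm
  refine h.congr (Filter.Eventually.of_forall fun x => ?_)
  simp only [Complex.norm_exp]
  congr 1
  simp [← Complex.ofReal_pow]

/-- The polynomial factor is absorbed by `1 + s ≤ e^s`, which leaves the positive exponent `π - 1`.
-/
theorem integrable_of_le_gaussian {E : Type*} [NormedAddCommGroup E]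
    {f : EuclideanSpace ℝ ι → E} (hf : AEStronglyMeasurable f) {C : ℝ}
    (h : ∀ x, ‖f x‖ ≤ C * ((1 + ‖x‖ ^ 2) * gaussian x)) : Integrable f := by
  have hb : (0 : ℝ) < Real.pi - 1 := by linarith [Real.pi_gt_three]
  refine Integrable.mono' ((integrable_exp_neg_mul_norm_sq (ι := ι) hb).const_mul |C|) hf
    (Filter.Eventually.of_forall fun x => (h x).trans ?_)
  have h1 : (1 + ‖x‖ ^ 2) * gaussian x ≤ Real.exp (-(Real.pi - 1) * ‖x‖ ^ 2) := by
    have h2 : 1 + ‖x‖ ^ 2 ≤ Real.exp (‖x‖ ^ 2) := by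
      linarith [Real.add_one_le_exp (‖x‖ ^ 2)]
    calc _ ≤ Real.exp (‖x‖ ^ 2) * gaussian x := by
          gcongr
          exact (gaussian_pos x).le
      _ = _ := by
          rw [gaussian, ← Real.exp_add]
          congr 1
          ring
  have h3 : 0 ≤ (1 + ‖x‖ ^ 2) * gaussian x := by
    have := gaussian_pos x
    positivity
  exact mul_le_mul (le_abs_self C) h1 h3 (abs_nonneg C)

theorem hasFDerivAt_gaussian (x : EuclideanSpace ℝ ι) :
    HasFDerivAt gaussian ((-2 * Real.pi * gaussian x) • innerSL ℝ x) x := by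
  have h1 : HasFDerivAt (fun x : EuclideanSpace ℝ ι => -Real.pi * ‖x‖ ^ 2)
      ((-Real.pi) • (2 • innerSL ℝ x)) x :=
    (hasStrictFDerivAt_norm_sq x).hasFDerivAt.const_mul (-Real.pi)
  convert! h1.exp using 1
  ext y
  simp [gaussian]
  ring

theorem abs_apply_le_norm (x : EuclideanSpace ℝ ι) (q : ι) : |x q| ≤ ‖x‖ :=
  PiLp.norm_apply_le x q

theorem fourier_gaussian (w : EuclideanSpace ℝ ι) :
    𝓕 (fun x : EuclideanSpace ℝ ι => (gaussian x : ℂ)) w = (gaussian w : ℂ) := by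
  have h := fourier_gaussian_innerProductSpace (b := (Real.pi : ℂ))
    (by simpa using Real.pi_pos) w
  have h1 : (fun x : EuclideanSpace ℝ ι => (gaussian x : ℂ)) =
      fun v => Complex.exp (-(Real.pi : ℂ) * ‖v‖ ^ 2) := by
    funext x
    simp [gaussian]
  rw [h1, h]
  have hpi : (Real.pi : ℂ) ≠ 0 := by exact_mod_cast Real.pi_ne_zero
  rw [div_self hpi, Complex.one_cpow, one_mul, gaussian, Complex.ofReal_exp]
  congr 1
  push_cast
  field_simp

variable [DecidableEq ι]

theorem pderiv_gaussian (q : ι) (x : EuclideanSpace ℝ ι) :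
    pderiv q gaussian x = -2 * Real.pi * (x q * gaussian x) := by
  rw [pderiv, (hasFDerivAt_gaussian x).hasLineDerivAt _ |>.lineDeriv]
  simp [EuclideanSpace.inner_single_right]
  ring

theorem hasFDerivAt_pderiv_gaussian (q : ι) (x : EuclideanSpace ℝ ι) :
    HasFDerivAt (pderiv q gaussian)
      ((-2 * Real.pi) • (x q • ((-2 * Real.pi * gaussian x) • innerSL ℝ x) +
        gaussian x • (EuclideanSpace.proj q : EuclideanSpace ℝ ι →L[ℝ] ℝ))) x := by
  have h : pderiv q gaussian =
      fun x : EuclideanSpace ℝ ι => -2 * Real.pi * (x q * gaussian x) :=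
    funext fun x => pderiv_gaussian q x
  rw [h]
  have h1 : HasFDerivAt (fun x : EuclideanSpace ℝ ι => x q)
      (EuclideanSpace.proj q : EuclideanSpace ℝ ι →L[ℝ] ℝ) x :=
    (EuclideanSpace.proj q : EuclideanSpace ℝ ι →L[ℝ] ℝ).hasFDerivAt
  exact (h1.mul (hasFDerivAt_gaussian x)).const_mul _

theorem pderiv_pderiv_gaussian {p q : ι} (hpq : p ≠ q) (x : EuclideanSpace ℝ ι) :
    pderiv p (pderiv q gaussian) x = 4 * Real.pi ^ 2 * (x p * x q * gaussian x) := by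
  rw [pderiv, (hasFDerivAt_pderiv_gaussian q x).hasLineDerivAt _ |>.lineDeriv]
  simp [EuclideanSpace.inner_single_right, hpq.symm]
  ring

theorem fourier_ofReal_pderiv {f : EuclideanSpace ℝ ι → ℝ}
    {f' : EuclideanSpace ℝ ι → EuclideanSpace ℝ ι →L[ℝ] ℝ} (hf' : ∀ x, HasFDerivAt f (f' x) x)
    (hc : Continuous f') {C : ℝ} (h0 : ∀ x, |f x| ≤ C * ((1 + ‖x‖ ^ 2) * gaussian x))
    (h1 : ∀ x, ‖f' x‖ ≤ C * ((1 + ‖x‖ ^ 2) * gaussian x)) (q : ι) (w : EuclideanSpace ℝ ι) :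
    𝓕 (fun x => (pderiv q f x : ℂ)) w =
      2 * Real.pi * Complex.I * w q * 𝓕 (fun x => (f x : ℂ)) w := by
  have hd : ∀ x, HasFDerivAt (fun x => (f x : ℂ)) (Complex.ofRealCLM.comp (f' x)) x := fun x =>
    Complex.ofRealCLM.hasFDerivAt.comp x (hf' x)
  have hfd : fderiv ℝ (fun x => (f x : ℂ)) = fun x => Complex.ofRealCLM.comp (f' x) :=
    funext fun x => (hd x).fderiv
  have hcf : Continuous f := continuous_iff_continuousAt.2 fun x => (hf' x).continuousAt
  have hi0 : Integrable (fun x => (f x : ℂ)) :=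
    integrable_of_le_gaussian (by fun_prop) (C := C) (by simpa using h0)
  have hi1 : Integrable (fderiv ℝ (fun x => (f x : ℂ))) := by
    rw [hfd]
    refine integrable_of_le_gaussian (Continuous.aestronglyMeasurable (by fun_prop)) (C := C)
      fun x => le_trans ?_ (h1 x)
    refine (ContinuousLinearMap.opNorm_comp_le _ _).trans ?_
    simp
  have h := Real.fourier_fderiv hi0 (fun x => (hd x).differentiableAt) hi1
  have h2 := congrFun h w
  have h3 := congrArg (fun T => T (EuclideanSpace.single q 1)) h2
  rw [Real.fourier_continuousLinearMap_apply hi1] at h3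
  have h4 : (fun x => (pderiv q f x : ℂ)) =
      fun x => fderiv ℝ (fun x => (f x : ℂ)) x (EuclideanSpace.single q 1) := by
    funext x
    rw [hfd, pderiv, (hf' x).hasLineDerivAt _ |>.lineDeriv]
    simp
  rw [h4, h3, VectorFourier.fourierSMulRight_apply]
  have h5 : innerSL ℝ w (EuclideanSpace.single q (1 : ℝ)) = w q := by
    simp [innerSL_apply_apply, EuclideanSpace.inner_single_right]
  simp only [neg_apply, h5, neg_smul, neg_neg, smul_eq_mul,
    Complex.real_smul, neg_mul, mul_neg]
  ring

theorem fourier_pderiv_pderiv_gaussian (p q : ι) (w : EuclideanSpace ℝ ι) :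
    𝓕 (fun x => (pderiv p (pderiv q gaussian) x : ℂ)) w =
      (-(4 * Real.pi ^ 2) * (w p * w q * gaussian w) : ℝ) := by
  have hg := fun x : EuclideanSpace ℝ ι => gaussian_pos x
  have hpi := Real.pi_pos
  have hn : ∀ x : EuclideanSpace ℝ ι, ‖x‖ ≤ 1 + ‖x‖ ^ 2 := fun x => by
    nlinarith [sq_nonneg (‖x‖ - 1)]
  have hA : ∀ x : EuclideanSpace ℝ ι, ‖(-2 * Real.pi * gaussian x) • innerSL ℝ x‖ ≤
      2 * Real.pi * (‖x‖ * gaussian x) := fun x => by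
    rw [norm_smul, innerSL_apply_norm, Real.norm_eq_abs, abs_mul, abs_mul, abs_of_pos (hg x),
      abs_of_pos hpi]
    norm_num
    linarith
  rw [fourier_ofReal_pderiv (f := pderiv q gaussian)
    (f' := fun x => ((-2 * Real.pi) • (x q • ((-2 * Real.pi * gaussian x) • innerSL ℝ x) +
        gaussian x • (EuclideanSpace.proj q : EuclideanSpace ℝ ι →L[ℝ] ℝ))))
    (fun x => hasFDerivAt_pderiv_gaussian q x) ?_
    (C := 2 * Real.pi * (2 * Real.pi + 1)) ?_ ?_,
    fourier_ofReal_pderiv (f := gaussian)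
    (f' := fun x => (-2 * Real.pi * gaussian x) • innerSL ℝ x) hasFDerivAt_gaussian ?_
    (C := 2 * Real.pi + 1) ?_ ?_, fourier_gaussian]
  · push_cast
    ring_nf
    simp
  · have := continuous_gaussian (ι := ι)
    fun_prop
  · intro x
    rw [abs_of_pos (hg x)]
    have : 0 ≤ ‖x‖ ^ 2 * gaussian x := by have := hg x; positivity
    nlinarith [hg x]
  · intro x
    refine (hA x).trans ?_
    have := mul_le_mul_of_nonneg_right (hn x) (hg x).le
    have h2 : 0 ≤ (1 + ‖x‖ ^ 2) * gaussian x := by have := hg x; positivity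
    nlinarith
  · have := continuous_gaussian (ι := ι)
    fun_prop
  · intro x
    rw [pderiv_gaussian, abs_mul, abs_mul, abs_mul (x q), abs_of_pos (hg x), abs_of_pos hpi,
      abs_neg, abs_two]
    have h1 : |x q| * gaussian x ≤ (1 + ‖x‖ ^ 2) * gaussian x :=
      mul_le_mul_of_nonneg_right ((abs_apply_le_norm x q).trans (hn x)) (hg x).le
    have h2 : 0 ≤ (1 + ‖x‖ ^ 2) * gaussian x := by have := hg x; positivity
    calc _ ≤ 2 * Real.pi * ((1 + ‖x‖ ^ 2) * gaussian x) := by gcongr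
      _ ≤ _ := by
        rw [mul_assoc (2 * Real.pi)]
        refine mul_le_mul_of_nonneg_left ?_ (by positivity)
        nlinarith
  · intro x
    rw [norm_smul]
    have h1 : ‖x q • ((-2 * Real.pi * gaussian x) • innerSL ℝ x) +
        gaussian x • (EuclideanSpace.proj q : EuclideanSpace ℝ ι →L[ℝ] ℝ)‖ ≤
        ‖x‖ * (2 * Real.pi * (‖x‖ * gaussian x)) + gaussian x * 1 := by
      refine (norm_add_le _ _).trans (add_le_add ?_ ?_)
      · rw [norm_smul]
        exact mul_le_mul (abs_apply_le_norm x q) (hA x) (norm_nonneg _) (norm_nonneg _)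
      · rw [norm_smul, Real.norm_of_nonneg (hg x).le]
        refine mul_le_mul_of_nonneg_left ?_ (hg x).le
        exact ContinuousLinearMap.opNorm_le_bound _ zero_le_one
          fun y => by simpa using abs_apply_le_norm y q
    have h3 : ‖-2 * Real.pi‖ = 2 * Real.pi := by
      rw [Real.norm_eq_abs, abs_mul, abs_neg, abs_two, abs_of_pos hpi]
    rw [h3, mul_assoc (2 * Real.pi)]
    refine mul_le_mul_of_nonneg_left (h1.trans ?_) (by positivity)
    have : 0 ≤ ‖x‖ ^ 2 * gaussian x := by have := hg x; positivity
    nlinarith [hg x, mul_pos hpi (hg x)]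

end Gaussian

/-! ### The symbol of `g_{i,k₁,k₂}` and the oscillation at a scale -/

variable {m d : ℕ}

theorem gaussianDeriv_apply (i : Fin m) (k₁ k₂ : Fin d) (x : BlockVec (Fin m ⊕ Fin m) d) :
    gaussianDeriv i k₁ k₂ x =
      4 * Real.pi ^ 2 * (x (Sum.inl i, k₁) * x (Sum.inr i, k₂) * gaussian x) :=
  pderiv_pderiv_gaussian (by simp) x

theorem integrable_gaussianDeriv (i : Fin m) (k₁ k₂ : Fin d) :
    Integrable (gaussianDeriv i k₁ k₂ : BlockVec (Fin m ⊕ Fin m) d → ℝ) := by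
  have h : (gaussianDeriv i k₁ k₂ : BlockVec (Fin m ⊕ Fin m) d → ℝ) = fun x =>
      4 * Real.pi ^ 2 * (x (Sum.inl i, k₁) * x (Sum.inr i, k₂) * gaussian x) :=
    funext fun x => gaussianDeriv_apply i k₁ k₂ x
  have := continuous_gaussian (ι := (Fin m ⊕ Fin m) × Fin d)
  rw [h]
  refine integrable_of_le_gaussian (Continuous.aestronglyMeasurable (by fun_prop))
    (C := 4 * Real.pi ^ 2) fun x => ?_
  rw [norm_mul, norm_mul (_ * _) (gaussian x), norm_mul (x _),
    Real.norm_of_nonneg (gaussian_pos x).le,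
    Real.norm_of_nonneg (show (0 : ℝ) ≤ 4 * Real.pi ^ 2 by positivity)]
  refine mul_le_mul_of_nonneg_left (mul_le_mul_of_nonneg_right ?_ (gaussian_pos x).le)
    (by positivity)
  calc _ ≤ ‖x‖ * ‖x‖ := mul_le_mul (abs_apply_le_norm x _) (abs_apply_le_norm x _)
        (abs_nonneg _) (norm_nonneg _)
    _ ≤ _ := by nlinarith

/-- The Fourier transform of `g_{i,k₁,k₂}` at `(I A)ᵀ ξ`. -/
def symb (A : Matrix (Fin m) (Fin m) ℝ) (i : Fin m) (k₁ k₂ : Fin d) (ξ : BlockVec (Fin m) d) :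
    ℝ :=
  -(4 * Real.pi ^ 2) * (ξ (i, k₁) * blockAct A.transpose ξ (i, k₂) *
    Real.exp (-Real.pi * (‖ξ‖ ^ 2 + ‖blockAct A.transpose ξ‖ ^ 2)))

theorem blockAct_pairMat_transpose_inl (A : Matrix (Fin m) (Fin m) ℝ) (ξ : BlockVec (Fin m) d)
    (i : Fin m) (k : Fin d) : blockAct (pairMat A).transpose ξ (Sum.inl i, k) = ξ (i, k) := by
  simp [blockAct_apply, pairMat, Matrix.one_apply]

theorem blockAct_pairMat_transpose_inr (A : Matrix (Fin m) (Fin m) ℝ) (ξ : BlockVec (Fin m) d)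
    (i : Fin m) (k : Fin d) :
    blockAct (pairMat A).transpose ξ (Sum.inr i, k) = blockAct A.transpose ξ (i, k) := by
  simp [blockAct_apply, pairMat]

theorem norm_sq_blockAct_pairMat_transpose (A : Matrix (Fin m) (Fin m) ℝ)
    (ξ : BlockVec (Fin m) d) : ‖blockAct (pairMat A).transpose ξ‖ ^ 2 =
      ‖ξ‖ ^ 2 + ‖blockAct A.transpose ξ‖ ^ 2 := by
  simp only [EuclideanSpace.norm_sq_eq, Fintype.sum_prod_type, Fintype.sum_sum_type,
    blockAct_pairMat_transpose_inl, blockAct_pairMat_transpose_inr]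

theorem fourier_gaussianDeriv (A : Matrix (Fin m) (Fin m) ℝ) (i : Fin m) (k₁ k₂ : Fin d)
    (ξ : BlockVec (Fin m) d) :
    𝓕 (fun x : BlockVec (Fin m ⊕ Fin m) d => (gaussianDeriv i k₁ k₂ x : ℂ))
      (blockAct (pairMat A).transpose ξ) = symb A i k₁ k₂ ξ := by
  have h := fourier_pderiv_pderiv_gaussian (Sum.inl i, k₁) (Sum.inr i, k₂)
    (blockAct (pairMat A).transpose ξ)
  rw [blockAct_pairMat_transpose_inl, blockAct_pairMat_transpose_inr, gaussian,
    norm_sq_blockAct_pairMat_transpose] at h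
  exact h

theorem continuous_symb (A : Matrix (Fin m) (Fin m) ℝ) (i : Fin m) (k₁ k₂ : Fin d) :
    Continuous (symb A i k₁ k₂ : BlockVec (Fin m) d → ℝ) := by
  unfold symb
  fun_prop

/-- The oscillation of the push-forward at scale `t`, with shift `u`. -/
def osc (A : Matrix (Fin m) (Fin m) ℝ) (F : Cube m → 𝓢(BlockVec (Fin m) d, ℝ)) (i : Fin m)
    (k₁ k₂ : Fin d) (t : ℝ) (u : BlockVec (Fin m) d) : ℂ :=
  pairing (fun ξ => symb A i k₁ k₂ (t • ξ) *
    Complex.exp (2 * Real.pi * Complex.I * (inner ℝ u (t • ξ) : ℝ))) A F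

theorem scaleMat_const {t : ℝ} (ht : 0 < t) (A : Matrix (Fin m) (Fin m) ℝ) :
    scaleMat (fun _ => t) A = A := by
  ext r s
  rw [scaleMat_apply]
  field_simp

theorem blockAct_diagonal_const (t : ℝ) (ξ : BlockVec (Fin m) d) :
    blockAct (Matrix.diagonal fun _ : Fin m => t) ξ = t • ξ := by
  ext ⟨i, k⟩
  rw [blockAct_diagonal]
  rfl

/-- Isotropic dilations commute with `A`, so only the tuple changes; estimates at scale one thus
hold at every scale. -/
theorem osc_eq_osc_one (A : Matrix (Fin m) (Fin m) ℝ) (F : Cube m → 𝓢(BlockVec (Fin m) d, ℝ))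
    (i : Fin m) (k₁ k₂ : Fin d) {t : ℝ} (ht : 0 < t) (u : BlockVec (Fin m) d) :
    osc A F i k₁ k₂ t u = osc A (scaleTuple (fun _ => t) (fun _ => ht) F) i k₁ k₂ 1 u := by
  have h := pairing_scaleTuple (fun _ => t) (fun _ => ht) (fun ξ => symb A i k₁ k₂ ξ *
    Complex.exp (2 * Real.pi * Complex.I * (inner ℝ u ξ : ℝ))) A F
  simp only [blockAct_diagonal_const, scaleMat_const ht] at h
  simp only [osc, one_smul]
  exact h.symm

/-- Parseval: the adjoint moves `(I A)ᵀ` from the frequency to `(I A)` on the space side, and the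
modulation with `u` becomes a translation by `u`. -/
theorem osc_one_eq_integral (A : Matrix (Fin m) (Fin m) ℝ)
    (F : Cube m → 𝓢(BlockVec (Fin m) d, ℝ))
    (i : Fin m) (k₁ k₂ : Fin d) (u : BlockVec (Fin m) d) :
    osc A F i k₁ k₂ 1 u = ∫ x : BlockVec (Fin m ⊕ Fin m) d,
      (gaussianDeriv i k₁ k₂ x : ℂ) * pushforward A F (blockAct (pairMat A) x - u) := by
  have hinv : ∀ y, pushforward A F y =
      ∫ ξ, Complex.exp (↑(-2 * Real.pi * inner ℝ ξ y) * Complex.I) * invPush A F ξ := by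
    intro y
    have h : pushforward A F = 𝓕 (invPush A F) := by
      rw [invPush, FourierTransform.fourier_fourierInv_eq]
    conv_lhs => rw [h, SchwartzMap.fourier_coe, Real.fourier_eq']
    rfl
  simp only [osc, pairing, one_smul]
  simp only [← fourier_gaussianDeriv, Real.fourier_eq', smul_eq_mul]
  simp only [hinv, ← integral_const_mul, ← integral_mul_const]
  rw [integral_integral_swap]
  · refine integral_congr_ae (Filter.Eventually.of_forall fun x => ?_)
    refine integral_congr_ae (Filter.Eventually.of_forall fun ξ => ?_)
    simp only
    have h : Complex.exp (↑(-2 * Real.pi * inner ℝ x (blockAct (pairMat A).transpose ξ)) *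
        Complex.I) * Complex.exp (2 * Real.pi * Complex.I * (inner ℝ u ξ : ℝ)) =
        Complex.exp (↑(-2 * Real.pi * inner ℝ ξ (blockAct (pairMat A) x - u)) * Complex.I) := by
      rw [← Complex.exp_add, ← inner_blockAct, inner_sub_right, real_inner_comm ξ,
        real_inner_comm ξ]
      congr 1
      push_cast
      ring
    rw [← h]
    ring
  · have h1 : Integrable (fun z : BlockVec (Fin m) d × BlockVec (Fin m ⊕ Fin m) d =>
        invPush A F z.1 * (gaussianDeriv i k₁ k₂ z.2 : ℂ)) :=
      (invPush A F).integrable.mul_prod (integrable_gaussianDeriv i k₁ k₂).ofReal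
    have h2 := h1.bdd_mul (c := 1) (f := fun z : BlockVec (Fin m) d × BlockVec (Fin m ⊕ Fin m) d =>
      Complex.exp (↑(-2 * Real.pi * inner ℝ z.2 (blockAct (pairMat A).transpose z.1)) *
        Complex.I) * Complex.exp (2 * Real.pi * Complex.I * (inner ℝ u z.1 : ℝ)))
      (Continuous.aestronglyMeasurable (by fun_prop))
      (Filter.Eventually.of_forall fun z => by
        have e : (2 * Real.pi * Complex.I * (inner ℝ u z.1 : ℝ) : ℂ) =
          ((2 * Real.pi * inner ℝ u z.1 : ℝ) : ℂ) * Complex.I := by push_cast; ring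
        rw [norm_mul, e, Complex.norm_exp_ofReal_mul_I, Complex.norm_exp_ofReal_mul_I, one_mul])
    refine h2.congr (Filter.Eventually.of_forall fun z => ?_)
    simp only [Function.uncurry]
    ring

/-! ### The value of the push-forward at the origin -/

/-- With `P` the diagonal projection to the indices where `j` is one, the matrices are `1 + P(A -
1)` and `1 + (A - 1)P`; their determinants agree by Sylvester's identity. -/
theorem det_ite_row_eq_det_ite_col (A : Matrix (Fin m) (Fin m) ℝ) (j : Cube m) :
    (Matrix.of fun r s => if j r then A r s else (1 : Matrix (Fin m) (Fin m) ℝ) r s).det =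
      (Matrix.of fun r s => if j s then A r s else (1 : Matrix (Fin m) (Fin m) ℝ) r s).det := by
  have h := Matrix.det_one_add_mul_comm (Matrix.diagonal fun r => if j r then (1 : ℝ) else 0)
    (A - 1)
  convert h using 2
  · ext r s
    simp only [Matrix.of_apply, Matrix.add_apply, Matrix.diagonal_mul, Matrix.sub_apply]
    split_ifs <;> ring
  · ext r s
    simp only [Matrix.of_apply, Matrix.add_apply, Matrix.mul_diagonal, Matrix.sub_apply]
    split_ifs <;> ring

/-- The matrix of `z ↦ Π_j (-A z, z)`. -/
def fiberMat (A : Matrix (Fin m) (Fin m) ℝ) (j : Cube m) : Matrix (Fin m) (Fin m) ℝ :=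
  Matrix.of fun r s => if j r then (1 : Matrix (Fin m) (Fin m) ℝ) r s else -A r s

/-- Up to signs of rows, the left matrix takes its rows from `A` where `j` is zero and from `I`
where `j` is one. Exchanging rows for columns gives the determinant in the hypothesis, for the
complement of `j`. -/
theorem abs_det_fiberMat (A : Matrix (Fin m) (Fin m) ℝ) (j : Cube m) :
    |(fiberMat A j).det| = |(pairMat A * (projMat fun r => !j r).transpose).det| := by
  have h1 : fiberMat A j = Matrix.diagonal (fun r => if j r then (1 : ℝ) else -1) *
      (Matrix.of fun r s => if (!j r) then A r s else (1 : Matrix (Fin m) (Fin m) ℝ) r s) := by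
    ext r s
    rw [Matrix.diagonal_mul, fiberMat, Matrix.of_apply, Matrix.of_apply]
    cases j r <;> simp
  have h2 : pairMat A * (projMat fun r => !j r).transpose =
      Matrix.of fun r s => if (!j s) then A r s else (1 : Matrix (Fin m) (Fin m) ℝ) r s := by
    ext r s
    rw [pairMat_mul_projMat, Matrix.of_apply]
  rw [h1, Matrix.det_mul, det_ite_row_eq_det_ite_col A fun r => !j r, ← h2, abs_mul,
    Matrix.det_diagonal, Finset.abs_prod]
  have : ∀ r, |if j r then (1 : ℝ) else -1| = 1 := fun r => by split_ifs <;> simp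
  simp [this]

theorem projMat_fiberPt_zero (A : Matrix (Fin m) (Fin m) ℝ) (j : Cube m)
    (z : BlockVec (Fin m) d) :
    blockAct (projMat j) (fiberPt A (0, z)) = blockAct (fiberMat A j) z := by
  ext ⟨r, k⟩
  rw [projMat_act, blockAct_apply]
  cases h : j r
  · simp [fiberPt_inl, blockAct_apply, fiberMat, h]
  · simp [fiberPt_inr, fiberMat, h, Matrix.one_apply]

/-- On the fibre over the origin each `F_j` is composed with an invertible matrix whose determinant
is at least `ε` in modulus. The Hölder exponents are all equal, so a product of `2^m` numbers can
simply be bounded by the sum of their `2^m`-th powers. -/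
theorem norm_pushforward_zero_le {S : Finset (Fin m)} {ε R : ℝ} (hε : 0 < ε)
    {A : Matrix (Fin m) (Fin m) ℝ} (hA : Admissible S ε R A)
    {F : Cube m → 𝓢(BlockVec (Fin m) d, ℝ)} (hF : SymTuple S F) :
    ‖pushforward A F 0‖ ≤ 2 ^ (2 ^ m) * (ε ^ d)⁻¹ := by
  have hdet : ∀ j, ε ≤ |(fiberMat A j).det| := fun j => by
    rw [abs_det_fiberMat]
    exact hA.det _
  have hne : ∀ j, (fiberMat A j).det ≠ 0 := fun j => abs_pos.1 (hε.trans_le (hdet j))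
  have h1 : ‖pushforward A F 0‖ₑ ≤ ∫⁻ z, ∑ j, ‖F j (blockAct (fiberMat A j) z)‖ₑ ^ (2 ^ m) := by
    rw [pushforward_apply]
    refine (enorm_integral_le_lintegral_enorm _).trans (lintegral_mono fun z => ?_)
    simp only [cubeProd, projMat_fiberPt_zero, Complex.ofReal_prod]
    rw [enorm_eq_nnnorm, nnnorm_prod]
    push_cast
    obtain ⟨j₀, -, hj₀⟩ := Finset.exists_max_image (Finset.univ : Finset (Cube m))
      (fun j => ‖F j (blockAct (fiberMat A j) z)‖ₑ) Finset.univ_nonempty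
    calc ∏ j, (‖((F j (blockAct (fiberMat A j) z) : ℝ) : ℂ)‖₊ : ℝ≥0∞)
        ≤ ∏ _j : Cube m, ‖F j₀ (blockAct (fiberMat A j₀) z)‖ₑ := by
          refine Finset.prod_le_prod' fun j _ => ?_
          refine le_trans (le_of_eq ?_) (hj₀ j (Finset.mem_univ j))
          rw [Complex.nnnorm_real, enorm_eq_nnnorm]
      _ = ‖F j₀ (blockAct (fiberMat A j₀) z)‖ₑ ^ (2 ^ m) := by
          simp [Finset.card_univ]
      _ ≤ _ := Finset.single_le_sum
          (f := fun j => ‖F j (blockAct (fiberMat A j) z)‖ₑ ^ (2 ^ m))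
          (fun _ _ => zero_le) (Finset.mem_univ j₀)
  have h2 : ∫⁻ z, ∑ j, ‖F j (blockAct (fiberMat A j) z)‖ₑ ^ (2 ^ m) ≤
      ∑ _j : Cube m, ENNReal.ofReal ((ε ^ d)⁻¹) := by
    rw [lintegral_finsetSum' (f := fun j z => ‖F j (blockAct (fiberMat A j) z)‖ₑ ^ (2 ^ m)) _
      fun j _ => (((F j).continuous.comp (blockAct (fiberMat A j)).continuous).measurable.enorm.pow_const
        _).aemeasurable]
    refine Finset.sum_le_sum fun j _ => ?_
    rw [lintegral_comp_blockAct _ (hne j) (fun z => ‖F j z‖ₑ ^ (2 ^ m))]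
    calc _ ≤ ENNReal.ofReal ((ε ^ d)⁻¹) * 1 := by
          gcongr
          · exact hdet j
          · exact hF.norm j
      _ = _ := mul_one _
  have h3 := h1.trans h2
  rw [Finset.sum_const, Finset.card_univ, Fintype.card_fun, Fintype.card_bool, Fintype.card_fin,
    ← ofReal_norm, nsmul_eq_mul] at h3
  have h4 : ((2 ^ m : ℕ) : ℝ≥0∞) * ENNReal.ofReal ((ε ^ d)⁻¹) =
      ENNReal.ofReal (2 ^ m * (ε ^ d)⁻¹) := by
    rw [ENNReal.ofReal_mul (by positivity)]
    congr 1
    rw [ENNReal.ofReal_pow (by norm_num)]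
    simp
  rw [h4, ENNReal.ofReal_le_ofReal_iff (by positivity)] at h3
  -- The sum has `2^m` terms; the constant is rounded up to `2^(2^m)`.
  refine h3.trans ?_
  gcongr
  · norm_num
  · exact (Nat.lt_two_pow_self).le

end CubicalBL

end

noncomputable section

namespace CubicalBL

variable {m d : ℕ}

/-! ### Separating the coordinates `x_i^0` and `x_i^1` from the others -/

/-- The index set of the coordinates other than those of `x_i^0` and `x_i^1`. -/
abbrev RestIdx (i : Fin m) (d : ℕ) : Type :=
  {p : (Fin m ⊕ Fin m) × Fin d // p.1 ≠ Sum.inl i ∧ p.1 ≠ Sum.inr i}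

/-- The decomposition of the coordinates into those other than `x_i^0`, `x_i^1`, those of `x_i^0`,
and those of `x_i^1`. -/
def splitIdx (i : Fin m) (d : ℕ) : RestIdx i d ⊕ (Fin d ⊕ Fin d) ≃ (Fin m ⊕ Fin m) × Fin d where
  toFun := Sum.elim (fun p => p.1)
    (Sum.elim (fun k => (Sum.inl i, k)) (fun k => (Sum.inr i, k)))
  invFun p := if h0 : p.1 = Sum.inl i then Sum.inr (Sum.inl p.2)
    else if h1 : p.1 = Sum.inr i then Sum.inr (Sum.inr p.2) else Sum.inl ⟨p, h0, h1⟩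
  left_inv := by
    rintro (⟨p, h0, h1⟩ | k | k)
    · simp [h0, h1]
    · simp
    · simp
  right_inv := by
    rintro ⟨p, k⟩
    by_cases h0 : p = Sum.inl i
    · simp [h0]
    · by_cases h1 : p = Sum.inr i
      · simp [h1]
      · simp [h0, h1]

/-- The point of `(ℝ^d)^{2m}` with `x_i^0 = a`, `x_i^1 = b` and other coordinates `y`. -/
def join (i : Fin m) (y : RestIdx i d → ℝ) (a b : Fin d → ℝ) : BlockVec (Fin m ⊕ Fin m) d :=
  WithLp.toLp 2 fun p => if h0 : p.1 = Sum.inl i then a p.2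
    else if h1 : p.1 = Sum.inr i then b p.2 else y ⟨p, h0, h1⟩

theorem join_inl (i : Fin m) (y : RestIdx i d → ℝ) (a b : Fin d → ℝ) (k : Fin d) :
    join i y a b (Sum.inl i, k) = a k := by simp [join]

theorem join_inr (i : Fin m) (y : RestIdx i d → ℝ) (a b : Fin d → ℝ) (k : Fin d) :
    join i y a b (Sum.inr i, k) = b k := by simp [join]

theorem join_rest (i : Fin m) (y : RestIdx i d → ℝ) (a b : Fin d → ℝ) (p : RestIdx i d) :
    join i y a b p.1 = y p := by simp [join, p.2.1, p.2.2]

/-- `join` as a measurable equivalence. -/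
def joinEquiv (i : Fin m) (d : ℕ) :
    (RestIdx i d → ℝ) × ((Fin d → ℝ) × (Fin d → ℝ)) ≃ᵐ BlockVec (Fin m ⊕ Fin m) d :=
  (((MeasurableEquiv.refl _).prodCongr
    (MeasurableEquiv.sumPiEquivProdPi fun _ : Fin d ⊕ Fin d => ℝ).symm).trans
    (MeasurableEquiv.sumPiEquivProdPi
      fun _ : RestIdx i d ⊕ (Fin d ⊕ Fin d) => ℝ).symm).trans
    ((MeasurableEquiv.piCongrLeft (fun _ => ℝ) (splitIdx i d)).trans
      (MeasurableEquiv.toLp 2 _))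

theorem joinEquiv_apply (i : Fin m) (z : (RestIdx i d → ℝ) × ((Fin d → ℝ) × (Fin d → ℝ))) :
    joinEquiv i d z = join i z.1 z.2.1 z.2.2 := by
  have h : ∀ q, joinEquiv i d z (splitIdx i d q) = join i z.1 z.2.1 z.2.2 (splitIdx i d q) := by
    intro q
    have h1 : joinEquiv i d z (splitIdx i d q) =
        (MeasurableEquiv.sumPiEquivProdPi fun _ : RestIdx i d ⊕ (Fin d ⊕ Fin d) => ℝ).symm
          (z.1, (MeasurableEquiv.sumPiEquivProdPi fun _ : Fin d ⊕ Fin d => ℝ).symm z.2) q :=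
      MeasurableEquiv.piCongrLeft_apply_apply (splitIdx i d) _ q
    rw [h1]
    rcases q with p | k | k
    · exact (join_rest i z.1 z.2.1 z.2.2 p).symm
    · exact (join_inl i z.1 z.2.1 z.2.2 k).symm
    · exact (join_inr i z.1 z.2.1 z.2.2 k).symm
  ext p
  obtain ⟨q, rfl⟩ := (splitIdx i d).surjective p
  exact h q

theorem measurePreserving_joinEquiv (i : Fin m) (d : ℕ) :
    MeasurePreserving (joinEquiv i d) volume volume := by
  refine MeasurePreserving.trans (MeasurePreserving.trans
    (MeasurePreserving.prod (MeasurePreserving.id _)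
      (volume_measurePreserving_sumPiEquivProdPi_symm _))
    (volume_measurePreserving_sumPiEquivProdPi_symm _))
    (MeasurePreserving.trans (volume_measurePreserving_piCongrLeft _ _)
      (PiLp.volume_preserving_toLp _))

/-- The product of the `F_j(Π_j x)` over the `j ∈ Q` with `j(i) = 0`. -/
def halfProd (i : Fin m) (F : Cube m → 𝓢(BlockVec (Fin m) d, ℝ))
    (x : BlockVec (Fin m ⊕ Fin m) d) : ℝ :=
  ∏ j ∈ Finset.univ.filter fun j : Cube m => j i = false, F j (blockAct (projMat j) x)

/-- The half product reads neither the entry `x_i^1` nor the `F_j` with `j(i) = 1`; every later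
decoupling of `x_i^0` from `x_i^1` rests on this. -/
theorem halfProd_congr (i : Fin m) {F F' : Cube m → 𝓢(BlockVec (Fin m) d, ℝ)}
    (hF : ∀ j, j i = false → F j = F' j) {x x' : BlockVec (Fin m ⊕ Fin m) d}
    (hx : ∀ p k, p ≠ Sum.inr i → x (p, k) = x' (p, k)) :
    halfProd i F x = halfProd i F' x' := by
  refine Finset.prod_congr rfl fun j hj => ?_
  rw [Finset.mem_filter] at hj
  rw [hF j hj.2]
  congr 1
  ext ⟨r, k⟩
  rw [projMat_act, projMat_act]
  refine hx _ _ ?_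
  by_cases h : r = i
  · subst h
    simp [hj.2]
  · split_ifs <;> simp [h]

/-- The involution of `(ℝ^d)^{2m}` that exchanges `x_i^0` and `x_i^1`. -/
def swapVec (i : Fin m) (x : BlockVec (Fin m ⊕ Fin m) d) : BlockVec (Fin m ⊕ Fin m) d :=
  WithLp.toLp 2 fun p => x (Equiv.swap (Sum.inl i) (Sum.inr i) p.1, p.2)

theorem swapVec_apply (i : Fin m) (x : BlockVec (Fin m ⊕ Fin m) d) (p : Fin m ⊕ Fin m)
    (k : Fin d) : swapVec i x (p, k) = x (Equiv.swap (Sum.inl i) (Sum.inr i) p, k) := rfl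

/-- The reflected tuple `j ↦ F_{i * j}`. -/
def reflTuple (i : Fin m) (F : Cube m → 𝓢(BlockVec (Fin m) d, ℝ)) :
    Cube m → 𝓢(BlockVec (Fin m) d, ℝ) := fun j => F (j.reflect i)

theorem Cube.reflect_reflect (i : Fin m) (j : Cube m) : (j.reflect i).reflect i = j := by
  funext r
  by_cases h : r = i
  · subst h; simp [Cube.reflect]
  · simp [Cube.reflect, h]

theorem projMat_swapVec (i : Fin m) (j : Cube m) (x : BlockVec (Fin m ⊕ Fin m) d) :
    blockAct (projMat j) (swapVec i x) = blockAct (projMat (j.reflect i)) x := by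
  ext ⟨r, k⟩
  have key : Equiv.swap (Sum.inl i) (Sum.inr i) (if j r then Sum.inr r else Sum.inl r) =
      if (j.reflect i) r then Sum.inr r else Sum.inl r := by
    by_cases h : r = i
    · subst h
      cases hj : j r <;> simp [Cube.reflect, hj]
    · have h1 : (Sum.inl r : Fin m ⊕ Fin m) ≠ Sum.inl i := by simpa using h
      have h2 : (Sum.inr r : Fin m ⊕ Fin m) ≠ Sum.inr i := by simpa using h
      cases hj : j r <;> simp [Cube.reflect, hj, h, h1, h2, Equiv.swap_apply_of_ne_of_ne]
  rw [projMat_act, projMat_act, swapVec_apply, key]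

/-- The reflection `j ↦ i * j` turns the factors with `j(i) = 1` into factors with `j(i) = 0` of the
reflected tuple at the swapped point. Both halves thus become instances of one expression, and can
be compared. -/
theorem cubeProd_eq_halfProd_mul (i : Fin m) (F : Cube m → 𝓢(BlockVec (Fin m) d, ℝ))
    (x : BlockVec (Fin m ⊕ Fin m) d) :
    cubeProd F x = halfProd i F x * halfProd i (reflTuple i F) (swapVec i x) := by
  rw [cubeProd, ← Finset.prod_filter_mul_prod_filter_not Finset.univ
    (fun j : Cube m => j i = false)]
  congr 1
  refine Finset.prod_nbij' (fun j => j.reflect i) (fun j => j.reflect i) ?_ ?_ ?_ ?_ ?_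
  · intro j hj
    simpa [Cube.reflect] using hj
  · intro j hj
    simpa [Cube.reflect] using hj
  · intro j _
    exact Cube.reflect_reflect i j
  · intro j _
    exact Cube.reflect_reflect i j
  · intro j _
    simp only [reflTuple, Cube.reflect_reflect, projMat_swapVec]

/-- The matrix `B` with the rows belonging to `x_i^0` and `x_i^1` exchanged. -/
def swapMat (i : Fin m) (B : Matrix (Fin m ⊕ Fin m) (Fin m) ℝ) :
    Matrix (Fin m ⊕ Fin m) (Fin m) ℝ :=
  B.submatrix (Equiv.swap (Sum.inl i) (Sum.inr i)) id

theorem swapVec_add_blockAct (i : Fin m) (B : Matrix (Fin m ⊕ Fin m) (Fin m) ℝ)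
    (x v : BlockVec (Fin m ⊕ Fin m) d) (p : BlockVec (Fin m) d) :
    swapVec i (x + v + blockAct B p) =
      swapVec i x + swapVec i v + blockAct (swapMat i B) p := by
  ext ⟨r, k⟩
  simp [swapVec_apply, blockAct_apply, swapMat]

/-! ### Energies -/

/-- The one-dimensional factor `a ↦ a_k e^{-π|a|²}` of the derivative of the Gaussian. -/
def slotGauss (k : Fin d) (a : Fin d → ℝ) : ℝ := a k * Real.exp (-Real.pi * ∑ q, a q ^ 2)

/-- The integral in `x_i^0` of the factors that depend on `x_i^0`. -/
def slotInt (i : Fin m) (B : Matrix (Fin m ⊕ Fin m) (Fin m) ℝ) (v : BlockVec (Fin m ⊕ Fin m) d)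
    (F : Cube m → 𝓢(BlockVec (Fin m) d, ℝ)) (k : Fin d)
    (w : BlockVec (Fin m) d × (RestIdx i d → ℝ)) : ℝ :=
  ∫ a : Fin d → ℝ, slotGauss k a * halfProd i F (join i w.2 a 0 + v + blockAct B w.1)

/-- The energy `∫∫ W(y) ∏_{j} F_j(Π_j(x + v + B p)) (x_i^0)_{k₁} (x_i^1)_{k₂}
e^{-π(|x_i^0|² + |x_i^1|²)} dx dp`, with the integrals in `x_i^0` and `x_i^1` separated. -/
def energy (i : Fin m) (W : (RestIdx i d → ℝ) → ℝ) (B : Matrix (Fin m ⊕ Fin m) (Fin m) ℝ)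
    (v : BlockVec (Fin m ⊕ Fin m) d) (F : Cube m → 𝓢(BlockVec (Fin m) d, ℝ)) (k₁ k₂ : Fin d) :
    ℝ :=
  ∫ w : BlockVec (Fin m) d × (RestIdx i d → ℝ), W w.2 *
    (slotInt i B v F k₁ w * slotInt i (swapMat i B) (swapVec i v) (reflTuple i F) k₂ w)

/-- The rows of `B` belonging to `x^1`. -/
def lowerMat (B : Matrix (Fin m ⊕ Fin m) (Fin m) ℝ) : Matrix (Fin m) (Fin m) ℝ :=
  B.submatrix Sum.inr id

/-- The weight in the energy as a function on `(ℝ^d)^{2m}`. -/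
def energyWeight (i : Fin m) (W : (RestIdx i d → ℝ) → ℝ) (k₁ k₂ : Fin d)
    (x : BlockVec (Fin m ⊕ Fin m) d) : ℝ :=
  W (fun p => x p.1) * (slotGauss k₁ (fun q => x (Sum.inl i, q)) *
    slotGauss k₂ (fun q => x (Sum.inr i, q)))

/-- Decay in `x^1` alone is enough: in the integrals below, the fibre parameter moves `x^1` through
an invertible matrix. -/
theorem cubeProd_bound (F : Cube m → 𝓢(BlockVec (Fin m) d, ℝ)) : ∃ C : ℝ, ∀ x,
    |cubeProd F x| ≤ C * (1 + ‖blockAct (projMat fun _ => true) x‖) ^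
      (-((volume : Measure (BlockVec (Fin m) d)).integrablePower : ℝ)) := by
  set N := (volume : Measure (BlockVec (Fin m) d)).integrablePower
  obtain ⟨C0, h0⟩ := cubeProd_decay F 0 0
  obtain ⟨C1, h1⟩ := cubeProd_decay F N 0
  refine ⟨2 ^ N * (C0 + C1), fun x => ?_⟩
  have h0 := h0 x
  have h1 := h1 x
  rw [norm_iteratedFDeriv_zero, Real.norm_eq_abs] at h0 h1
  rw [pow_zero, one_mul] at h0
  rw [Real.rpow_neg (by positivity), Real.rpow_natCast, ← div_eq_mul_inv,
    le_div_iff₀ (by positivity)]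
  have hx : ‖blockAct (projMat fun _ => true) x‖ ≤ ‖x‖ := by
    refine le_of_sq_le_sq ?_ (norm_nonneg _)
    simp only [EuclideanSpace.norm_sq_eq, Fintype.sum_prod_type, projMat_act,
      Fintype.sum_sum_type, if_true]
    have : 0 ≤ ∑ r : Fin m, ∑ k : Fin d, ‖x (Sum.inl r, k)‖ ^ 2 := by positivity
    linarith
  have h2 : (1 + ‖blockAct (projMat fun _ => true) x‖) ^ N ≤ 2 ^ N * (1 + ‖x‖ ^ N) := by
    calc _ ≤ (1 + ‖x‖) ^ N := by gcongr
      _ ≤ 2 ^ (N - 1) * (1 ^ N + ‖x‖ ^ N) := add_pow_le zero_le_one (norm_nonneg _) N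
      _ ≤ _ := by
        rw [one_pow]
        gcongr
        · norm_num
        · omega
  calc |cubeProd F x| * (1 + ‖blockAct (projMat fun _ => true) x‖) ^ N
      ≤ |cubeProd F x| * (2 ^ N * (1 + ‖x‖ ^ N)) := by gcongr
    _ = 2 ^ N * (|cubeProd F x| + ‖x‖ ^ N * |cubeProd F x|) := by ring
    _ ≤ _ := by gcongr

theorem continuous_cubeProd (F : Cube m → 𝓢(BlockVec (Fin m) d, ℝ)) : Continuous (cubeProd F) :=
  (cubeProd_contDiff F).continuous

/-- The `x^1` part of `x + v + B p` is `lowerMat B p` plus a function of `x`. Invertibility makes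
the `p`-integral of the majorant independent of `x`, and `G` takes care of the integration in `x`.
-/
theorem integrable_mul_cubeProd {G : BlockVec (Fin m ⊕ Fin m) d → ℝ} (hG : Integrable G)
    (B : Matrix (Fin m ⊕ Fin m) (Fin m) ℝ) (hB : (lowerMat B).det ≠ 0)
    (v : BlockVec (Fin m ⊕ Fin m) d) (F : Cube m → 𝓢(BlockVec (Fin m) d, ℝ)) :
    Integrable fun z : BlockVec (Fin m ⊕ Fin m) d × BlockVec (Fin m) d =>
      G z.1 * cubeProd F (z.1 + v + blockAct B z.2) := by
  have hcont := continuous_cubeProd F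
  have hmeas : AEStronglyMeasurable
      (fun z : BlockVec (Fin m ⊕ Fin m) d × BlockVec (Fin m) d =>
        G z.1 * cubeProd F (z.1 + v + blockAct B z.2)) :=
    hG.aestronglyMeasurable.comp_fst.mul (Continuous.aestronglyMeasurable (by fun_prop))
  obtain ⟨C, hC⟩ := cubeProd_bound F
  set φ : BlockVec (Fin m) d → ℝ := fun z => C * (1 + ‖z‖) ^
      (-((volume : Measure (BlockVec (Fin m) d)).integrablePower : ℝ)) with hφ
  have hφi : Integrable φ :=
    (volume : Measure (BlockVec (Fin m) d)).integrable_pow_neg_integrablePower.const_mul C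
  set c : BlockVec (Fin m ⊕ Fin m) d → BlockVec (Fin m) d :=
    fun x => blockAct (projMat fun _ => true) (x + v) with hc
  have hle : ∀ x p, |cubeProd F (x + v + blockAct B p)| ≤ φ (blockAct (lowerMat B) p + c x) := by
    intro x p
    refine (hC _).trans (le_of_eq ?_)
    rw [hφ, hc]
    congr 4
    ext ⟨r, k⟩
    change blockAct (projMat fun _ => true) (x + v + blockAct B p) (r, k) =
      blockAct (lowerMat B) p (r, k) + blockAct (projMat fun _ => true) (x + v) (r, k)
    rw [projMat_act, projMat_act]
    simp [blockAct_apply, lowerMat]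
    ring
  have hci : ∀ x, Integrable fun p => φ (blockAct (lowerMat B) p + c x) := fun x =>
    integrable_comp_blockAct (lowerMat B) hB (hφi.comp_add_right (c x))
  refine Integrable.mono' (g := fun z : BlockVec (Fin m ⊕ Fin m) d × BlockVec (Fin m) d =>
    |G z.1| * φ (blockAct (lowerMat B) z.2 + c z.1)) ?_ hmeas
    (Filter.Eventually.of_forall fun z => ?_)
  · have hcc : Continuous c := by rw [hc]; fun_prop
    have hφc : Continuous φ := by
      rw [hφ]
      refine continuous_const.mul (Continuous.rpow_const (by fun_prop) fun z => Or.inl ?_)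
      positivity
    refine (integrable_prod_iff (f := fun z : BlockVec (Fin m ⊕ Fin m) d × BlockVec (Fin m) d =>
      |G z.1| * φ (blockAct (lowerMat B) z.2 + c z.1)) (hG.abs.aestronglyMeasurable.comp_fst.mul
      (Continuous.aestronglyMeasurable (by fun_prop)))).2
      ⟨Filter.Eventually.of_forall fun x => (hci x).const_mul |G x|, ?_⟩
    have h : ∀ x, ∫ p, ‖|G x| * φ (blockAct (lowerMat B) p + c x)‖ =
        |G x| * ((|(lowerMat B).det| ^ d)⁻¹ • ∫ p, ‖φ p‖) := by
      intro x
      simp only [norm_mul, Real.norm_eq_abs, abs_abs]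
      rw [integral_const_mul, integral_comp_blockAct (lowerMat B) hB (fun p => |φ (p + c x)|),
        integral_add_right_eq_self (fun p => |φ p|)]
    simp only [h]
    exact hG.abs.mul_const _
  · rw [norm_mul]
    exact mul_le_mul_of_nonneg_left (hle _ _) (norm_nonneg _)

theorem integrable_slotGauss (k : Fin d) : Integrable (slotGauss k) := by
  have h : Integrable fun x : EuclideanSpace ℝ (Fin d) => x k * gaussian x := by
    have := continuous_gaussian (ι := Fin d)
    refine integrable_of_le_gaussian (Continuous.aestronglyMeasurable (by fun_prop)) (C := 1)
      fun x => ?_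
    rw [norm_mul, Real.norm_of_nonneg (gaussian_pos x).le, one_mul]
    refine mul_le_mul_of_nonneg_right ((abs_apply_le_norm x k).trans ?_) (gaussian_pos x).le
    nlinarith [sq_nonneg (‖x‖ - 1)]
  rw [← (PiLp.volume_preserving_toLp (Fin d)).integrable_comp_emb
    (MeasurableEquiv.toLp 2 _).measurableEmbedding] at h
  refine h.congr (Filter.Eventually.of_forall fun a => ?_)
  simp [slotGauss, gaussian, EuclideanSpace.norm_sq_eq]

theorem energyWeight_join (i : Fin m) (W : (RestIdx i d → ℝ) → ℝ) (k₁ k₂ : Fin d)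
    (y : RestIdx i d → ℝ) (a b : Fin d → ℝ) :
    energyWeight i W k₁ k₂ (join i y a b) = W y * (slotGauss k₁ a * slotGauss k₂ b) := by
  simp only [energyWeight, join_inl, join_inr, join_rest]

theorem integrable_energyWeight (i : Fin m) {W : (RestIdx i d → ℝ) → ℝ} (hW : Integrable W)
    (k₁ k₂ : Fin d) : Integrable (energyWeight i W k₁ k₂) := by
  rw [← (measurePreserving_joinEquiv i d).integrable_comp_emb
    (joinEquiv i d).measurableEmbedding]
  have h := hW.mul_prod ((integrable_slotGauss k₁).mul_prod (integrable_slotGauss k₂))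
  refine h.congr (Filter.Eventually.of_forall fun z => ?_)
  simp only [Function.comp, joinEquiv_apply, energyWeight_join]

/-- The first half ignores `b` and, after the swap, the second ignores `a`, so the unused entry may
be set to zero and the integrals in `a` and `b` separate. -/
theorem slotGauss_mul_slotGauss_mul_cubeProd (i : Fin m)
    (B : Matrix (Fin m ⊕ Fin m) (Fin m) ℝ) (v : BlockVec (Fin m ⊕ Fin m) d)
    (F : Cube m → 𝓢(BlockVec (Fin m) d, ℝ)) (p : BlockVec (Fin m) d) (y : RestIdx i d → ℝ)
    (a b : Fin d → ℝ) :
    cubeProd F (join i y a b + v + blockAct B p) =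
      halfProd i F (join i y a 0 + v + blockAct B p) *
      halfProd i (reflTuple i F) (join i y b 0 + swapVec i v + blockAct (swapMat i B) p) := by
  rw [cubeProd_eq_halfProd_mul i, swapVec_add_blockAct]
  congr 1
  · refine halfProd_congr i (fun _ _ => rfl) fun p k hp => ?_
    simp [join, hp]
  · refine halfProd_congr i (fun _ _ => rfl) fun p k hp => ?_
    by_cases h : p = Sum.inl i
    · subst h
      simp [swapVec_apply, join_inl, join_inr]
    · simp [swapVec_apply, Equiv.swap_apply_of_ne_of_ne h hp, join, h, hp]

/-- Fubini in the coordinates `(p, y, a, b)`: for fixed `(p, y)` the integral over `a` and `b` is a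
product of two slot integrals. -/
theorem energy_integral (i : Fin m) {W : (RestIdx i d → ℝ) → ℝ} (hW : Integrable W)
    {B : Matrix (Fin m ⊕ Fin m) (Fin m) ℝ} (hB : (lowerMat B).det ≠ 0)
    (v : BlockVec (Fin m ⊕ Fin m) d) (F : Cube m → 𝓢(BlockVec (Fin m) d, ℝ)) (k₁ k₂ : Fin d) :
    Integrable (fun w : BlockVec (Fin m) d × (RestIdx i d → ℝ) => W w.2 *
      (slotInt i B v F k₁ w * slotInt i (swapMat i B) (swapVec i v) (reflTuple i F) k₂ w)) ∧
    energy i W B v F k₁ k₂ =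
      ∫ x, ∫ p, energyWeight i W k₁ k₂ x * cubeProd F (x + v + blockAct B p) := by
  have h1 := (integrable_mul_cubeProd (integrable_energyWeight i hW k₁ k₂) B hB v F).swap
  have e1 : MeasurePreserving
      (((MeasurableEquiv.refl (BlockVec (Fin m) d)).prodCongr (joinEquiv i d)))
      volume volume :=
    (MeasurePreserving.id _).prod (measurePreserving_joinEquiv i d)
  have e2 : MeasurePreserving (MeasurableEquiv.prodAssoc :
      (BlockVec (Fin m) d × (RestIdx i d → ℝ)) × ((Fin d → ℝ) × (Fin d → ℝ)) ≃ᵐ _)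
      volume volume := measurePreserving_prodAssoc _ _ _
  have e3 := e2.trans e1
  have h2 := (e3.integrable_comp_emb (MeasurableEquiv.measurableEmbedding _)).2 h1
  have hpt : ∀ z : (BlockVec (Fin m) d × (RestIdx i d → ℝ)) × ((Fin d → ℝ) × (Fin d → ℝ)),
      ((fun z : BlockVec (Fin m ⊕ Fin m) d × BlockVec (Fin m) d =>
        energyWeight i W k₁ k₂ z.1 * cubeProd F (z.1 + v + blockAct B z.2)) ∘ Prod.swap)
        ((MeasurableEquiv.prodAssoc.trans
          ((MeasurableEquiv.refl (BlockVec (Fin m) d)).prodCongr (joinEquiv i d))) z) =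
      W z.1.2 * ((slotGauss k₁ z.2.1 * halfProd i F (join i z.1.2 z.2.1 0 + v + blockAct B z.1.1)) *
        (slotGauss k₂ z.2.2 * halfProd i (reflTuple i F)
          (join i z.1.2 z.2.2 0 + swapVec i v + blockAct (swapMat i B) z.1.1))) := by
    rintro ⟨⟨p, y⟩, a, b⟩
    have : ((MeasurableEquiv.prodAssoc.trans
          ((MeasurableEquiv.refl (BlockVec (Fin m) d)).prodCongr (joinEquiv i d)))
            ((p, y), (a, b))) = (p, join i y a b) := by
      rw [← joinEquiv_apply i (y, (a, b))]
      rfl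
    rw [this]
    simp only [Function.comp, Prod.swap_prod_mk, energyWeight_join,
      slotGauss_mul_slotGauss_mul_cubeProd]
    ring
  have hin : ∀ w : BlockVec (Fin m) d × (RestIdx i d → ℝ),
      ∫ c : (Fin d → ℝ) × (Fin d → ℝ),
      W w.2 * ((slotGauss k₁ c.1 * halfProd i F (join i w.2 c.1 0 + v + blockAct B w.1)) *
        (slotGauss k₂ c.2 * halfProd i (reflTuple i F)
          (join i w.2 c.2 0 + swapVec i v + blockAct (swapMat i B) w.1))) =
      W w.2 *
      (slotInt i B v F k₁ w * slotInt i (swapMat i B) (swapVec i v) (reflTuple i F) k₂ w) := by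
    intro w
    rw [integral_const_mul]
    congr 1
    exact integral_prod_mul
      (fun a => slotGauss k₁ a * halfProd i F (join i w.2 a 0 + v + blockAct B w.1))
      (fun b => slotGauss k₂ b * halfProd i (reflTuple i F)
          (join i w.2 b 0 + swapVec i v + blockAct (swapMat i B) w.1))
  have h3 : Integrable (fun z : (BlockVec (Fin m) d × (RestIdx i d → ℝ)) ×
      ((Fin d → ℝ) × (Fin d → ℝ)) =>
      W z.1.2 * ((slotGauss k₁ z.2.1 * halfProd i F (join i z.1.2 z.2.1 0 + v + blockAct B z.1.1)) *
        (slotGauss k₂ z.2.2 * halfProd i (reflTuple i F)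
          (join i z.1.2 z.2.2 0 + swapVec i v + blockAct (swapMat i B) z.1.1)))) :=
    h2.congr (Filter.Eventually.of_forall hpt)
  refine ⟨?_, ?_⟩
  · have h4 := h3.integral_prod_left
    simp only [hin] at h4
    exact h4
  · rw [energy]
    simp only [← hin]
    rw [← integral_prod _ h3, ← integral_congr_ae (Filter.Eventually.of_forall hpt)]
    rw [← integral_prod _ (integrable_mul_cubeProd (integrable_energyWeight i hW k₁ k₂) B hB v F),
      ← Measure.volume_eq_prod]
    have h5 := e3.integral_comp' ((fun z : BlockVec (Fin m ⊕ Fin m) d × BlockVec (Fin m) d =>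
        energyWeight i W k₁ k₂ z.1 * cubeProd F (z.1 + v + blockAct B z.2)) ∘ Prod.swap)
    refine h5.trans ?_
    exact integral_prod_swap (fun z : BlockVec (Fin m ⊕ Fin m) d × BlockVec (Fin m) d =>
        energyWeight i W k₁ k₂ z.1 * cubeProd F (z.1 + v + blockAct B z.2))

end CubicalBL

end

noncomputable section

namespace CubicalBL

variable {m d : ℕ}

/-! ### Symmetrization by the inequality between the means -/

theorem slotInt_congr (i : Fin m) {B B' : Matrix (Fin m ⊕ Fin m) (Fin m) ℝ}
    (hB : ∀ p s, p ≠ Sum.inr i → B p s = B' p s) {v v' : BlockVec (Fin m ⊕ Fin m) d}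
    (hv : ∀ p k, p ≠ Sum.inr i → v (p, k) = v' (p, k))
    {F F' : Cube m → 𝓢(BlockVec (Fin m) d, ℝ)} (hF : ∀ j, j i = false → F j = F' j) (k : Fin d) :
    slotInt i B v F k = slotInt i B' v' F' k := by
  funext w
  simp only [slotInt]
  congr 1
  funext a
  congr 1
  refine halfProd_congr i hF fun p q hp => ?_
  simp only [PiLp.add_apply, hv p q hp, blockAct_apply, hB p _ hp]

/-- The substitution of the slot `p` for the slot `q`. -/
def slotMap (p q r : Fin m ⊕ Fin m) : Fin m ⊕ Fin m := if r = q then p else r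

/-- The matrix `B` with its row `q` replaced by its row `p`. -/
def copyRow (p q : Fin m ⊕ Fin m) (B : Matrix (Fin m ⊕ Fin m) (Fin m) ℝ) :
    Matrix (Fin m ⊕ Fin m) (Fin m) ℝ := B.submatrix (slotMap p q) id

/-- The vector `v` with its entry `q` replaced by its entry `p`. -/
def copyEntry (p q : Fin m ⊕ Fin m) (v : BlockVec (Fin m ⊕ Fin m) d) :
    BlockVec (Fin m ⊕ Fin m) d := WithLp.toLp 2 fun r => v (slotMap p q r.1, r.2)

theorem copyEntry_apply (p q : Fin m ⊕ Fin m) (v : BlockVec (Fin m ⊕ Fin m) d)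
    (r : Fin m ⊕ Fin m) (k : Fin d) : copyEntry p q v (r, k) = v (slotMap p q r, k) := rfl

/-- The tuple `j ↦ F_{j'}`, where `j'` is `j` with its `i`-th entry replaced by `b`. -/
def freezeTuple (i : Fin m) (b : Bool) (F : Cube m → 𝓢(BlockVec (Fin m) d, ℝ)) :
    Cube m → 𝓢(BlockVec (Fin m) d, ℝ) := fun j => F (Function.update j i b)

theorem swap_inl_of_ne {i : Fin m} {p : Fin m ⊕ Fin m} (h0 : p ≠ Sum.inl i)
    (h1 : p ≠ Sum.inr i) : Equiv.swap (Sum.inl i) (Sum.inr i) p = p :=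
  Equiv.swap_apply_of_ne_of_ne h0 h1

/-- When slot `x_i^1` is overwritten with slot `x_i^0` and `j(i)` is frozen to zero, both factors of
the energy density become the first factor of the original density. -/
theorem slotInt_mul_copy_inl (i : Fin m) (B : Matrix (Fin m ⊕ Fin m) (Fin m) ℝ) (v : BlockVec (Fin m ⊕ Fin m) d)
    (F : Cube m → 𝓢(BlockVec (Fin m) d, ℝ)) (k : Fin d)
    (w : BlockVec (Fin m) d × (RestIdx i d → ℝ)) :
    slotInt i (copyRow (Sum.inl i) (Sum.inr i) B) (copyEntry (Sum.inl i) (Sum.inr i) v)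
      (freezeTuple i false F) k w *
      slotInt i (swapMat i (copyRow (Sum.inl i) (Sum.inr i) B))
      (swapVec i (copyEntry (Sum.inl i) (Sum.inr i) v))
      (reflTuple i (freezeTuple i false F)) k w =
    slotInt i B v F k w * slotInt i B v F k w := by
  congr 1
  · refine congrFun (slotInt_congr i ?_ ?_ ?_ k) w
    · intro p s hp
      simp [copyRow, slotMap, hp]
    · intro p q hp
      simp [copyEntry_apply, slotMap, hp]
    · intro j hj
      rw [freezeTuple, ← hj, Function.update_eq_self]
  · refine congrFun (slotInt_congr i ?_ ?_ ?_ k) w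
    · intro p s hp
      by_cases h : p = Sum.inl i
      · subst h
        simp [swapMat, copyRow, slotMap]
      · simp [swapMat, copyRow, slotMap, hp, swap_inl_of_ne h hp]
    · intro p q hp
      by_cases h : p = Sum.inl i
      · subst h
        simp [swapVec_apply, copyEntry_apply, slotMap]
      · simp [swapVec_apply, copyEntry_apply, slotMap, hp, swap_inl_of_ne h hp]
    · intro j hj
      rw [reflTuple, freezeTuple, Cube.reflect, Function.update_idem, ← hj,
        Function.update_eq_self]

/-- The mirror image: overwriting `x_i^0` with `x_i^1` produces the square of the second factor. -/
theorem slotInt_mul_copy_inr (i : Fin m) (B : Matrix (Fin m ⊕ Fin m) (Fin m) ℝ) (v : BlockVec (Fin m ⊕ Fin m) d)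
    (F : Cube m → 𝓢(BlockVec (Fin m) d, ℝ)) (k : Fin d)
    (w : BlockVec (Fin m) d × (RestIdx i d → ℝ)) :
    slotInt i (copyRow (Sum.inr i) (Sum.inl i) B) (copyEntry (Sum.inr i) (Sum.inl i) v)
      (freezeTuple i true F) k w *
      slotInt i (swapMat i (copyRow (Sum.inr i) (Sum.inl i) B))
      (swapVec i (copyEntry (Sum.inr i) (Sum.inl i) v))
      (reflTuple i (freezeTuple i true F)) k w =
    slotInt i (swapMat i B) (swapVec i v) (reflTuple i F) k w *
      slotInt i (swapMat i B) (swapVec i v) (reflTuple i F) k w := by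
  congr 1
  · refine congrFun (slotInt_congr i ?_ ?_ ?_ k) w
    · intro p s hp
      by_cases h : p = Sum.inl i
      · subst h
        simp [swapMat, copyRow, slotMap]
      · simp [swapMat, copyRow, slotMap, h, swap_inl_of_ne h hp]
    · intro p q hp
      by_cases h : p = Sum.inl i
      · subst h
        simp [swapVec_apply, copyEntry_apply, slotMap]
      · simp [swapVec_apply, copyEntry_apply, slotMap, h, swap_inl_of_ne h hp]
    · intro j hj
      rw [freezeTuple, reflTuple, Cube.reflect, hj, Bool.not_false]
  · refine congrFun (slotInt_congr i ?_ ?_ ?_ k) w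
    · intro p s hp
      by_cases h : p = Sum.inl i
      · subst h
        simp [swapMat, copyRow, slotMap]
      · simp [swapMat, copyRow, slotMap, h, swap_inl_of_ne h hp]
    · intro p q hp
      by_cases h : p = Sum.inl i
      · subst h
        simp [swapVec_apply, copyEntry_apply, slotMap]
      · simp [swapVec_apply, copyEntry_apply, slotMap, h, swap_inl_of_ne h hp]
    · intro j hj
      rw [reflTuple, reflTuple, freezeTuple, Cube.reflect, Function.update_idem, hj,
        Bool.not_false]

/-- Cauchy-Schwarz in the variables other than `x_i^0`, `x_i^1`, in the additive form `|ab| ≤ a² +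
b²` under the integral with a nonnegative weight. By the two preceding lemmas the squares are
energies of symmetrized data. -/
theorem abs_energy_le (i : Fin m) {W : (RestIdx i d → ℝ) → ℝ} (hW : Integrable W)
    (hW0 : ∀ y, 0 ≤ W y) {B : Matrix (Fin m ⊕ Fin m) (Fin m) ℝ}
    (hB : (lowerMat B).det ≠ 0)
    (hB' : (lowerMat (copyRow (Sum.inl i) (Sum.inr i) B)).det ≠ 0)
    (v : BlockVec (Fin m ⊕ Fin m) d) (F : Cube m → 𝓢(BlockVec (Fin m) d, ℝ)) (k₁ k₂ : Fin d) :
    |energy i W B v F k₁ k₂| ≤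
      energy i W (copyRow (Sum.inl i) (Sum.inr i) B) (copyEntry (Sum.inl i) (Sum.inr i) v)
        (freezeTuple i false F) k₁ k₁ +
      energy i W (copyRow (Sum.inr i) (Sum.inl i) B) (copyEntry (Sum.inr i) (Sum.inl i) v)
        (freezeTuple i true F) k₂ k₂ := by
  -- This copy overwrites a row of the upper block only, so the lower block stays invertible; the
  -- other copy changes the lower block and needs `hB'`.
  have hB1 : (lowerMat (copyRow (Sum.inr i) (Sum.inl i) B)).det ≠ 0 := by
    have : lowerMat (copyRow (Sum.inr i) (Sum.inl i) B) = lowerMat B := by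
      ext r s
      simp [lowerMat, copyRow, slotMap]
    rwa [this]
  have h0 := (energy_integral i hW hB' (copyEntry (Sum.inl i) (Sum.inr i) v)
    (freezeTuple i false F) k₁ k₁).1
  have h1 := (energy_integral i hW hB1 (copyEntry (Sum.inr i) (Sum.inl i) v)
    (freezeTuple i true F) k₂ k₂).1
  rw [energy, energy, energy, ← integral_add h0 h1]
  refine (abs_integral_le_integral_abs).trans (integral_mono
    (energy_integral i hW hB v F k₁ k₂).1.abs (h0.add h1) fun w => ?_)
  simp only
  rw [slotInt_mul_copy_inl i, slotInt_mul_copy_inr i, ← mul_add, abs_mul, abs_of_nonneg (hW0 _)]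
  refine mul_le_mul_of_nonneg_left ?_ (hW0 _)
  set a := slotInt i B v F k₁ w
  set b := slotInt i (swapMat i B) (swapVec i v) (reflTuple i F) k₂ w
  rw [abs_le]
  constructor <;> nlinarith [sq_nonneg (a + b), sq_nonneg (a - b), sq_nonneg a, sq_nonneg b]

/-! ### Symmetric energies -/

/-- The matrix of `p ↦ (-A p, p)`. -/
def fiberRows (A : Matrix (Fin m) (Fin m) ℝ) : Matrix (Fin m ⊕ Fin m) (Fin m) ℝ :=
  Matrix.fromRows (-A) 1

theorem fiberRows_inl (A : Matrix (Fin m) (Fin m) ℝ) (r s : Fin m) :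
    fiberRows A (Sum.inl r) s = -A r s := rfl

theorem fiberRows_inr (A : Matrix (Fin m) (Fin m) ℝ) (r s : Fin m) :
    fiberRows A (Sum.inr r) s = (1 : Matrix (Fin m) (Fin m) ℝ) r s := rfl

theorem blockAct_fiberRows (A : Matrix (Fin m) (Fin m) ℝ) (p : BlockVec (Fin m) d) :
    blockAct (fiberRows A) p = fiberPt A (0, p) := by
  ext ⟨r | r, k⟩
  · simp [fiberPt_inl, blockAct_apply, fiberRows_inl]
  · simp [fiberPt_inr, blockAct_apply, fiberRows_inr, Matrix.one_apply]

theorem lowerMat_fiberRows (A : Matrix (Fin m) (Fin m) ℝ) : lowerMat (fiberRows A) = 1 := rfl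

theorem lowerMat_mul (B : Matrix (Fin m ⊕ Fin m) (Fin m) ℝ) (N : Matrix (Fin m) (Fin m) ℝ) :
    lowerMat (B * N) = lowerMat B * N := rfl

/-- The coordinates of a vector other than those of `x_i^0` and `x_i^1`. -/
def restVec (i : Fin m) (v : BlockVec (Fin m ⊕ Fin m) d) : RestIdx i d → ℝ := fun p => v p.1

theorem swapMat_eq_self {i : Fin m} {B : Matrix (Fin m ⊕ Fin m) (Fin m) ℝ}
    (h : ∀ s, B (Sum.inl i) s = B (Sum.inr i) s) : swapMat i B = B := by
  ext p s
  by_cases h0 : p = Sum.inl i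
  · subst h0; simp [swapMat, h]
  · by_cases h1 : p = Sum.inr i
    · subst h1; simp [swapMat, h]
    · simp [swapMat, swap_inl_of_ne h0 h1]

theorem swapVec_eq_self {i : Fin m} {v : BlockVec (Fin m ⊕ Fin m) d}
    (h : ∀ k, v (Sum.inl i, k) = v (Sum.inr i, k)) : swapVec i v = v := by
  ext ⟨p, k⟩
  rw [swapVec_apply]
  by_cases h0 : p = Sum.inl i
  · subst h0; simp [h]
  · by_cases h1 : p = Sum.inr i
    · subst h1; simp [h]
    · simp [swap_inl_of_ne h0 h1]

theorem energy_symm {i : Fin m} (W : (RestIdx i d → ℝ) → ℝ)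
    {B : Matrix (Fin m ⊕ Fin m) (Fin m) ℝ} (hB : ∀ s, B (Sum.inl i) s = B (Sum.inr i) s)
    {v : BlockVec (Fin m ⊕ Fin m) d} (hv : ∀ k, v (Sum.inl i, k) = v (Sum.inr i, k))
    {F : Cube m → 𝓢(BlockVec (Fin m) d, ℝ)} (hF : ∀ j, F j = F (j.reflect i)) (k : Fin d) :
    energy i W B v F k k = ∫ w : BlockVec (Fin m) d × (RestIdx i d → ℝ), W w.2 *
      (slotInt i B v F k w) ^ 2 := by
  have h : reflTuple i F = F := funext fun j => (hF j).symm
  rw [energy, swapMat_eq_self hB, swapVec_eq_self hv, h]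
  simp only [sq]

theorem energy_nonneg {i : Fin m} {W : (RestIdx i d → ℝ) → ℝ} (hW0 : ∀ y, 0 ≤ W y)
    {B : Matrix (Fin m ⊕ Fin m) (Fin m) ℝ} (hB : ∀ s, B (Sum.inl i) s = B (Sum.inr i) s)
    {v : BlockVec (Fin m ⊕ Fin m) d} (hv : ∀ k, v (Sum.inl i, k) = v (Sum.inr i, k))
    {F : Cube m → 𝓢(BlockVec (Fin m) d, ℝ)} (hF : ∀ j, F j = F (j.reflect i)) (k : Fin d) :
    0 ≤ energy i W B v F k k := by
  rw [energy_symm W hB hv hF]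
  exact integral_nonneg fun w => mul_nonneg (hW0 _) (sq_nonneg _)

/-- Moving the parameter by `p₀` and the coordinates `y` by the rest of `v + B p₀` absorbs the
shift. The entry `x_i^0` cannot be moved, as it carries the kernel `slotGauss`; hence `p₀` must
cancel the shift there. The entry `x_i^1` does not matter. -/
theorem slotInt_translate (i : Fin m) (B : Matrix (Fin m ⊕ Fin m) (Fin m) ℝ)
    (v : BlockVec (Fin m ⊕ Fin m) d) (p₀ : BlockVec (Fin m) d)
    (h0 : ∀ k, (v + blockAct B p₀) (Sum.inl i, k) = 0)
    (F : Cube m → 𝓢(BlockVec (Fin m) d, ℝ)) (k : Fin d)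
    (w : BlockVec (Fin m) d × (RestIdx i d → ℝ)) :
    slotInt i B v F k (w + (p₀, -restVec i (v + blockAct B p₀))) = slotInt i B 0 F k w := by
  simp only [slotInt]
  congr 1
  funext a
  congr 1
  refine halfProd_congr i (fun _ _ => rfl) fun p q hp => ?_
  simp only [Prod.fst_add, Prod.snd_add, map_add]
  by_cases h : p = Sum.inl i
  · subst h
    have := h0 q
    simp only [PiLp.add_apply] at this
    simp only [PiLp.add_apply, join_inl, PiLp.zero_apply]
    linarith
  · have e1 : ∀ y : RestIdx i d → ℝ, join i y a 0 (p, q) = y ⟨(p, q), h, hp⟩ :=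
      fun y => join_rest i y a 0 ⟨(p, q), h, hp⟩
    simp only [PiLp.add_apply, e1, PiLp.zero_apply, Pi.add_apply, Pi.neg_apply, restVec]
    ring

/-- Translation invariance in `(p, y)` moves the shift from the functions to the weight. Symmetry
guarantees that one `p₀` serves both factors of the density. -/
theorem energy_translate {i : Fin m} (W : (RestIdx i d → ℝ) → ℝ)
    {B : Matrix (Fin m ⊕ Fin m) (Fin m) ℝ} (hB : ∀ s, B (Sum.inl i) s = B (Sum.inr i) s)
    {v : BlockVec (Fin m ⊕ Fin m) d} (hv : ∀ k, v (Sum.inl i, k) = v (Sum.inr i, k))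
    {F : Cube m → 𝓢(BlockVec (Fin m) d, ℝ)} (hF : ∀ j, F j = F (j.reflect i)) (k : Fin d)
    (p₀ : BlockVec (Fin m) d) (h0 : ∀ k, (v + blockAct B p₀) (Sum.inl i, k) = 0) :
    energy i W B v F k k =
      energy i (fun y => W (y - restVec i (v + blockAct B p₀))) B 0 F k k := by
  have : (volume : Measure (BlockVec (Fin m) d × (RestIdx i d → ℝ))).IsAddRightInvariant := by
    rw [Measure.volume_eq_prod]
    infer_instance
  rw [energy_symm W hB hv hF, energy_symm _ hB (fun _ => rfl) hF,
    ← integral_add_right_eq_self (fun w : BlockVec (Fin m) d × (RestIdx i d → ℝ) => W w.2 *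
      (slotInt i B v F k w) ^ 2) (p₀, -restVec i (v + blockAct B p₀))]
  simp only [slotInt_translate i B v p₀ h0, Prod.snd_add, ← sub_eq_add_neg]

/-- For symmetric data the density is the weight times a square. -/
theorem energy_mono {i : Fin m} {W W' : (RestIdx i d → ℝ) → ℝ} (hW : Integrable W)
    (hW' : Integrable W') (hWW' : ∀ y, W y ≤ W' y)
    {B : Matrix (Fin m ⊕ Fin m) (Fin m) ℝ} (hdet : (lowerMat B).det ≠ 0)
    (hB : ∀ s, B (Sum.inl i) s = B (Sum.inr i) s)
    {F : Cube m → 𝓢(BlockVec (Fin m) d, ℝ)} (hF : ∀ j, F j = F (j.reflect i)) (k : Fin d) :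
    energy i W B 0 F k k ≤ energy i W' B 0 F k k := by
  have h1 := (energy_integral i hW hdet 0 F k k).1
  have h2 := (energy_integral i hW' hdet 0 F k k).1
  have hs : swapVec i (0 : BlockVec (Fin m ⊕ Fin m) d) = 0 := swapVec_eq_self fun _ => rfl
  have h : reflTuple i F = F := funext fun j => (hF j).symm
  rw [energy, energy]
  refine integral_mono h1 h2 fun w => ?_
  simp only
  rw [swapMat_eq_self hB, hs, h]
  exact mul_le_mul_of_nonneg_right (hWW' _) (mul_self_nonneg _)

theorem energy_const_mul (i : Fin m) (c : ℝ) (W : (RestIdx i d → ℝ) → ℝ)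
    (B : Matrix (Fin m ⊕ Fin m) (Fin m) ℝ) (v : BlockVec (Fin m ⊕ Fin m) d)
    (F : Cube m → 𝓢(BlockVec (Fin m) d, ℝ)) (k₁ k₂ : Fin d) :
    energy i (fun y => c * W y) B v F k₁ k₂ = c * energy i W B v F k₁ k₂ := by
  rw [energy, energy, ← integral_const_mul]
  simp only [mul_assoc]

/-- The Gaussian of width `L` in the coordinates other than `x_i^0` and `x_i^1`. -/
def restGauss (i : Fin m) (d : ℕ) (L : ℝ) (y : RestIdx i d → ℝ) : ℝ :=
  Real.exp (-Real.pi * ∑ p, (y p / L) ^ 2)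

theorem restGauss_nonneg (i : Fin m) (L : ℝ) (y : RestIdx i d → ℝ) : 0 ≤ restGauss i d L y :=
  (Real.exp_pos _).le

theorem integrable_restGauss (i : Fin m) (d : ℕ) {L : ℝ} (hL : 0 < L) :
    Integrable (restGauss i d L) := by
  have h : Integrable fun x : EuclideanSpace ℝ (RestIdx i d) =>
      Real.exp (-(Real.pi / L ^ 2) * ‖x‖ ^ 2) :=
    integrable_exp_neg_mul_norm_sq (div_pos Real.pi_pos (by positivity))
  rw [← (PiLp.volume_preserving_toLp (RestIdx i d)).integrable_comp_emb
    (MeasurableEquiv.toLp 2 _).measurableEmbedding] at h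
  refine h.congr (Filter.Eventually.of_forall fun y => ?_)
  simp only [Function.comp, restGauss, EuclideanSpace.norm_sq_eq, div_pow, ← Finset.sum_div]
  congr 1
  simp
  ring

/-- By Cauchy-Schwarz `(b + c)² ≤ (b² + 1)(1 + c)²`, so `|y|²/L² ≤ |y - r|² + 1`; the additional `1`
in the exponent costs the factor `e^π`. -/
theorem restGauss_sub_le (i : Fin m) (y r : RestIdx i d → ℝ) {L : ℝ}
    (hL : 1 + ‖WithLp.toLp 2 r‖ ≤ L) :
    restGauss i d 1 (y - r) ≤ Real.exp Real.pi * restGauss i d L y := by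
  have hL0 : 0 < L := by linarith [norm_nonneg (WithLp.toLp 2 r)]
  rw [restGauss, restGauss, ← Real.exp_add]
  refine Real.exp_le_exp.2 ?_
  have e1 : ∑ p, ((y - r) p / 1) ^ 2 = ‖WithLp.toLp 2 (y - r)‖ ^ 2 := by
    simp [EuclideanSpace.norm_sq_eq]
  have e2 : ∑ p, (y p / L) ^ 2 = ‖WithLp.toLp 2 y‖ ^ 2 / L ^ 2 := by
    simp [EuclideanSpace.norm_sq_eq, div_pow, Finset.sum_div]
  have h1 : ‖WithLp.toLp 2 y‖ ≤ ‖WithLp.toLp 2 (y - r)‖ + ‖WithLp.toLp 2 r‖ := by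
    have := norm_add_le (WithLp.toLp 2 (y - r)) (WithLp.toLp 2 r)
    rwa [← WithLp.toLp_add, sub_add_cancel] at this
  rw [e1, e2]
  set a := ‖WithLp.toLp 2 y‖
  set b := ‖WithLp.toLp 2 (y - r)‖
  set c := ‖WithLp.toLp 2 r‖
  have ha : 0 ≤ a := norm_nonneg _
  have hb : 0 ≤ b := norm_nonneg _
  have hc : 0 ≤ c := norm_nonneg _
  have h2 : a ^ 2 / L ^ 2 ≤ b ^ 2 + 1 := by
    rw [div_le_iff₀ (by positivity)]
    calc a ^ 2 ≤ (b + c) ^ 2 := by gcongr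
      _ ≤ (b ^ 2 + 1) * (1 + c) ^ 2 := by
          nlinarith [sq_nonneg (b * c - 1), mul_nonneg hb hc, mul_nonneg (sq_nonneg b) hc]
      _ ≤ _ := by gcongr
  nlinarith [Real.pi_pos]

theorem sum_splitIdx (i : Fin m) (f : (Fin m ⊕ Fin m) × Fin d → ℝ) :
    ∑ p, f p = ∑ p : RestIdx i d, f p.1 +
      (∑ k, f (Sum.inl i, k) + ∑ k, f (Sum.inr i, k)) := by
  rw [← (splitIdx i d).sum_comp f, Fintype.sum_sum_type, Fintype.sum_sum_type]
  rfl

theorem gaussianDeriv_eq_energyWeight (i : Fin m) (k₁ k₂ : Fin d)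
    (x : BlockVec (Fin m ⊕ Fin m) d) :
    gaussianDeriv i k₁ k₂ x = 4 * Real.pi ^ 2 * energyWeight i (restGauss i d 1) k₁ k₂ x := by
  have h : gaussian x = restGauss i d 1 (fun p => x p.1) *
      (Real.exp (-Real.pi * ∑ q, x (Sum.inl i, q) ^ 2) *
        Real.exp (-Real.pi * ∑ q, x (Sum.inr i, q) ^ 2)) := by
    rw [gaussian, restGauss, ← Real.exp_add, ← Real.exp_add, ← mul_add, ← mul_add]
    simp only [EuclideanSpace.norm_sq_eq, div_one, Real.norm_eq_abs, sq_abs]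
    rw [sum_splitIdx i]
  rw [gaussianDeriv_apply, h, energyWeight, slotGauss, slotGauss]
  ring

/-- Translating the fibre variable by `x^1` turns the fibre over `(I A) x - u` into the points `x +
(-u, 0) + (-A p, p)`. -/
theorem osc_one_eq_energy (A : Matrix (Fin m) (Fin m) ℝ)
    (F : Cube m → 𝓢(BlockVec (Fin m) d, ℝ)) (i : Fin m) (k₁ k₂ : Fin d)
    (u : BlockVec (Fin m) d) :
    osc A F i k₁ k₂ 1 u = ((4 * Real.pi ^ 2 * energy i (restGauss i d 1) (fiberRows A)
      (fiberPt A (-u, 0)) F k₁ k₂ : ℝ) : ℂ) := by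
  rw [osc_one_eq_integral, (energy_integral i (integrable_restGauss i d one_pos)
    (by rw [lowerMat_fiberRows]; simp) _ F k₁ k₂).2, ← integral_const_mul, ← integral_complex_ofReal]
  refine integral_congr_ae (Filter.Eventually.of_forall fun x => ?_)
  simp only
  rw [integral_const_mul, ← mul_assoc, ← gaussianDeriv_eq_energyWeight, Complex.ofReal_mul]
  congr 1
  rw [← integral_complex_ofReal, pushforward_apply,
    ← integral_add_right_eq_self _ (blockAct (projMat fun _ => true) x)]
  congr 1
  funext p
  congr 2
  ext ⟨r | r, k⟩
  · rw [fiberPt_inl, map_add, blockAct_fiberRows]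
    simp only [PiLp.add_apply, PiLp.sub_apply, fiberPt_inl]
    have : blockAct (pairMat A) x (r, k) = x (Sum.inl r, k) +
        blockAct A (blockAct (projMat fun _ => true) x) (r, k) := by
      simp [blockAct_apply, pairMat, Matrix.one_apply, projMat]
    rw [this]
    simp
    ring
  · rw [fiberPt_inr, blockAct_fiberRows]
    simp only [PiLp.add_apply, fiberPt_inr, projMat_act]
    simp
    ring

theorem osc_one_zero_eq_energy (A : Matrix (Fin m) (Fin m) ℝ)
    (F : Cube m → 𝓢(BlockVec (Fin m) d, ℝ)) (i : Fin m) (k₁ k₂ : Fin d) :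
    osc A F i k₁ k₂ 1 0 = ((4 * Real.pi ^ 2 * energy i (restGauss i d 1) (fiberRows A)
      0 F k₁ k₂ : ℝ) : ℂ) := by
  rw [osc_one_eq_energy, neg_zero, Prod.mk_zero_zero, map_zero]

/-! ### Rescaling the coordinates other than `x_i^0` and `x_i^1` -/

/-- The scaling by `L` of all coordinates but the `i`-th. -/
def slotScale (i : Fin m) (L : ℝ) (r : Fin m) : ℝ := if r = i then 1 else L

theorem slotScale_pos (i : Fin m) {L : ℝ} (hL : 0 < L) (r : Fin m) : 0 < slotScale i L r := by
  rw [slotScale]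
  split_ifs <;> positivity

theorem prod_slotScale (i : Fin m) (L : ℝ) : ∏ r, slotScale i L r = L ^ (m - 1) := by
  simp only [slotScale]
  rw [Finset.prod_ite, Finset.prod_const_one, one_mul, Finset.prod_const]
  congr 1
  rw [Finset.filter_ne' Finset.univ i, Finset.card_erase_of_mem (Finset.mem_univ i),
    Finset.card_univ, Fintype.card_fin]

theorem energyWeight_slotScale (i : Fin m) {L : ℝ} (hL : 0 < L) (k₁ k₂ : Fin d)
    (x : BlockVec (Fin m ⊕ Fin m) d) :
    energyWeight i (restGauss i d L) k₁ k₂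
      (blockAct (Matrix.diagonal (Sum.elim (slotScale i L) (slotScale i L))) x) =
      energyWeight i (restGauss i d 1) k₁ k₂ x := by
  simp only [energyWeight, blockAct_diagonal, Sum.elim_inl, Sum.elim_inr, slotScale, if_true,
    one_mul]
  congr 1
  simp only [restGauss]
  congr 2
  refine Finset.sum_congr rfl fun p _ => ?_
  obtain ⟨⟨r | r, k⟩, h0, h1⟩ := p
  · have : r ≠ i := fun h => h0 (by rw [h])
    simp only [blockAct_diagonal, Sum.elim_inl, slotScale, this, if_false]
    field_simp
  · have : r ≠ i := fun h => h1 (by rw [h])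
    simp only [blockAct_diagonal, Sum.elim_inr, slotScale, this, if_false]
    field_simp

/-- Substitute `N p` for `p`, then dilate by `L` in all slots but the `i`-th, where the kernels
`slotGauss` sit. The Jacobian in `p` cancels against the normalization of the tuple, and that in
`x`, which counts `x^0` and `x^1`, leaves `L^{2d(m-1)}`. This is the source of the growth in `u`. -/
theorem energy_slotScale (i : Fin m) {L : ℝ} (hL : 0 < L) (A N : Matrix (Fin m) (Fin m) ℝ)
    (hN : N.det ≠ 0) (F : Cube m → 𝓢(BlockVec (Fin m) d, ℝ)) (k₁ k₂ : Fin d) :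
    energy i (restGauss i d L) (fiberRows A * N) 0 F k₁ k₂ =
      (|N.det| ^ d)⁻¹ * L ^ (2 * d * (m - 1)) *
        energy i (restGauss i d 1) (fiberRows (scaleMat (slotScale i L) A)) 0
          (scaleTuple (slotScale i L) (slotScale_pos i hL) F) k₁ k₂ := by
  have hδ := slotScale_pos i hL
  have hp : 0 < ∏ r, slotScale i L r := Finset.prod_pos fun r _ => hδ r
  have hδ2 : ∀ r, 0 < Sum.elim (slotScale i L) (slotScale i L) r := by rintro (r | r) <;> exact hδ r
  rw [(energy_integral i (integrable_restGauss i d hL)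
      (by rw [lowerMat_mul, lowerMat_fiberRows, one_mul]; exact hN) 0 F k₁ k₂).2,
    (energy_integral i (integrable_restGauss i d one_pos)
      (by rw [lowerMat_fiberRows]; simp) 0 _ k₁ k₂).2]
  have h1 : ∀ x : BlockVec (Fin m ⊕ Fin m) d,
      ∫ p, energyWeight i (restGauss i d L) k₁ k₂ x *
        cubeProd F (x + 0 + blockAct (fiberRows A * N) p) =
      (|N.det| ^ d)⁻¹ * ∫ p, energyWeight i (restGauss i d L) k₁ k₂ x *
        cubeProd F (x + 0 + blockAct (fiberRows A) p) := by
    intro x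
    simp only [blockAct_mul]
    exact integral_comp_blockAct N hN (fun p => energyWeight i (restGauss i d L) k₁ k₂ x *
        cubeProd F (x + 0 + blockAct (fiberRows A) p))
  have h2 : ∀ x : BlockVec (Fin m ⊕ Fin m) d,
      ∫ p, energyWeight i (restGauss i d 1) k₁ k₂ x * cubeProd (scaleTuple (slotScale i L) hδ F)
        (x + 0 + blockAct (fiberRows (scaleMat (slotScale i L) A)) p) =
      ∫ p, energyWeight i (restGauss i d L) k₁ k₂
        (blockAct (Matrix.diagonal (Sum.elim (slotScale i L) (slotScale i L))) x) *
        cubeProd F (blockAct (Matrix.diagonal (Sum.elim (slotScale i L) (slotScale i L))) x + 0 +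
          blockAct (fiberRows A) p) := by
    intro x
    have h3 := integral_comp_blockAct (Matrix.diagonal (slotScale i L)) (det_diagonal_ne_zero hδ)
      (fun p : BlockVec (Fin m) d => energyWeight i (restGauss i d L) k₁ k₂
        (blockAct (Matrix.diagonal (Sum.elim (slotScale i L) (slotScale i L))) x) *
        cubeProd F (blockAct (Matrix.diagonal (Sum.elim (slotScale i L) (slotScale i L))) x + 0 +
          blockAct (fiberRows A) p))
    rw [Matrix.det_diagonal, abs_of_pos hp, smul_eq_mul, eq_inv_mul_iff_mul_eq₀ (by positivity)]
      at h3
    rw [← h3, ← integral_const_mul]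
    congr 1
    funext p
    rw [cubeProd_scaleTuple, map_add, map_add, map_zero, blockAct_fiberRows, scale_fiberPt (slotScale i L) hδ,
      map_zero, blockAct_fiberRows, energyWeight_slotScale i hL]
    ring
  simp only [h1, h2, integral_const_mul]
  rw [integral_comp_blockAct (Matrix.diagonal (Sum.elim (slotScale i L) (slotScale i L))) (det_diagonal_ne_zero hδ2)
    (fun x : BlockVec (Fin m ⊕ Fin m) d => energyWeight i (restGauss i d L) k₁ k₂ x *
      ∫ p : BlockVec (Fin m) d, cubeProd F (x + 0 + blockAct (fiberRows A) p)),
    Matrix.det_diagonal, Fintype.prod_sum_type]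
  simp only [Sum.elim_inl, Sum.elim_inr]
  rw [abs_of_pos (mul_pos hp hp), prod_slotScale, smul_eq_mul, mul_assoc]
  congr 1
  rw [← mul_assoc, ← pow_add, ← pow_mul]
  have : (m - 1 + (m - 1)) * d = 2 * d * (m - 1) := by ring
  rw [this, mul_inv_cancel₀ (by positivity), one_mul]

end CubicalBL

end

noncomputable section

namespace CubicalBL

variable {m d : ℕ}

/-! ### Symmetrization of admissible data -/

theorem det_updateRow_one (i : Fin m) (b : Fin m → ℝ) :
    ((1 : Matrix (Fin m) (Fin m) ℝ).updateRow i b).det = b i := by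
  rw [← Matrix.cramer_transpose_apply, Matrix.transpose_one, Matrix.cramer_one]
  rfl

/-- Choose `j` as the indicator of `i`: the identity with its `i`-th column replaced by that of `A`
has determinant `A i i`. -/
theorem Admissible.diag {S : Finset (Fin m)} {ε R : ℝ} {A : Matrix (Fin m) (Fin m) ℝ}
    (hA : Admissible S ε R A) (i : Fin m) : ε ≤ |A i i| := by
  have h := hA.det (fun s => decide (s = i))
  have h1 : pairMat A * (projMat fun s => decide (s = i)).transpose =
      (1 : Matrix (Fin m) (Fin m) ℝ).updateCol i (fun r => A r i) := by
    ext r s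
    rw [pairMat_mul_projMat, Matrix.updateCol_apply]
    by_cases h : s = i <;> simp [h]
  rw [h1, ← Matrix.cramer_apply, Matrix.cramer_one] at h
  exact h

theorem admissible_of_fiberMat {S : Finset (Fin m)} {ε R : ℝ} {A : Matrix (Fin m) (Fin m) ℝ}
    (h1 : ∀ j, ε ≤ |(fiberMat A j).det|) (h2 : ∀ r s, |A r s| ≤ R)
    (h3 : ∀ r ∈ S, ∀ s, A r s = (-1 : Matrix (Fin m) (Fin m) ℝ) r s) : Admissible S ε R A := by
  refine ⟨fun j => ?_, h2, h3⟩
  have h := h1 fun r => !j r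
  rw [abs_det_fiberMat] at h
  simpa using h

theorem Admissible.fiberMat {S : Finset (Fin m)} {ε R : ℝ} {A : Matrix (Fin m) (Fin m) ℝ}
    (hA : Admissible S ε R A) (j : Cube m) : ε ≤ |(CubicalBL.fiberMat A j).det| := by
  rw [abs_det_fiberMat]
  exact hA.det _

/-- Rows of `-I` are unchanged by conjugation, every other row is multiplied entrywise with `δ s / δ
r ≤ 1`, and the determinants are invariant. The constants do not deteriorate, however large the
dilation. -/
theorem Admissible.scaleMat {S : Finset (Fin m)} {ε R : ℝ} {A : Matrix (Fin m) (Fin m) ℝ}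
    (hA : Admissible S ε R A) {δ : Fin m → ℝ} (hδ : ∀ r, 0 < δ r)
    (h : ∀ r, r ∉ S → ∀ s, δ s ≤ δ r) : Admissible S ε R (scaleMat δ A) := by
  have hrow : ∀ r ∈ S, ∀ s, CubicalBL.scaleMat δ A r s = A r s := by
    intro r hr s
    rw [scaleMat_apply, hA.row r hr]
    by_cases hrs : r = s
    · subst hrs
      have := (hδ r).ne'
      field_simp
    · simp [hrs]
  refine ⟨fun j => ?_, fun r s => ?_, fun r hr s => ?_⟩
  · rw [det_pairMat_scaleMat δ hδ]
    exact hA.det j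
  · by_cases hr : r ∈ S
    · rw [hrow r hr]
      exact hA.entry r s
    · rw [scaleMat_apply, mul_right_comm, abs_mul, abs_mul, abs_of_pos (inv_pos.2 (hδ r)),
        abs_of_pos (hδ s)]
      have h1 : (δ r)⁻¹ * δ s ≤ 1 := by
        rw [inv_mul_le_iff₀ (hδ r), mul_one]
        exact h r hr s
      calc _ ≤ 1 * |A r s| := by gcongr
        _ ≤ R := by rw [one_mul]; exact hA.entry r s
  · rw [hrow r hr, hA.row r hr]

theorem SymTuple.freezeTuple {S : Finset (Fin m)} {F : Cube m → 𝓢(BlockVec (Fin m) d, ℝ)}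
    (hF : SymTuple S F) (i : Fin m) (b : Bool) :
    SymTuple (insert i S) (freezeTuple i b F) := by
  refine ⟨fun r hr j => ?_, fun j => hF.norm _⟩
  rw [Finset.mem_insert] at hr
  by_cases h : r = i
  · subst h
    simp [CubicalBL.freezeTuple, Cube.reflect]
  · rw [CubicalBL.freezeTuple, CubicalBL.freezeTuple, hF.symm r (hr.resolve_left h)]
    congr 1
    funext q
    simp only [Cube.reflect]
    by_cases hq : q = r
    · subst hq
      simp [h]
    · by_cases hqi : q = i
      · subst hqi
        simp [hq]
      · simp [hq, hqi]

/-- The matrix obtained from `A` by a pivot operation at the `i`-th diagonal entry. -/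
def pivotMat (i : Fin m) (A : Matrix (Fin m) (Fin m) ℝ) : Matrix (Fin m) (Fin m) ℝ :=
  Matrix.of fun r s => if s = i then -(A r i / A i i) else A r s - A r i * A i s / A i i

/-- The change of parameters on the fibre that accompanies `pivotMat`. -/
def pivotFactor (i : Fin m) (A : Matrix (Fin m) (Fin m) ℝ) : Matrix (Fin m) (Fin m) ℝ :=
  (1 : Matrix (Fin m) (Fin m) ℝ).updateRow i (-A i)

theorem det_pivotFactor (i : Fin m) (A : Matrix (Fin m) (Fin m) ℝ) :
    (pivotFactor i A).det = -A i i := det_updateRow_one i _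

/-- The factor introduces `-(A p)_i` as the new `i`-th parameter; solving for `p_i`, which is
possible as `A i i ≠ 0`, and substituting in the other rows gives the pivoted matrix. -/
theorem pivotMat_mul_pivotFactor (i : Fin m) {A : Matrix (Fin m) (Fin m) ℝ} (h : A i i ≠ 0) :
    pivotMat i A * pivotFactor i A = A := by
  ext r t
  rw [Matrix.mul_apply]
  have h1 : ∀ s, pivotMat i A r s * pivotFactor i A s t =
      (if s = i then A r i / A i i * A i t else 0) +
        (if s = t then (if t = i then 0 else pivotMat i A r t) else 0) := by
    intro s
    rw [pivotFactor, Matrix.updateRow_apply]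
    by_cases hs : s = i
    · subst hs
      by_cases hst : s = t
      · subst hst
        simp [pivotMat]
      · simp [pivotMat, hst]
    · by_cases hst : s = t
      · subst hst
        simp [hs]
      · simp [hs, hst]
  simp only [h1]
  rw [Finset.sum_add_distrib, Finset.sum_ite_eq' Finset.univ i, Finset.sum_ite_eq' Finset.univ t]
  simp only [Finset.mem_univ, if_true]
  by_cases ht : t = i
  · subst ht
    simp [h]
  · simp only [ht, if_false, pivotMat, Matrix.of_apply]
    ring

/-- After the copy, the entry `x_i^1` moves along `-(A p)_i`. With this as a parameter the fibre is
again of the form `(-A' p', p')`. -/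
theorem copyRow_inl_fiberRows (i : Fin m) {A : Matrix (Fin m) (Fin m) ℝ} (h : A i i ≠ 0) :
    copyRow (Sum.inl i) (Sum.inr i) (fiberRows A) =
      fiberRows (pivotMat i A) * pivotFactor i A := by
  ext (r | r) t
  · have h1 := congrFun (congrFun (pivotMat_mul_pivotFactor i h) r) t
    rw [Matrix.mul_apply] at h1 ⊢
    simp only [fiberRows_inl, neg_mul, Finset.sum_neg_distrib, h1]
    simp [copyRow, slotMap, fiberRows_inl]
  · rw [Matrix.mul_apply]
    simp only [fiberRows_inr, Matrix.one_apply, ite_mul, one_mul, zero_mul, Finset.sum_ite_eq,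
      Finset.mem_univ, if_true]
    rw [pivotFactor, Matrix.updateRow_apply]
    by_cases hr : r = i
    · subst hr
      simp [copyRow, slotMap, fiberRows_inl]
    · simp [copyRow, slotMap, hr, fiberRows_inr]

/-- The matrix `A` with its `i`-th row replaced by that of `-I`. -/
def resetMat (i : Fin m) (A : Matrix (Fin m) (Fin m) ℝ) : Matrix (Fin m) (Fin m) ℝ :=
  A.updateRow i ((-1 : Matrix (Fin m) (Fin m) ℝ) i)

theorem copyRow_inr_fiberRows (i : Fin m) (A : Matrix (Fin m) (Fin m) ℝ) :
    copyRow (Sum.inr i) (Sum.inl i) (fiberRows A) = fiberRows (resetMat i A) := by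
  ext (r | r) t
  · by_cases hr : r = i
    · subst hr
      simp [copyRow, slotMap, fiberRows_inl, fiberRows_inr, resetMat]
    · simp [copyRow, slotMap, fiberRows_inl, resetMat, hr, Matrix.updateRow_ne]
  · simp [copyRow, slotMap, fiberRows_inr]

theorem fiberMat_mul_apply (A N : Matrix (Fin m) (Fin m) ℝ) (j : Cube m) (r t : Fin m) :
    (fiberMat A j * N) r t = (fiberRows A * N) (if j r then Sum.inr r else Sum.inl r) t := by
  rw [Matrix.mul_apply, Matrix.mul_apply]
  refine Finset.sum_congr rfl fun s _ => ?_
  congr 1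
  rw [fiberMat, Matrix.of_apply]
  split_ifs <;> rfl

/-- All determinants of the pivoted matrix are determinants of `A` with `j(i)` frozen to zero,
divided up to sign by `A i i`. -/
theorem fiberMat_pivotMat (i : Fin m) {A : Matrix (Fin m) (Fin m) ℝ} (h : A i i ≠ 0)
    (j : Cube m) : fiberMat (pivotMat i A) j * pivotFactor i A =
      fiberMat A (Function.update j i false) := by
  ext r t
  rw [fiberMat_mul_apply, ← copyRow_inl_fiberRows i h, fiberMat, Matrix.of_apply]
  by_cases hr : r = i
  · subst hr
    cases hj : j r <;> simp [copyRow, slotMap, fiberRows_inl]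
  · cases hj : j r <;> simp [copyRow, slotMap, fiberRows_inl, fiberRows_inr, hr, hj]

theorem fiberMat_resetMat (i : Fin m) (A : Matrix (Fin m) (Fin m) ℝ)
    (j : Cube m) : fiberMat (resetMat i A) j = fiberMat A (Function.update j i true) := by
  ext r t
  rw [fiberMat, fiberMat, Matrix.of_apply, Matrix.of_apply]
  by_cases hr : r = i
  · subst hr
    simp [resetMat]
  · simp [resetMat, hr, Matrix.updateRow_ne]

/-- The determinants lose a factor `|A i i| ≤ R`, the entries are divided by `|A i i| ≥ ε`. Pivoting
creates the row of `-I` in slot `i` and keeps the earlier ones, because their entries in column `i`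
vanish. -/
theorem Admissible.pivotMat {S : Finset (Fin m)} {ε R : ℝ} {A : Matrix (Fin m) (Fin m) ℝ}
    (hA : Admissible S ε R A) (hε : 0 < ε) (hR : 1 ≤ R) {i : Fin m} (hi : i ∉ S) :
    Admissible (insert i S) (ε / R) (R + R ^ 2 / ε) (pivotMat i A) := by
  have hR0 : 0 < R := by linarith
  have hd := hA.diag i
  have hd0 : A i i ≠ 0 := abs_pos.1 (hε.trans_le hd)
  refine admissible_of_fiberMat (fun j => ?_) (fun r s => ?_) (fun r hr s => ?_)
  · have h1 := hA.fiberMat (Function.update j i false)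
    rw [← fiberMat_pivotMat i hd0, Matrix.det_mul, det_pivotFactor, abs_mul, abs_neg] at h1
    rw [div_le_iff₀ hR0]
    exact h1.trans (mul_le_mul_of_nonneg_left (hA.entry i i) (abs_nonneg _))
  · rw [CubicalBL.pivotMat, Matrix.of_apply]
    have h2 : R / ε ≤ R ^ 2 / ε := by
      rw [sq]
      gcongr
      nlinarith
    split_ifs
    · rw [abs_neg, abs_div]
      calc |A r i| / |A i i| ≤ R / ε := div_le_div₀ hR0.le (hA.entry r i) hε hd
        _ ≤ _ := by linarith
    · refine (abs_sub _ _).trans (add_le_add (hA.entry r s) ?_)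
      rw [abs_div, abs_mul, sq]
      exact div_le_div₀ (by positivity) (mul_le_mul (hA.entry r i) (hA.entry i s)
        (abs_nonneg _) hR0.le) hε hd
  · rw [CubicalBL.pivotMat, Matrix.of_apply]
    by_cases hri : r = i
    · subst hri
      by_cases hs : s = r
      · subst hs
        simp [hd0]
      · have hs' : r ≠ s := fun h => hs h.symm
        simp [hs, hs', hd0]
    · have hr' := (Finset.mem_insert.1 hr).resolve_left hri
      have h0 : A r i = 0 := by
        rw [hA.row r hr']
        simp [hri]
      simp only [h0, zero_div, neg_zero, zero_mul, sub_zero]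
      split_ifs with hs
      · subst hs
        simp [hri]
      · exact hA.row r hr' s

/-- Here the determinants are among those of `A` itself, with `j(i)` frozen to one, so nothing is
lost in `ε`. -/
theorem Admissible.resetMat {S : Finset (Fin m)} {ε R : ℝ} {A : Matrix (Fin m) (Fin m) ℝ}
    (hA : Admissible S ε R A) (hR : 1 ≤ R) (i : Fin m) :
    Admissible (insert i S) ε R (resetMat i A) := by
  refine admissible_of_fiberMat (fun j => ?_) (fun r s => ?_) (fun r hr s => ?_)
  · rw [fiberMat_resetMat]
    exact hA.fiberMat _
  · rw [CubicalBL.resetMat, Matrix.updateRow_apply]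
    split_ifs
    · rw [Matrix.neg_apply, abs_neg, Matrix.one_apply]
      split_ifs
      · simpa using hR
      · simp only [abs_zero]
        linarith
    · exact hA.entry r s
  · rw [CubicalBL.resetMat, Matrix.updateRow_apply]
    split_ifs with h
    · rw [h]
    · exact hA.row r ((Finset.mem_insert.1 hr).resolve_left h) s

theorem Admissible.mono {S : Finset (Fin m)} {ε R ε' R' : ℝ} {A : Matrix (Fin m) (Fin m) ℝ}
    (hA : Admissible S ε R A) (hε : ε' ≤ ε) (hR : R ≤ R') : Admissible S ε' R' A :=
  ⟨fun j => hε.trans (hA.det j), fun r s => (hA.entry r s).trans hR, hA.row⟩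

theorem Admissible.fiberRows_eq {S : Finset (Fin m)} {ε R : ℝ} {A : Matrix (Fin m) (Fin m) ℝ}
    (hA : Admissible S ε R A) {i : Fin m} (hi : i ∈ S) (s : Fin m) :
    fiberRows A (Sum.inl i) s = fiberRows A (Sum.inr i) s := by
  rw [fiberRows_inl, fiberRows_inr, hA.row i hi, Matrix.neg_apply, neg_neg]

/-- Translate the shift into the weight, dominate the translated Gaussian by one of width `L`, and
rescale to width one. -/
theorem energy_le_of_symm {S : Finset (Fin m)} {ε R : ℝ} {A : Matrix (Fin m) (Fin m) ℝ}
    (hA : Admissible S ε R A) {F : Cube m → 𝓢(BlockVec (Fin m) d, ℝ)} (hF : SymTuple S F)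
    {i : Fin m} (hi : i ∈ S) {N : Matrix (Fin m) (Fin m) ℝ} (hN : N.det ≠ 0)
    {v : BlockVec (Fin m ⊕ Fin m) d} (hv : ∀ k, v (Sum.inl i, k) = v (Sum.inr i, k))
    {p₀ : BlockVec (Fin m) d}
    (h0 : ∀ k, (v + blockAct (fiberRows A * N) p₀) (Sum.inl i, k) = 0) {L : ℝ} (hL : 0 < L)
    (hv' : 1 + ‖WithLp.toLp 2 (restVec i (v + blockAct (fiberRows A * N) p₀))‖ ≤ L) (k : Fin d) :
    energy i (restGauss i d 1) (fiberRows A * N) v F k k ≤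
      Real.exp Real.pi * ((|N.det| ^ d)⁻¹ * L ^ (2 * d * (m - 1)) *
        energy i (restGauss i d 1) (fiberRows (scaleMat (slotScale i L) A)) 0
          (scaleTuple (slotScale i L) (slotScale_pos i hL) F) k k) := by
  have hB : ∀ s, (fiberRows A * N) (Sum.inl i) s = (fiberRows A * N) (Sum.inr i) s := by
    intro s
    rw [Matrix.mul_apply, Matrix.mul_apply]
    simp only [hA.fiberRows_eq hi]
  rw [energy_translate _ hB hv (hF.symm i hi) k p₀ h0, ← energy_slotScale i hL A N hN,
    ← energy_const_mul]
  refine energy_mono ((integrable_restGauss i d one_pos).comp_sub_right _)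
    ((integrable_restGauss i d hL).const_mul _) (fun y => restGauss_sub_le i y _ hv') ?_ hB
    (hF.symm i hi) k
  rw [lowerMat_mul, lowerMat_fiberRows, one_mul]
  exact hN

theorem norm_toLp_le_card_mul {ι : Type} [Fintype ι] {f : ι → ℝ} {c : ℝ} (hc : 0 ≤ c)
    (h : ∀ p, |f p| ≤ c) : ‖WithLp.toLp 2 f‖ ≤ Fintype.card ι * c := by
  refine le_of_sq_le_sq ?_ (by positivity)
  rw [EuclideanSpace.norm_sq_eq]
  rcases Nat.eq_zero_or_pos (Fintype.card ι) with h0 | h0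
  · have := Fintype.card_eq_zero_iff.1 h0
    simp
  · calc ∑ p, ‖f p‖ ^ 2 ≤ ∑ _p : ι, c ^ 2 := by
          gcongr with p
          exact h p
      _ = Fintype.card ι * c ^ 2 := by
          rw [Finset.sum_const, Finset.card_univ, nsmul_eq_mul]
      _ ≤ Fintype.card ι * (Fintype.card ι * c ^ 2) := by
          refine le_mul_of_one_le_left (by positivity) ?_
          exact_mod_cast h0
      _ = _ := by ring

theorem scaleTuple_comm (δ δ' : Fin m → ℝ) (hδ : ∀ r, 0 < δ r) (hδ' : ∀ r, 0 < δ' r)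
    (F : Cube m → 𝓢(BlockVec (Fin m) d, ℝ)) :
    scaleTuple δ hδ (scaleTuple δ' hδ' F) = scaleTuple δ' hδ' (scaleTuple δ hδ F) := by
  rw [scaleTuple_scaleTuple, scaleTuple_scaleTuple]
  congr 1
  funext r
  ring

/-- The oscillation of symmetric data is nonnegative. -/
theorem osc_symm_nonneg {S : Finset (Fin m)} {ε R : ℝ} {A : Matrix (Fin m) (Fin m) ℝ}
    (hA : Admissible S ε R A) {F : Cube m → 𝓢(BlockVec (Fin m) d, ℝ)} (hF : SymTuple S F)
    {i : Fin m} (hi : i ∈ S) (k : Fin d) {t : ℝ} (ht : 0 < t) :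
    osc A F i k k t 0 = (‖osc A F i k k t 0‖ : ℝ) := by
  have h : 0 ≤ energy i (restGauss i d 1) (fiberRows A) 0
      (scaleTuple (fun _ => t) (fun _ => ht) F) k k :=
    energy_nonneg (restGauss_nonneg i 1) (hA.fiberRows_eq hi) (fun _ => rfl)
      ((hF.scaleTuple _ _).symm i hi) k
  rw [osc_eq_osc_one A F i k k ht, osc_one_zero_eq_energy, Complex.norm_real,
    Real.norm_of_nonneg (by positivity)]

theorem energy_le_norm_osc (i : Fin m) (A : Matrix (Fin m) (Fin m) ℝ)
    (F : Cube m → 𝓢(BlockVec (Fin m) d, ℝ)) (k : Fin d) {t : ℝ} (ht : 0 < t) :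
    4 * Real.pi ^ 2 * energy i (restGauss i d 1) (fiberRows A) 0
      (scaleTuple (fun _ => t) (fun _ => ht) F) k k ≤ ‖osc A F i k k t 0‖ := by
  rw [osc_eq_osc_one A F i k k ht, osc_one_zero_eq_energy, Complex.norm_real]
  exact Real.le_norm_self _

/-- The symmetrized data may depend on `u`, through the width `L`, but not on `t`; so the estimate
can be integrated over the scales and the right side is again a square function of fixed admissible
data. -/
theorem exists_norm_osc_le (d : ℕ) {S : Finset (Fin m)} {i : Fin m} (hi : i ∉ S) {ε R : ℝ}
    (hε : 0 < ε) (hR : 1 ≤ R) :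
    ∃ C ε' R' : ℝ, 0 ≤ C ∧ 0 < ε' ∧ 1 ≤ R' ∧ ∀ (A : Matrix (Fin m) (Fin m) ℝ)
      (F : Cube m → 𝓢(BlockVec (Fin m) d, ℝ)) (k₁ k₂ : Fin d) (u : BlockVec (Fin m) d),
      Admissible S ε R A → SymTuple S F →
      ∃ (A₀ A₁ : Matrix (Fin m) (Fin m) ℝ) (F₀ F₁ : Cube m → 𝓢(BlockVec (Fin m) d, ℝ)),
        (Admissible (insert i S) ε' R' A₀ ∧ SymTuple (insert i S) F₀) ∧
        (Admissible (insert i S) ε' R' A₁ ∧ SymTuple (insert i S) F₁) ∧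
        ∀ t, 0 < t → ‖osc A F i k₁ k₂ t u‖ ≤ C * (1 + ‖u‖) ^ (2 * d * (m - 1)) *
          (‖osc A₀ F₀ i k₁ k₁ t 0‖ + ‖osc A₁ F₁ i k₂ k₂ t 0‖) := by
  have hR0 : 0 < R := by linarith
  -- Each coordinate of the displaced Gaussian's centre is at most `(1 + R/ε)|u|`; so a width `L =
  -- K(1 + |u|)` suffices for `restGauss_sub_le`.
  set K : ℝ := Fintype.card (RestIdx i d) * (1 + R / ε) + 1 with hK
  have hK0 : 0 ≤ Fintype.card (RestIdx i d) * (1 + R / ε) := by positivity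
  refine ⟨Real.exp Real.pi * (((min ε 1) ^ d)⁻¹ * K ^ (2 * d * (m - 1))), ε / R, R + R ^ 2 / ε,
    by positivity, by positivity, by linarith [show 0 ≤ R ^ 2 / ε by positivity], ?_⟩
  intro A F k₁ k₂ u hA hF
  have hd := hA.diag i
  have hd0 : A i i ≠ 0 := abs_pos.1 (hε.trans_le hd)
  set L : ℝ := K * (1 + ‖u‖) with hLdef
  have hL1 : 1 + Fintype.card (RestIdx i d) * ((1 + R / ε) * ‖u‖) ≤ L := by
    rw [hLdef, hK]
    nlinarith [norm_nonneg u, mul_nonneg hK0 (norm_nonneg u)]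
  have hLone : 1 ≤ L := le_trans (le_add_of_nonneg_right (by positivity)) hL1
  have hL : 0 < L := by linarith
  have hiS : i ∈ insert i S := Finset.mem_insert_self i S
  have hscale : ∀ {A' : Matrix (Fin m) (Fin m) ℝ},
      Admissible (insert i S) (ε / R) (R + R ^ 2 / ε) A' →
      Admissible (insert i S) (ε / R) (R + R ^ 2 / ε) (scaleMat (slotScale i L) A') := by
    intro A' hA'
    refine hA'.scaleMat (slotScale_pos i hL) fun r hr s => ?_
    have hri : r ≠ i := fun h => hr (h ▸ hiS)
    simp only [slotScale, hri, if_false]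
    split_ifs
    · exact hLone
    · exact le_rfl
  have hA0 := hA.pivotMat hε hR hi
  have hA1 : Admissible (insert i S) (ε / R) (R + R ^ 2 / ε) (resetMat i A) :=
    (hA.resetMat hR i).mono (div_le_self hε.le hR)
      (by linarith [show 0 ≤ R ^ 2 / ε by positivity])
  have hF0 := hF.freezeTuple i false
  have hF1 := hF.freezeTuple i true
  refine ⟨_, _, _, _, ⟨hscale hA0, hF0.scaleTuple _ (slotScale_pos i hL)⟩,
    ⟨hscale hA1, hF1.scaleTuple _ (slotScale_pos i hL)⟩, fun t ht => ?_⟩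
  set Ft := scaleTuple (fun _ => t) (fun _ => ht) F with hFt
  have hFt' : SymTuple S Ft := hF.scaleTuple _ _
  set v := fiberPt A (-u, 0) with hv
  have hv1 : ∀ r k, v (Sum.inl r, k) = -u (r, k) := fun r k => by
    rw [hv, fiberPt_inl]
    simp
  have hv2 : ∀ r k, v (Sum.inr r, k) = 0 := fun r k => by
    rw [hv, fiberPt_inr]
    simp
  have hN0 : (pivotFactor i A).det ≠ 0 := by
    rw [det_pivotFactor]
    exact neg_ne_zero.2 hd0
  have hcopy := copyRow_inl_fiberRows i hd0
  have h1 := abs_energy_le i (integrable_restGauss i d one_pos) (restGauss_nonneg i 1)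
    (B := fiberRows A) (by rw [lowerMat_fiberRows]; simp)
    (by rw [hcopy, lowerMat_mul, lowerMat_fiberRows, one_mul]; exact hN0) v Ft k₁ k₂
  have hue : ∀ p, |u p| ≤ ‖u‖ := abs_apply_le_norm u
  have hr1 : |A i i|⁻¹ ≤ ε⁻¹ := by gcongr
  -- Chosen such that `-u_i - (A p₀)_i = 0`, which removes the shift from the slot `x_i^0`.
  set p₀ : BlockVec (Fin m) d := WithLp.toLp 2 fun q => if q.1 = i then -(u (i, q.2) / A i i) else 0
    with hp₀
  have hBp : ∀ (r : Fin m ⊕ Fin m) (k : Fin d),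
      blockAct (fiberRows A) p₀ (r, k) = -(fiberRows A r i * (u (i, k) / A i i)) := by
    intro r k
    rw [blockAct_apply]
    simp [hp₀]
  have hcp : ∀ (r : Fin m ⊕ Fin m) (k : Fin d),
      blockAct (copyRow (Sum.inl i) (Sum.inr i) (fiberRows A)) p₀ (r, k) =
        blockAct (fiberRows A) p₀ (slotMap (Sum.inl i) (Sum.inr i) r, k) := fun _ _ => rfl
  have h2 : energy i (restGauss i d 1) (copyRow (Sum.inl i) (Sum.inr i) (fiberRows A))
      (copyEntry (Sum.inl i) (Sum.inr i) v) (freezeTuple i false Ft) k₁ k₁ ≤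
      Real.exp Real.pi * ((|(pivotFactor i A).det| ^ d)⁻¹ * L ^ (2 * d * (m - 1)) *
        energy i (restGauss i d 1) (fiberRows (scaleMat (slotScale i L) (pivotMat i A))) 0
          (scaleTuple (slotScale i L) (slotScale_pos i hL) (freezeTuple i false Ft)) k₁ k₁) := by
    rw [hcopy]
    refine energy_le_of_symm hA0 (hFt'.freezeTuple i false) hiS hN0 ?_ (p₀ := p₀) ?_ hL ?_ k₁
    · intro k
      simp [copyEntry_apply, slotMap]
    · intro k
      rw [← hcopy, PiLp.add_apply, copyEntry_apply, hcp, hBp]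
      simp only [slotMap, reduceCtorEq, if_false, hv1, fiberRows_inl]
      field_simp
      ring
    · rw [← hcopy]
      refine le_trans (add_le_add_right (norm_toLp_le_card_mul
        (c := (1 + R / ε) * ‖u‖) (by positivity) ?_) 1) hL1
      rintro ⟨⟨r | r, k⟩, hr0, hr1'⟩
      · simp only [restVec, PiLp.add_apply, copyEntry_apply, hcp, hBp]
        simp only [slotMap, reduceCtorEq, if_false, hv1, fiberRows_inl]
        have h3 : |A r i * (u (i, k) / A i i)| ≤ R / ε * ‖u‖ := by
          rw [abs_mul, abs_div, div_eq_mul_inv, div_mul_eq_mul_div, div_eq_mul_inv]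
          calc |A r i| * (|u (i, k)| * |A i i|⁻¹) ≤ R * (‖u‖ * ε⁻¹) := by
                gcongr
                · exact hA.entry r i
                · exact hue _
            _ = _ := by ring
        calc _ ≤ |u (r, k)| + |A r i * (u (i, k) / A i i)| := by
              rw [← abs_neg (u (r, k))]
              refine le_trans (le_of_eq ?_) (abs_add_le _ _)
              congr 1
              ring
          _ ≤ ‖u‖ + R / ε * ‖u‖ := add_le_add (hue _) h3
          _ = _ := by ring
      · have hri : r ≠ i := fun h => hr1' (by rw [h])
        simp only [restVec, PiLp.add_apply, copyEntry_apply, hcp, hBp]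
        have : ¬ (Sum.inr r : Fin m ⊕ Fin m) = Sum.inr i := by simpa using hri
        simp only [slotMap, this, if_false, hv2, fiberRows_inr, Matrix.one_apply, hri]
        simp only [zero_mul, neg_zero, add_zero, abs_zero]
        positivity
  have h4 : energy i (restGauss i d 1) (copyRow (Sum.inr i) (Sum.inl i) (fiberRows A))
      (copyEntry (Sum.inr i) (Sum.inl i) v) (freezeTuple i true Ft) k₂ k₂ ≤
      Real.exp Real.pi * ((|(1 : Matrix (Fin m) (Fin m) ℝ).det| ^ d)⁻¹ * L ^ (2 * d * (m - 1)) *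
        energy i (restGauss i d 1) (fiberRows (scaleMat (slotScale i L) (resetMat i A))) 0
          (scaleTuple (slotScale i L) (slotScale_pos i hL) (freezeTuple i true Ft)) k₂ k₂) := by
    rw [copyRow_inr_fiberRows, ← Matrix.mul_one (fiberRows (resetMat i A))]
    -- The shift `(-u, 0)` has no component in `x_i^1`, which now fills both slots; no translation
    -- of the parameter is needed.
    refine energy_le_of_symm hA1 (hFt'.freezeTuple i true) hiS (by simp) ?_ (p₀ := 0) ?_ hL ?_ k₂
    · intro k
      simp [copyEntry_apply, slotMap]
    · intro k
      rw [map_zero, add_zero, copyEntry_apply]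
      simp [slotMap, hv2]
    · rw [map_zero, add_zero]
      refine le_trans (add_le_add_right (norm_toLp_le_card_mul
        (c := (1 + R / ε) * ‖u‖) (by positivity) ?_) 1) hL1
      rintro ⟨⟨r | r, k⟩, hr0, hr1'⟩
      · have hri : r ≠ i := fun h => hr0 (by rw [h])
        have : ¬ (Sum.inl r : Fin m ⊕ Fin m) = Sum.inl i := by simpa using hri
        simp only [restVec, copyEntry_apply, slotMap, this, if_false, hv1, abs_neg]
        refine (hue _).trans (le_mul_of_one_le_left (norm_nonneg u) ?_)
        linarith [show 0 ≤ R / ε by positivity]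
      · simp only [restVec, copyEntry_apply, slotMap, reduceCtorEq, if_false, hv2, abs_zero]
        positivity
  -- Dilations commute with each other and with freezing; this makes the symmetrized tuples
  -- independent of `t`.
  have hfz : ∀ b, scaleTuple (slotScale i L) (slotScale_pos i hL) (freezeTuple i b Ft) =
      scaleTuple (fun _ => t) (fun _ => ht)
        (scaleTuple (slotScale i L) (slotScale_pos i hL) (freezeTuple i b F)) := fun b => by
    rw [scaleTuple_comm]
    rfl
  rw [hfz] at h2 h4
  have h5 := energy_le_norm_osc i (scaleMat (slotScale i L) (pivotMat i A))
    (scaleTuple (slotScale i L) (slotScale_pos i hL) (freezeTuple i false F)) k₁ ht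
  have h6 := energy_le_norm_osc i (scaleMat (slotScale i L) (resetMat i A))
    (scaleTuple (slotScale i L) (slotScale_pos i hL) (freezeTuple i true F)) k₂ ht
  rw [osc_eq_osc_one A F i k₁ k₂ ht, osc_one_eq_energy, Complex.norm_real, Real.norm_eq_abs,
    abs_mul, abs_of_pos (show (0 : ℝ) < 4 * Real.pi ^ 2 by positivity)]
  -- One constant for both parameter changes: the pivot has determinant at least `ε` in modulus, the
  -- reset uses the identity.
  have hmin : 0 < min ε 1 := lt_min hε one_pos
  have hc0 : (|(pivotFactor i A).det| ^ d)⁻¹ ≤ ((min ε 1) ^ d)⁻¹ := by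
    rw [det_pivotFactor, abs_neg]
    gcongr
    exact (min_le_left _ _).trans hd
  have hc1 : (|(1 : Matrix (Fin m) (Fin m) ℝ).det| ^ d)⁻¹ ≤ ((min ε 1) ^ d)⁻¹ := by
    rw [Matrix.det_one, abs_one]
    gcongr
    exact min_le_right _ _
  set E0 := energy i (restGauss i d 1) (fiberRows (scaleMat (slotScale i L) (pivotMat i A))) 0
    (scaleTuple (fun _ => t) (fun _ => ht)
        (scaleTuple (slotScale i L) (slotScale_pos i hL) (freezeTuple i false F))) k₁ k₁
  set E1 := energy i (restGauss i d 1) (fiberRows (scaleMat (slotScale i L) (resetMat i A))) 0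
    (scaleTuple (fun _ => t) (fun _ => ht)
        (scaleTuple (slotScale i L) (slotScale_pos i hL) (freezeTuple i true F))) k₂ k₂
  set O0 := ‖osc (scaleMat (slotScale i L) (pivotMat i A))
    (scaleTuple (slotScale i L) (slotScale_pos i hL) (freezeTuple i false F)) i k₁ k₁ t 0‖
  set O1 := ‖osc (scaleMat (slotScale i L) (resetMat i A))
    (scaleTuple (slotScale i L) (slotScale_pos i hL) (freezeTuple i true F)) i k₂ k₂ t 0‖
  have hLp : L ^ (2 * d * (m - 1)) = K ^ (2 * d * (m - 1)) * (1 + ‖u‖) ^ (2 * d * (m - 1)) := by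
    rw [hLdef, mul_pow]
  have hfin : ∀ {c E O : ℝ}, 0 ≤ c → 0 ≤ O → c ≤ ((min ε 1) ^ d)⁻¹ → 4 * Real.pi ^ 2 * E ≤ O →
      4 * Real.pi ^ 2 * (Real.exp Real.pi * (c * L ^ (2 * d * (m - 1)) * E)) ≤
      Real.exp Real.pi * (((min ε 1) ^ d)⁻¹ * L ^ (2 * d * (m - 1))) * O := by
    intro c E O hc hO hcm hE
    calc _ = Real.exp Real.pi * (c * L ^ (2 * d * (m - 1))) * (4 * Real.pi ^ 2 * E) := by ring
      _ ≤ Real.exp Real.pi * (c * L ^ (2 * d * (m - 1))) * O := by gcongr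
      _ ≤ _ := by gcongr
  calc _ ≤ 4 * Real.pi ^ 2 * (_ + _) := by gcongr
    _ ≤ 4 * Real.pi ^ 2 * _ + 4 * Real.pi ^ 2 * _ := by
        rw [← mul_add]
        exact mul_le_mul_of_nonneg_left (add_le_add h2 h4) (by positivity)
    _ ≤ _ := add_le_add (hfin (by positivity) (norm_nonneg _) hc0 h5)
        (hfin (by positivity) (norm_nonneg _) hc1 h6)
    _ = _ := by
        rw [hLp]
        ring

end CubicalBL

end

noncomputable section
namespace CubicalBL

/-! ### Uniform symbol estimates -/

section Symbols

variable {E F G : Type} [NormedAddCommGroup E] [NormedSpace ℝ E] [NormedAddCommGroup F]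
  [NormedSpace ℝ F] [NormedAddCommGroup G] [NormedSpace ℝ G]

theorem iteratedFDeriv_comp_add_clm {N : ℕ} (g : G →L[ℝ] E) (a : E) {f : E → F}
    {U : Set E} (hU : IsOpen U) (hf : ContDiffOn ℝ N f U) {x : G} (hx : a + g x ∈ U) {n : ℕ}
    (hn : n ≤ N) : iteratedFDeriv ℝ n (fun x => f (a + g x)) x =
      (iteratedFDeriv ℝ n f (a + g x)).compContinuousLinearMap fun _ => g := by
  set f' : E → F := fun y => f (a + y) with hf'
  set U' : Set E := (fun y => a + y) ⁻¹' U with hU'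
  have hU'o : IsOpen U' := hU.preimage (by fun_prop)
  have hf'c : ContDiffOn ℝ N f' U' := hf.comp (by fun_prop) (fun y hy => hy)
  have h1 := g.iteratedFDerivWithin_comp_right hf'c hU'o.uniqueDiffOn
    (hU'o.preimage g.continuous).uniqueDiffOn (x := x) hx (i := n) (by exact_mod_cast hn)
  rw [iteratedFDerivWithin_of_isOpen n (hU'o.preimage g.continuous) (by exact hx),
    iteratedFDerivWithin_of_isOpen n hU'o (by exact hx)] at h1
  change iteratedFDeriv ℝ n (f' ∘ g) x = _
  rw [h1, ← iteratedFDeriv_comp_add_left]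

theorem norm_iteratedFDeriv_comp_add_clm_le {N : ℕ} (g : G →L[ℝ] E) (a : E) {f : E → F}
    {U : Set E} (hU : IsOpen U) (hf : ContDiffOn ℝ N f U) {x : G} (hx : a + g x ∈ U) {n : ℕ}
    (hn : n ≤ N) :
    ‖iteratedFDeriv ℝ n (fun x => f (a + g x)) x‖ ≤
      ‖iteratedFDeriv ℝ n f (a + g x)‖ * ‖g‖ ^ n := by
  rw [iteratedFDeriv_comp_add_clm g a hU hf hx hn]
  refine (ContinuousMultilinearMap.norm_compContinuousLinearMap_le _ _).trans ?_
  simp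

/-- Joint smoothness and compactness give derivative bounds uniform in the parameter `p`. In the
applications the parameter is the matrix `A`. -/
theorem exists_norm_iteratedFDeriv_section_le {N : ℕ} {f : E × G → F} {U K : Set (E × G)}
    (hU : IsOpen U) (hf : ContDiffOn ℝ N f U) (hK : IsCompact K) (hKU : K ⊆ U) :
    ∃ C : ℝ, 0 ≤ C ∧ ∀ p ξ, (p, ξ) ∈ K → ∀ n ≤ N,
      ‖iteratedFDeriv ℝ n (fun ξ => f (p, ξ)) ξ‖ ≤ C := by
  have h : ∀ n : ℕ, ∃ C : ℝ, n ≤ N → ∀ x ∈ K, ‖iteratedFDeriv ℝ n f x‖ ≤ C := by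
    intro n
    by_cases hn : n ≤ N
    · have h1 : ContinuousOn (iteratedFDeriv ℝ n f) U :=
        (hf.continuousOn_iteratedFDerivWithin (by exact_mod_cast hn) hU.uniqueDiffOn).congr
          fun x hx => (iteratedFDerivWithin_of_isOpen n hU hx).symm
      obtain ⟨C, hC⟩ := hK.exists_bound_of_continuousOn (h1.mono hKU)
      exact ⟨C, fun _ => hC⟩
    · exact ⟨0, fun h => absurd h hn⟩
  choose C hC using h
  refine ⟨∑ n ∈ Finset.range (N + 1), |C n|, Finset.sum_nonneg fun _ _ => abs_nonneg _,
    fun p ξ hx n hn => ?_⟩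
  have h2 : ∀ ξ : G, ((p, (0 : G)) : E × G) + ContinuousLinearMap.inr ℝ E G ξ = (p, ξ) := by
    intro ξ
    simp
  have h1 := norm_iteratedFDeriv_comp_add_clm_le (ContinuousLinearMap.inr ℝ E G) (p, 0) hU hf
    (x := ξ) (by rw [h2]; exact hKU hx) hn
  simp only [h2] at h1
  calc _ ≤ _ := h1
    _ ≤ C n * 1 ^ n := by
        gcongr
        · exact (norm_nonneg _).trans (hC n hn _ hx)
        · exact hC n hn _ hx
        · exact ContinuousLinearMap.norm_inr_le_one ℝ E G
    _ ≤ |C n| := by simpa using le_abs_self _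
    _ ≤ _ := Finset.single_le_sum (f := fun n => |C n|) (fun _ _ => abs_nonneg _)
        (Finset.mem_range.2 (by omega))

/-- Differentiate `f(x) = f(x/|ξ|)` at `x = ξ`, where the inner point lies on the unit sphere. -/
theorem norm_iteratedFDeriv_le_of_homogeneous {N : ℕ} {f : G → F}
    (hf : ContDiffOn ℝ N f {0}ᶜ) (hom : ∀ c : ℝ, 0 < c → ∀ ξ, f (c • ξ) = f ξ) {C : ℝ}
    (hC : ∀ n ≤ N, ∀ ξ, ‖ξ‖ = 1 → ‖iteratedFDeriv ℝ n f ξ‖ ≤ C) {n : ℕ} (hn : n ≤ N) {ξ : G}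
    (hξ : ξ ≠ 0) : ‖iteratedFDeriv ℝ n f ξ‖ ≤ C * (‖ξ‖ ^ n)⁻¹ := by
  have hξ' : 0 < ‖ξ‖ := norm_pos_iff.2 hξ
  have h1 := norm_iteratedFDeriv_comp_add_clm_le (‖ξ‖⁻¹ • ContinuousLinearMap.id ℝ G) 0
    isOpen_compl_singleton hf (x := ξ) (by simp [hξ]) hn
  have h2 : (fun x => f (0 + (‖ξ‖⁻¹ • ContinuousLinearMap.id ℝ G) x)) = f := by
    funext x
    rw [zero_add]
    exact hom _ (inv_pos.2 hξ') x
  rw [h2] at h1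
  refine h1.trans ?_
  have h3 : ‖(0 : G) + (‖ξ‖⁻¹ • ContinuousLinearMap.id ℝ G) ξ‖ = 1 := by
    rw [zero_add]
    change ‖‖ξ‖⁻¹ • ξ‖ = 1
    rw [norm_smul, norm_inv, norm_norm, inv_mul_cancel₀ hξ'.ne']
  have h4 := hC n hn _ h3
  have h5 : ‖‖ξ‖⁻¹ • ContinuousLinearMap.id ℝ G‖ ≤ ‖ξ‖⁻¹ := by
    rw [norm_smul, norm_inv, norm_norm]
    exact mul_le_of_le_one_right (by positivity) ContinuousLinearMap.norm_id_le
  rw [← inv_pow]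
  gcongr
  exact (norm_nonneg _).trans h4

/-- `f` is `N` times continuously differentiable off the origin, with differentials of order
`n ≤ N` bounded by `B |ξ|^{-n}`. -/
structure IsSymbol (N : ℕ) (B : ℝ) (f : G → F) : Prop where
  contDiffOn : ContDiffOn ℝ N f {0}ᶜ
  bound : ∀ n ≤ N, ∀ ξ, ξ ≠ 0 → ‖iteratedFDeriv ℝ n f ξ‖ ≤ B * (‖ξ‖ ^ n)⁻¹

theorem IsSymbol.contDiffAt {N : ℕ} {B : ℝ} {f : G → F} (h : IsSymbol N B f) {ξ : G}
    (hξ : ξ ≠ 0) : ContDiffAt ℝ N f ξ :=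
  h.contDiffOn.contDiffAt (isOpen_compl_singleton.mem_nhds hξ)

theorem IsSymbol.const_smul {N : ℕ} {B : ℝ} {f : G → F} (h : IsSymbol N B f) (c : ℝ) :
    IsSymbol N (|c| * B) fun ξ => c • f ξ := by
  refine ⟨h.contDiffOn.const_smul c, fun n hn ξ hξ => ?_⟩
  rw [iteratedFDeriv_const_smul_apply' ((h.contDiffAt hξ).of_le (by exact_mod_cast hn)),
    norm_smul, Real.norm_eq_abs, mul_assoc]
  exact mul_le_mul_of_nonneg_left (h.bound n hn ξ hξ) (abs_nonneg _)

end Symbols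

/-! ### The two statements of the induction -/

variable {m d : ℕ}

/-- Multipliers with symbol estimates that vanish where all frequencies outside `S` vanish have
bounded forms, for matrices and tuples adapted to `S`. -/
def SymbolBound (d : ℕ) (S : Finset (Fin m)) : Prop :=
  ∀ ε R : ℝ, 0 < ε → 1 ≤ R → ∃ C : ℝ, 0 ≤ C ∧ ∀ (A : Matrix (Fin m) (Fin m) ℝ)
    (F : Cube m → 𝓢(BlockVec (Fin m) d, ℝ)) (M : BlockVec (Fin m) d → ℂ) (B : ℝ),
    Admissible S ε R A → SymTuple S F → 0 < B → IsSymbol (3 * d * m) B M →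
    (∀ ξ, ξ ≠ 0 → (∀ k ∉ S, ∀ q, ξ (k, q) = 0) → M ξ = 0) → ‖pairing M A F‖ ≤ C * B

/-- The square functions with Gaussian kernels in the slots outside `S` are bounded, for matrices
and tuples adapted to `S`. -/
def SquareBound (d : ℕ) (S : Finset (Fin m)) : Prop :=
  ∀ ε R : ℝ, 0 < ε → 1 ≤ R → ∃ C : ℝ, 0 ≤ C ∧ ∀ (A : Matrix (Fin m) (Fin m) ℝ)
    (F : Cube m → 𝓢(BlockVec (Fin m) d, ℝ)) (i : Fin m) (k₁ k₂ : Fin d)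
    (u : BlockVec (Fin m) d), i ∉ S → Admissible S ε R A → SymTuple S F →
    ∫⁻ t in Ioi (0 : ℝ), ‖osc A F i k₁ k₂ t u‖ₑ * ENNReal.ofReal t⁻¹ ≤
      ENNReal.ofReal (C * (1 + ‖u‖) ^ (2 * d * (m - 1)))

/-! ### Integration over the scales -/

theorem enorm_complex_ofReal (x : ℝ) : ‖(x : ℂ)‖ₑ = ‖x‖ₑ := by
  rw [← ofReal_norm, Complex.norm_real, ofReal_norm]

/-- The quadratic form `|ξ|² + |Aᵀ ξ|²`. -/
def quadNorm (A : Matrix (Fin m) (Fin m) ℝ) (ξ : BlockVec (Fin m) d) : ℝ :=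
  ‖ξ‖ ^ 2 + ‖blockAct A.transpose ξ‖ ^ 2

theorem quadNorm_pos (A : Matrix (Fin m) (Fin m) ℝ) {ξ : BlockVec (Fin m) d} (hξ : ξ ≠ 0) :
    0 < quadNorm A ξ := by
  have := norm_pos_iff.2 hξ
  unfold quadNorm
  positivity

theorem symb_smul_mul_inv (A : Matrix (Fin m) (Fin m) ℝ) (i : Fin m) (k₁ k₂ : Fin d)
    (ξ : BlockVec (Fin m) d) {t : ℝ} (ht : 0 < t) :
    symb A i k₁ k₂ (t • ξ) * t⁻¹ =
      -(4 * Real.pi ^ 2) * (ξ (i, k₁) * blockAct A.transpose ξ (i, k₂)) *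
        (t * Real.exp (-(Real.pi * quadNorm A ξ) * t ^ 2)) := by
  have h1 : -Real.pi * (‖t • ξ‖ ^ 2 + ‖blockAct A.transpose (t • ξ)‖ ^ 2) =
      -(Real.pi * quadNorm A ξ) * t ^ 2 := by
    rw [map_smul, norm_smul, norm_smul, Real.norm_of_nonneg ht.le, quadNorm]
    ring
  rw [symb, h1, map_smul]
  simp only [PiLp.smul_apply, smul_eq_mul]
  field_simp

theorem integral_mul_exp_neg_mul_sq_Ioi {b : ℝ} (hb : 0 < b) :
    ∫ t in Ioi (0 : ℝ), t * Real.exp (-b * t ^ 2) = (2 * b)⁻¹ := by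
  have h := integral_mul_cexp_neg_mul_sq (b := (b : ℂ)) (by simpa using hb)
  have h2 : (fun r : ℝ => (r : ℂ) * Complex.exp (-(b : ℂ) * (r : ℂ) ^ 2)) =
      fun r : ℝ => ((r * Real.exp (-b * r ^ 2) : ℝ) : ℂ) := by
    funext r
    push_cast
    rfl
  rw [h2, integral_complex_ofReal] at h
  exact_mod_cast h

theorem integrableOn_symb_smul_mul_inv (A : Matrix (Fin m) (Fin m) ℝ) (i : Fin m) (k₁ k₂ : Fin d)
    (ξ : BlockVec (Fin m) d) :
    IntegrableOn (fun t : ℝ => symb A i k₁ k₂ (t • ξ) * t⁻¹) (Ioi 0) := by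
  by_cases hξ : ξ = 0
  · subst hξ
    simp [symb]
  · refine IntegrableOn.congr_fun (((integrable_mul_exp_neg_mul_sq (b := Real.pi * quadNorm A ξ)
      (mul_pos Real.pi_pos (quadNorm_pos A hξ))).const_mul
      (-(4 * Real.pi ^ 2) * (ξ (i, k₁) * blockAct A.transpose ξ (i, k₂)))).integrableOn)
      (fun t ht => (symb_smul_mul_inv A i k₁ k₂ ξ ht).symm) measurableSet_Ioi

theorem integral_symb_smul_mul_inv (A : Matrix (Fin m) (Fin m) ℝ) (i : Fin m) (k₁ k₂ : Fin d)
    (ξ : BlockVec (Fin m) d) :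
    ∫ t in Ioi (0 : ℝ), symb A i k₁ k₂ (t • ξ) * t⁻¹ =
      -(2 * Real.pi) * (ξ (i, k₁) * blockAct A.transpose ξ (i, k₂)) / quadNorm A ξ := by
  by_cases hξ : ξ = 0
  · subst hξ
    simp [symb]
  · have hN := quadNorm_pos A hξ
    rw [setIntegral_congr_fun measurableSet_Ioi
      (fun t ht => symb_smul_mul_inv A i k₁ k₂ ξ ht), integral_const_mul,
      integral_mul_exp_neg_mul_sq_Ioi (mul_pos Real.pi_pos hN)]
    field_simp
    ring

/-- The scale integral of the modulus is explicit, and `2|ξ||Aᵀξ| ≤ |ξ|² + |Aᵀξ|²`. The bound is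
uniform in `ξ`, which justifies each exchange of the scale and frequency integrals, and later shows
that the multiplier of part 2 is bounded. -/
theorem lintegral_symb_smul_mul_inv_le (A : Matrix (Fin m) (Fin m) ℝ) (i : Fin m) (k₁ k₂ : Fin d)
    (ξ : BlockVec (Fin m) d) :
    ∫⁻ t in Ioi (0 : ℝ), ‖symb A i k₁ k₂ (t • ξ) * t⁻¹‖ₑ ≤ ENNReal.ofReal Real.pi := by
  rw [← ofReal_integral_norm_eq_lintegral_enorm (integrableOn_symb_smul_mul_inv A i k₁ k₂ ξ)]
  refine ENNReal.ofReal_le_ofReal ?_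
  by_cases hξ : ξ = 0
  · subst hξ
    simp [symb, Real.pi_pos.le]
  · have hN := quadNorm_pos A hξ
    have h1 : ∀ t ∈ Ioi (0 : ℝ), ‖symb A i k₁ k₂ (t • ξ) * t⁻¹‖ =
        4 * Real.pi ^ 2 * |ξ (i, k₁) * blockAct A.transpose ξ (i, k₂)| *
        (t * Real.exp (-(Real.pi * quadNorm A ξ) * t ^ 2)) := by
      intro t ht
      rw [symb_smul_mul_inv A i k₁ k₂ ξ ht, norm_mul, norm_mul, norm_neg, Real.norm_eq_abs,
        Real.norm_eq_abs, Real.norm_eq_abs, abs_of_nonneg (by positivity),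
        abs_of_nonneg (mul_nonneg (le_of_lt ht) (Real.exp_pos _).le)]
    rw [setIntegral_congr_fun measurableSet_Ioi h1, integral_const_mul,
      integral_mul_exp_neg_mul_sq_Ioi (mul_pos Real.pi_pos hN)]
    have h2 : 2 * |ξ (i, k₁) * blockAct A.transpose ξ (i, k₂)| ≤ quadNorm A ξ := by
      rw [abs_mul, quadNorm]
      have h3 := abs_apply_le_norm ξ (i, k₁)
      have h4 := abs_apply_le_norm (blockAct A.transpose ξ) (i, k₂)
      have h5 := mul_le_mul h3 h4 (abs_nonneg _) (norm_nonneg _)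
      nlinarith [sq_nonneg (‖ξ‖ - ‖blockAct A.transpose ξ‖)]
    have hpi := Real.pi_pos
    rw [show 4 * Real.pi ^ 2 * |ξ (i, k₁) * blockAct A.transpose ξ (i, k₂)| *
      (2 * (Real.pi * quadNorm A ξ))⁻¹ =
      Real.pi * (2 * |ξ (i, k₁) * blockAct A.transpose ξ (i, k₂)| / quadNorm A ξ) by
        field_simp; ring]
    exact mul_le_of_le_one_right hpi.le ((div_le_one hN).2 h2)

theorem integrable_symb_smul_mul_inv_prod (A : Matrix (Fin m) (Fin m) ℝ) (i : Fin m)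
    (k₁ k₂ : Fin d) {φ : BlockVec (Fin m) d → ℂ} (hφ : Integrable φ) :
    Integrable (fun p : ℝ × BlockVec (Fin m) d =>
      ((symb A i k₁ k₂ (p.1 • p.2) * p.1⁻¹ : ℝ) : ℂ) * φ p.2)
      ((volume.restrict (Ioi 0)).prod volume) := by
  have hm : AEStronglyMeasurable (fun p : ℝ × BlockVec (Fin m) d =>
      ((symb A i k₁ k₂ (p.1 • p.2) * p.1⁻¹ : ℝ) : ℂ) * φ p.2)
      ((volume.restrict (Ioi 0)).prod volume) := by
    refine AEStronglyMeasurable.mul ?_ hφ.aestronglyMeasurable.comp_snd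
    refine Measurable.aestronglyMeasurable ?_
    have h1 : Measurable (fun p : ℝ × BlockVec (Fin m) d => symb A i k₁ k₂ (p.1 • p.2)) :=
      ((continuous_symb A i k₁ k₂).comp (by fun_prop)).measurable
    exact Complex.measurable_ofReal.comp (h1.mul measurable_fst.inv)
  refine ⟨hm, ?_⟩
  rw [hasFiniteIntegral_iff_enorm, lintegral_prod_symm _ hm.enorm]
  calc ∫⁻ ξ : BlockVec (Fin m) d, ∫⁻ t in Ioi (0 : ℝ),
        ‖((symb A i k₁ k₂ (t • ξ) * t⁻¹ : ℝ) : ℂ) * φ ξ‖ₑ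
      ≤ ∫⁻ ξ : BlockVec (Fin m) d, ENNReal.ofReal Real.pi * ‖φ ξ‖ₑ := by
        refine lintegral_mono fun ξ => ?_
        simp only [enorm_mul]
        rw [lintegral_mul_const' _ _ enorm_ne_top]
        gcongr
        refine le_trans (le_of_eq ?_) (lintegral_symb_smul_mul_inv_le A i k₁ k₂ ξ)
        refine lintegral_congr fun t => ?_
        exact enorm_complex_ofReal _
    _ < ∞ := by
        rw [lintegral_const_mul' _ _ ENNReal.ofReal_ne_top]
        exact ENNReal.mul_lt_top ENNReal.ofReal_lt_top hφ.hasFiniteIntegral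

theorem integral_symb_smul_mul_inv_mul (A : Matrix (Fin m) (Fin m) ℝ)
    (F : Cube m → 𝓢(BlockVec (Fin m) d, ℝ)) (i : Fin m) (k₁ k₂ : Fin d) (t : ℝ) :
    ∫ ξ, ((symb A i k₁ k₂ (t • ξ) * t⁻¹ : ℝ) : ℂ) * invPush A F ξ =
      osc A F i k₁ k₂ t 0 * (t⁻¹ : ℝ) := by
  rw [osc, pairing, ← integral_mul_const]
  congr 1
  funext ξ
  simp only [inner_zero_left, Complex.ofReal_zero, mul_zero, Complex.exp_zero, mul_one]
  push_cast
  ring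

theorem integrableOn_osc_zero_mul_inv (A : Matrix (Fin m) (Fin m) ℝ)
    (F : Cube m → 𝓢(BlockVec (Fin m) d, ℝ)) (i : Fin m) (k₁ k₂ : Fin d) :
    IntegrableOn (fun t : ℝ => osc A F i k₁ k₂ t 0 * (t⁻¹ : ℝ)) (Ioi 0) := by
  have h := (integrable_symb_smul_mul_inv_prod A i k₁ k₂
    (invPush A F).integrable).integral_prod_left
  simp only [integral_symb_smul_mul_inv_mul] at h
  exact h

/-- Integrated over the scales, a Gaussian symbol becomes a multiplier that is homogeneous of degree
zero. -/
theorem integral_osc_zero_mul_inv (A : Matrix (Fin m) (Fin m) ℝ)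
    (F : Cube m → 𝓢(BlockVec (Fin m) d, ℝ)) (i : Fin m) (k₁ k₂ : Fin d) :
    ∫ t in Ioi (0 : ℝ), osc A F i k₁ k₂ t 0 * (t⁻¹ : ℝ) =
      pairing (fun ξ => ((-(2 * Real.pi) * (ξ (i, k₁) * blockAct A.transpose ξ (i, k₂)) /
        quadNorm A ξ : ℝ) : ℂ)) A F := by
  have h := integral_integral_swap (f := fun (t : ℝ) (ξ : BlockVec (Fin m) d) =>
    ((symb A i k₁ k₂ (t • ξ) * t⁻¹ : ℝ) : ℂ) * invPush A F ξ)
    (integrable_symb_smul_mul_inv_prod A i k₁ k₂ (invPush A F).integrable)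
  simp only [integral_symb_smul_mul_inv_mul] at h
  rw [h, pairing]
  congr 1
  funext ξ
  rw [integral_mul_const, integral_complex_ofReal, integral_symb_smul_mul_inv]

/-! ### Telescoping: the sum of the diagonal square functions -/

/-- The multiplier obtained by integrating all the diagonal kernels of the slots in `S` over the
scales. -/
def levelMult (S : Finset (Fin m)) (A : Matrix (Fin m) (Fin m) ℝ) (ξ : BlockVec (Fin m) d) : ℝ :=
  ∑ r ∈ S, ∑ k, -(2 * Real.pi) * (ξ (r, k) * blockAct A.transpose ξ (r, k)) / quadNorm A ξ

theorem contDiff_blockAct_transpose {n : WithTop ℕ∞} :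
    ContDiff ℝ n (fun x : (Fin m → Fin m → ℝ) × BlockVec (Fin m) d =>
      blockAct (Matrix.of x.1).transpose x.2) := by
  rw [contDiff_euclidean]
  rintro ⟨i, k⟩
  simp only [blockAct_apply, Matrix.transpose_apply, Matrix.of_apply]
  fun_prop

theorem contDiff_quadNorm {n : WithTop ℕ∞} :
    ContDiff ℝ n (fun x : (Fin m → Fin m → ℝ) × BlockVec (Fin m) d =>
      quadNorm (Matrix.of x.1) x.2) :=
  (contDiff_snd.norm_sq ℝ).add (contDiff_blockAct_transpose.norm_sq ℝ)

theorem contDiff_coord_mul_blockAct {n : WithTop ℕ∞} (i : Fin m) (k₁ k₂ : Fin d) :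
    ContDiff ℝ n (fun x : (Fin m → Fin m → ℝ) × BlockVec (Fin m) d =>
      x.2 (i, k₁) * blockAct (Matrix.of x.1).transpose x.2 (i, k₂)) := by
  have h := contDiff_euclidean.1 (contDiff_blockAct_transpose (m := m) (d := d) (n := n)) (i, k₂)
  exact ContDiff.mul (by fun_prop) h

theorem quadNorm_smul (A : Matrix (Fin m) (Fin m) ℝ) (c : ℝ) (ξ : BlockVec (Fin m) d) :
    quadNorm A (c • ξ) = c ^ 2 * quadNorm A ξ := by
  rw [quadNorm, quadNorm, map_smul, norm_smul, norm_smul, mul_pow, mul_pow, Real.norm_eq_abs,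
    sq_abs]
  ring

theorem isCompact_entry_le (R : ℝ) : IsCompact {a : Fin m → Fin m → ℝ | ∀ r s, |a r s| ≤ R} := by
  have h : {a : Fin m → Fin m → ℝ | ∀ r s, |a r s| ≤ R} =
      Set.pi univ fun _ => Set.pi univ fun _ => Icc (-R) R := by
    ext a
    simp [-Set.pi_univ_Icc, abs_le]
  rw [h]
  exact isCompact_univ_pi fun _ => isCompact_univ_pi fun _ => isCompact_Icc

/-- The multiplier is homogeneous of degree zero and jointly smooth in `A` and `ξ ≠ 0`, as its
denominator is at least `|ξ|²`; matrices with bounded entries form a compact set. -/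
theorem exists_isSymbol_levelMult (S : Finset (Fin m)) (R : ℝ) (N : ℕ) :
    ∃ B : ℝ, 0 < B ∧ ∀ A : Matrix (Fin m) (Fin m) ℝ, (∀ r s, |A r s| ≤ R) →
      IsSymbol N B fun ξ : BlockVec (Fin m) d => ((levelMult S A ξ - Real.pi : ℝ) : ℂ) := by
  set U : Set ((Fin m → Fin m → ℝ) × BlockVec (Fin m) d) := {x | x.2 ≠ 0} with hU
  have hUo : IsOpen U := isOpen_compl_singleton.preimage continuous_snd
  set f : (Fin m → Fin m → ℝ) × BlockVec (Fin m) d → ℂ := fun x =>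
    ((levelMult S (Matrix.of x.1) x.2 - Real.pi : ℝ) : ℂ) with hf
  have hfc : ContDiffOn ℝ N f U := by
    refine Complex.ofRealCLM.contDiff.comp_contDiffOn (ContDiffOn.sub ?_ contDiffOn_const)
    unfold levelMult
    refine ContDiffOn.sum fun r _ => ContDiffOn.sum fun k _ => ContDiffOn.div ?_ ?_ ?_
    · exact (contDiff_const.mul (contDiff_coord_mul_blockAct r k k)).contDiffOn
    · exact contDiff_quadNorm.contDiffOn
    · exact fun x hx => (quadNorm_pos _ hx).ne'
  obtain ⟨C, hC0, hC⟩ := exists_norm_iteratedFDeriv_section_le hUo hfc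
    ((isCompact_entry_le R).prod (isCompact_sphere (0 : BlockVec (Fin m) d) 1)) (by
      rintro ⟨a, ξ⟩ ⟨_, h⟩
      simp only [mem_sphere_iff_norm, sub_zero] at h
      simp only [hU, mem_ofPred_eq]
      exact norm_ne_zero_iff.1 (by rw [h]; norm_num))
  refine ⟨C + 1, by positivity, fun A hA => ?_⟩
  have hs : ContDiffOn ℝ N (fun ξ => f (A, ξ)) {0}ᶜ :=
    hfc.comp (contDiff_const.prodMk contDiff_id).contDiffOn fun ξ hξ => hξ
  refine ⟨hs, fun n hn ξ hξ => ?_⟩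
  refine (norm_iteratedFDeriv_le_of_homogeneous hs ?_ (fun n hn ξ hξ =>
    hC A ξ ⟨hA, by simpa using hξ⟩ n hn) hn hξ).trans (by gcongr; linarith)
  intro c hc ξ
  simp only [hf]
  congr 2
  unfold levelMult
  refine Finset.sum_congr rfl fun r _ => Finset.sum_congr rfl fun k _ => ?_
  rw [quadNorm_smul, map_smul, PiLp.smul_apply, PiLp.smul_apply, smul_eq_mul, smul_eq_mul]
  field_simp

/-- If `ξ` is supported in `S`, only the rows of `-I` enter `Aᵀξ`, so `Aᵀξ = -ξ`. The numerators add
up to `2π|ξ|²` and the denominator is `2|ξ|²`. -/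
theorem Admissible.levelMult_eq {S : Finset (Fin m)} {ε R : ℝ} {A : Matrix (Fin m) (Fin m) ℝ}
    (hA : Admissible S ε R A) {ξ : BlockVec (Fin m) d} (hξ : ξ ≠ 0)
    (h : ∀ k ∉ S, ∀ q, ξ (k, q) = 0) : levelMult S A ξ = Real.pi := by
  have h1 : blockAct A.transpose ξ = -ξ := by
    ext ⟨r, k⟩
    rw [blockAct_apply]
    calc ∑ n, A.transpose r n * ξ (n, k) = ∑ n, (-1 : Matrix (Fin m) (Fin m) ℝ) n r * ξ (n, k) := by
          refine Finset.sum_congr rfl fun n _ => ?_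
          by_cases hn : n ∈ S
          · rw [Matrix.transpose_apply, hA.row n hn]
          · rw [h n hn, mul_zero, mul_zero]
      _ = -ξ (r, k) := by
          simp [Matrix.one_apply]
  have h2 : ∑ r ∈ S, ∑ k, ξ (r, k) ^ 2 = ‖ξ‖ ^ 2 := by
    rw [EuclideanSpace.norm_sq_eq, Fintype.sum_prod_type]
    simp only [Real.norm_eq_abs, sq_abs]
    refine Finset.sum_subset (Finset.subset_univ _) fun r _ hr => ?_
    exact Finset.sum_eq_zero fun k _ => by rw [h r hr, zero_pow two_ne_zero]
  have h3 : 0 < ‖ξ‖ := norm_pos_iff.2 hξ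
  calc levelMult S A ξ = ∑ r ∈ S, ∑ k, Real.pi / ‖ξ‖ ^ 2 * ξ (r, k) ^ 2 := by
        unfold levelMult quadNorm
        refine Finset.sum_congr rfl fun r _ => Finset.sum_congr rfl fun k _ => ?_
        rw [h1, PiLp.neg_apply, norm_neg]
        field_simp
        ring
    _ = Real.pi := by
        simp only [← Finset.mul_sum]
        rw [h2]
        field_simp

theorem integral_invPush (A : Matrix (Fin m) (Fin m) ℝ)
    (F : Cube m → 𝓢(BlockVec (Fin m) d, ℝ)) : ∫ ξ, invPush A F ξ = pushforward A F 0 := by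
  have h : 𝓕 (invPush A F) = pushforward A F := by
    rw [invPush, FourierTransform.fourier_fourierInv_eq]
  rw [← h, SchwartzMap.fourier_coe, Real.fourier_eq]
  simp

theorem integrable_scaleIntegral_mul (A : Matrix (Fin m) (Fin m) ℝ)
    (F : Cube m → 𝓢(BlockVec (Fin m) d, ℝ)) (i : Fin m) (k₁ k₂ : Fin d) :
    Integrable fun ξ => ((-(2 * Real.pi) * (ξ (i, k₁) * blockAct A.transpose ξ (i, k₂)) /
        quadNorm A ξ : ℝ) : ℂ) * invPush A F ξ := by
  refine (integrable_symb_smul_mul_inv_prod A i k₁ k₂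
    (invPush A F).integrable).integral_prod_right.congr ?_
  filter_upwards with ξ
  rw [integral_mul_const, integral_complex_ofReal, integral_symb_smul_mul_inv]

/-- The telescoping estimate for the diagonal square functions in the slots of `S`. -/
theorem SymbolBound.lintegral_osc_le {S : Finset (Fin m)} (h : SymbolBound d S) {ε R : ℝ}
    (hε : 0 < ε) (hR : 1 ≤ R) : ∃ C : ℝ, 0 ≤ C ∧ ∀ (A : Matrix (Fin m) (Fin m) ℝ)
      (F : Cube m → 𝓢(BlockVec (Fin m) d, ℝ)), Admissible S ε R A → SymTuple S F →
      ∀ i ∈ S, ∀ k, ∫⁻ t in Ioi (0 : ℝ), ‖osc A F i k k t 0‖ₑ * ENNReal.ofReal t⁻¹ ≤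
        ENNReal.ofReal C := by
  obtain ⟨C, hC0, hC⟩ := h ε R hε hR
  obtain ⟨B, hB0, hB⟩ := exists_isSymbol_levelMult (d := d) S R (3 * d * m)
  refine ⟨C * B + Real.pi * (2 ^ (2 ^ m) * (ε ^ d)⁻¹), by positivity, fun A F hA hF i hi k => ?_⟩
  set g : Fin m → Fin d → ℝ → ℂ := fun r k t => osc A F r k k t 0 * (t⁻¹ : ℝ) with hg
  have hgi : ∀ r k, IntegrableOn (g r k) (Ioi 0) := fun r k =>
    integrableOn_osc_zero_mul_inv A F r k k
  set I : Fin m → Fin d → ℝ := fun r k => ∫ t in Ioi (0 : ℝ), ‖g r k t‖ with hI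
  have hI0 : ∀ r k, 0 ≤ I r k := fun r k => integral_nonneg fun _ => norm_nonneg _
  -- The oscillations in the slots of `S` are nonnegative, so the integral of the modulus is the
  -- integral itself and can be computed as a pairing.
  have hIeq : ∀ r ∈ S, ∀ k, (I r k : ℂ) = pairing (fun ξ => ((-(2 * Real.pi) *
      (ξ (r, k) * blockAct A.transpose ξ (r, k)) / quadNorm A ξ : ℝ) : ℂ)) A F := by
    intro r hr k
    rw [← integral_osc_zero_mul_inv, hI, ← integral_complex_ofReal]
    refine setIntegral_congr_fun measurableSet_Ioi fun t ht => ?_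
    have ht' : (0 : ℝ) < t⁻¹ := inv_pos.2 ht
    simp only [hg]
    rw [norm_mul, Complex.norm_real, Real.norm_of_nonneg ht'.le, Complex.ofReal_mul,
      ← osc_symm_nonneg hA hF hr k ht]
  -- Subtracting `π` makes the multiplier vanish where `SymbolBound` requires it; the multiplier `π`
  -- pairs to `π` times the push-forward at the origin.
  have hsum : ((∑ r ∈ S, ∑ k, I r k : ℝ) : ℂ) =
      pairing (fun ξ => ((levelMult S A ξ - Real.pi : ℝ) : ℂ)) A F +
        Real.pi * pushforward A F 0 := by
    have h1 : pairing (fun ξ => ((levelMult S A ξ - Real.pi : ℝ) : ℂ)) A F =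
        pairing (fun ξ => ((levelMult S A ξ : ℝ) : ℂ)) A F - Real.pi * pushforward A F 0 := by
      rw [← integral_invPush, pairing, pairing, ← integral_const_mul, ← integral_sub]
      · congr 1
        funext ξ
        push_cast
        ring
      · unfold levelMult
        simp only [Complex.ofReal_sum, Finset.sum_mul]
        exact integrable_finsetSum _ fun r _ => integrable_finsetSum _ fun k _ =>
          integrable_scaleIntegral_mul A F r k k
      · exact (invPush A F).integrable.const_mul _
    rw [h1, sub_add_cancel, pairing]
    unfold levelMult
    simp only [Complex.ofReal_sum, Finset.sum_mul]
    rw [integral_finsetSum _ fun r _ => integrable_finsetSum _ fun k _ =>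
          integrable_scaleIntegral_mul A F r k k]
    refine Finset.sum_congr rfl fun r hr => ?_
    rw [integral_finsetSum _ fun k _ => integrable_scaleIntegral_mul A F r k k]
    exact Finset.sum_congr rfl fun k _ => hIeq r hr k
  have hle : ∑ r ∈ S, ∑ k, I r k ≤ C * B + Real.pi * (2 ^ (2 ^ m) * (ε ^ d)⁻¹) := by
    have h1 : ‖((∑ r ∈ S, ∑ k, I r k : ℝ) : ℂ)‖ ≤
        C * B + Real.pi * (2 ^ (2 ^ m) * (ε ^ d)⁻¹) := by
      rw [hsum]
      refine (norm_add_le _ _).trans (add_le_add (hC A F _ B hA hF hB0 (hB A hA.entry) ?_) ?_)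
      · intro ξ hξ h2
        rw [hA.levelMult_eq hξ h2, sub_self, Complex.ofReal_zero]
      · rw [norm_mul, Complex.norm_real, Real.norm_of_nonneg Real.pi_pos.le]
        exact mul_le_mul_of_nonneg_left (norm_pushforward_zero_le hε hA hF) Real.pi_pos.le
    rw [Complex.norm_real] at h1
    exact (le_abs_self _).trans h1
  calc ∫⁻ t in Ioi (0 : ℝ), ‖osc A F i k k t 0‖ₑ * ENNReal.ofReal t⁻¹
      = ∫⁻ t in Ioi (0 : ℝ), ‖g i k t‖ₑ := by
        refine setLIntegral_congr_fun measurableSet_Ioi fun t ht => ?_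
        have ht' : (0 : ℝ) < t⁻¹ := inv_pos.2 ht
        simp only [hg]
        rw [enorm_mul, enorm_complex_ofReal, Real.enorm_of_nonneg ht'.le]
    _ = ENNReal.ofReal (I i k) := (ofReal_integral_norm_eq_lintegral_enorm (hgi i k)).symm
    _ ≤ _ := by
        -- The bound holds for the sum over all slots and coordinates, and all its terms are
        -- nonnegative.
        refine ENNReal.ofReal_le_ofReal (le_trans ?_ hle)
        calc I i k ≤ ∑ k, I i k :=
              Finset.single_le_sum (f := fun k => I i k) (fun k _ => hI0 i k) (Finset.mem_univ k)
          _ ≤ _ := Finset.single_le_sum (f := fun r => ∑ k, I r k)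
              (fun r _ => Finset.sum_nonneg fun k _ => hI0 r k) hi

/-- Symmetrization in slot `i` leads to diagonal square functions of data adapted to `insert i S`,
which the telescoping estimate controls. -/
theorem squareBound_of_symbolBound {S : Finset (Fin m)}
    (h : ∀ i ∉ S, SymbolBound d (insert i S)) : SquareBound d S := by
  intro ε R hε hR
  have h1 : ∀ i : Fin m, ∃ C : ℝ, 0 ≤ C ∧ (i ∉ S → ∀ (A : Matrix (Fin m) (Fin m) ℝ)
      (F : Cube m → 𝓢(BlockVec (Fin m) d, ℝ)) (k₁ k₂ : Fin d) (u : BlockVec (Fin m) d),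
      Admissible S ε R A → SymTuple S F →
      ∫⁻ t in Ioi (0 : ℝ), ‖osc A F i k₁ k₂ t u‖ₑ * ENNReal.ofReal t⁻¹ ≤
        ENNReal.ofReal (C * (1 + ‖u‖) ^ (2 * d * (m - 1)))) := by
    intro i
    by_cases hi : i ∈ S
    · exact ⟨0, le_rfl, fun h => absurd hi h⟩
    obtain ⟨C, ε', R', hC0, hε', hR', hC⟩ := exists_norm_osc_le d hi hε hR
    obtain ⟨C', hC'0, hC'⟩ := (h i hi).lintegral_osc_le hε' hR'
    refine ⟨C * (C' + C'), by positivity, fun _ A F k₁ k₂ u hA hF => ?_⟩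
    obtain ⟨A₀, A₁, F₀, F₁, ⟨hA₀, hF₀⟩, ⟨hA₁, hF₁⟩, hle⟩ := hC A F k₁ k₂ u hA hF
    have h0 := hC' A₀ F₀ hA₀ hF₀ i (Finset.mem_insert_self i S) k₁
    have h1 := hC' A₁ F₁ hA₁ hF₁ i (Finset.mem_insert_self i S) k₂
    set L : ℝ := C * (1 + ‖u‖) ^ (2 * d * (m - 1)) with hL
    have hL0 : 0 ≤ L := by positivity
    have hm : AEMeasurable (fun t : ℝ => ‖osc A₀ F₀ i k₁ k₁ t 0‖ₑ * ENNReal.ofReal t⁻¹)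
        (volume.restrict (Ioi 0)) := by
      refine (integrableOn_osc_zero_mul_inv A₀ F₀ i k₁ k₁).aestronglyMeasurable.enorm.congr ?_
      filter_upwards [ae_restrict_mem measurableSet_Ioi] with t ht
      have ht' : (0 : ℝ) < t⁻¹ := inv_pos.2 ht
      rw [enorm_mul, enorm_complex_ofReal, Real.enorm_of_nonneg ht'.le]
    calc ∫⁻ t in Ioi (0 : ℝ), ‖osc A F i k₁ k₂ t u‖ₑ * ENNReal.ofReal t⁻¹
        ≤ ∫⁻ t in Ioi (0 : ℝ), ENNReal.ofReal L * (‖osc A₀ F₀ i k₁ k₁ t 0‖ₑ * ENNReal.ofReal t⁻¹ +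
            ‖osc A₁ F₁ i k₂ k₂ t 0‖ₑ * ENNReal.ofReal t⁻¹) := by
          refine setLIntegral_mono' measurableSet_Ioi fun t ht => ?_
          rw [← add_mul, ← mul_assoc]
          gcongr
          rw [← ofReal_norm, ← ofReal_norm, ← ofReal_norm,
            ← ENNReal.ofReal_add (norm_nonneg _) (norm_nonneg _), ← ENNReal.ofReal_mul hL0]
          exact ENNReal.ofReal_le_ofReal (hle t ht)
      _ ≤ ENNReal.ofReal L * (ENNReal.ofReal C' + ENNReal.ofReal C') := by
          rw [lintegral_const_mul' _ _ ENNReal.ofReal_ne_top, lintegral_add_left' hm]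
          gcongr
      _ = _ := by
          rw [← ENNReal.ofReal_add hC'0 hC'0, ← ENNReal.ofReal_mul hL0, hL]
          congr 1
          ring
  choose C hC0 hC using h1
  refine ⟨∑ i, C i, Finset.sum_nonneg fun i _ => hC0 i, fun A F i k₁ k₂ u hi hA hF => ?_⟩
  refine (hC i hi A F k₁ k₂ u hA hF).trans (ENNReal.ofReal_le_ofReal ?_)
  gcongr
  exact Finset.single_le_sum (f := C) (fun i _ => hC0 i) (Finset.mem_univ i)

end CubicalBL
end

noncomputable section
namespace CubicalBL

/-! ### Fourier transforms of localized functions -/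

section FourierDecay

variable {V : Type} [NormedAddCommGroup V] [InnerProductSpace ℝ V]

theorem one_add_pow_le (N : ℕ) {x : ℝ} (hx : 0 ≤ x) : (1 + x) ^ N ≤ 2 ^ N * (1 + x ^ N) := by
  rcases le_total x 1 with h | h
  · calc (1 + x) ^ N ≤ 2 ^ N := by
          gcongr
          linarith
      _ ≤ _ := le_mul_of_one_le_right (by positivity) (by linarith [pow_nonneg hx N])
  · calc (1 + x) ^ N ≤ (2 * x) ^ N := by
          gcongr
          linarith
      _ = 2 ^ N * x ^ N := mul_pow _ _ _
      _ ≤ _ := by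
          gcongr
          linarith

theorem iteratedFDeriv_eq_zero_of_notMem {E F : Type} [NormedAddCommGroup E] [NormedSpace ℝ E]
    [NormedAddCommGroup F] [NormedSpace ℝ F] {K : Set E} (hK : IsClosed K) {h : E → F}
    (h0 : ∀ x ∉ K, h x = 0) {x : E} (hx : x ∉ K) (n : ℕ) : iteratedFDeriv ℝ n h x = 0 := by
  have h1 : h =ᶠ[nhds x] fun _ => (0 : F) := by
    filter_upwards [hK.isOpen_compl.mem_nhds hx] with y hy using h0 y hy
  rw [(h1.iteratedFDeriv ℝ n).eq_of_nhds]
  exact congrFun iteratedFDeriv_fun_zero x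

theorem contDiff_of_contDiffOn_of_eq_zero {E F : Type} [NormedAddCommGroup E] [NormedSpace ℝ E]
    [NormedAddCommGroup F] [NormedSpace ℝ F] {N : ℕ} {K U : Set E} (hK : IsClosed K)
    (hU : IsOpen U) (hKU : K ⊆ U) {h : E → F} (hh : ContDiffOn ℝ N h U)
    (h0 : ∀ x ∉ K, h x = 0) : ContDiff ℝ N h := by
  refine contDiff_iff_contDiffAt.2 fun x => ?_
  by_cases hx : x ∈ K
  · exact hh.contDiffAt (hU.mem_nhds (hKU hx))
  · refine (contDiffAt_const (c := (0 : F))).congr_of_eventuallyEq ?_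
    filter_upwards [hK.isOpen_compl.mem_nhds hx] with y hy using h0 y hy

theorem norm_iteratedFDeriv_mul_le_of_le {E : Type} [NormedAddCommGroup E] [NormedSpace ℝ E]
    {N : ℕ} {U : Set E} (hU : IsOpen U) {f g : E → ℂ} (hf : ContDiffOn ℝ N f U)
    (hg : ContDiffOn ℝ N g U) {x : E} (hx : x ∈ U) {a b : ℝ}
    (ha : ∀ n ≤ N, ‖iteratedFDeriv ℝ n f x‖ ≤ a) (hb : ∀ n ≤ N, ‖iteratedFDeriv ℝ n g x‖ ≤ b)
    {n : ℕ} (hn : n ≤ N) : ‖iteratedFDeriv ℝ n (fun y => f y * g y) x‖ ≤ 2 ^ N * (a * b) := by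
  have ha0 : 0 ≤ a := (norm_nonneg _).trans (ha 0 (Nat.zero_le _))
  have hb0 : 0 ≤ b := (norm_nonneg _).trans (hb 0 (Nat.zero_le _))
  have h := norm_iteratedFDerivWithin_mul_le hf hg hU.uniqueDiffOn hx (n := n)
    (by exact_mod_cast hn)
  rw [iteratedFDerivWithin_of_isOpen n hU hx] at h
  refine h.trans ?_
  calc _ ≤ ∑ i ∈ Finset.range (n + 1), (n.choose i : ℝ) * (a * b) := by
        refine Finset.sum_le_sum fun i hi => ?_
        have hi' : i ≤ n := Nat.lt_succ_iff.1 (Finset.mem_range.1 hi)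
        rw [iteratedFDerivWithin_of_isOpen i hU hx, iteratedFDerivWithin_of_isOpen _ hU hx,
          mul_assoc]
        gcongr
        · exact ha i (hi'.trans hn)
        · exact hb _ ((Nat.sub_le _ _).trans hn)
    _ = 2 ^ n * (a * b) := by
        rw [← Finset.sum_mul]
        congr 1
        exact_mod_cast Nat.sum_range_choose n
    _ ≤ _ := by
        gcongr
        norm_num

variable [FiniteDimensional ℝ V] [MeasurableSpace V] [BorelSpace V]

/-- Integration by parts. All derivatives vanish off `K`, so their integrals are at most `c` times
the volume of `K`. -/
theorem one_add_pow_mul_norm_fourier_le {N : ℕ} {K : Set V} (hK : IsCompact K) {h : V → ℂ}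
    (hh : ContDiff ℝ N h) (h0 : ∀ x ∉ K, h x = 0) {c : ℝ}
    (hc : ∀ n ≤ N, ∀ x ∈ K, ‖iteratedFDeriv ℝ n h x‖ ≤ c) (hc0 : 0 ≤ c) (u : V) :
    (1 + ‖u‖) ^ N * ‖𝓕 h u‖ ≤
      2 ^ N * (1 + 2 ^ N * (N + 1)) * (volume.real K * c) := by
  have hcs : HasCompactSupport h := HasCompactSupport.intro hK h0
  have hcsn : ∀ n : ℕ, HasCompactSupport (iteratedFDeriv ℝ n h) := fun n =>
    HasCompactSupport.intro hK fun x hx => iteratedFDeriv_eq_zero_of_notMem hK.isClosed h0 hx n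
  have hint : ∀ k n : ℕ, n ≤ N → Integrable fun v => ‖v‖ ^ k * ‖iteratedFDeriv ℝ n h v‖ := by
    intro k n hn
    refine Continuous.integrable_of_hasCompactSupport ?_ ((hcsn n).norm.mul_left)
    exact (continuous_norm.pow k).mul (hh.continuous_iteratedFDeriv (by exact_mod_cast hn)).norm
  have hle : ∀ n ≤ N, ∫ v, ‖iteratedFDeriv ℝ n h v‖ ≤ volume.real K * c := by
    intro n hn
    have h1 : ∫ v, ‖iteratedFDeriv ℝ n h v‖ = ∫ v in K, ‖iteratedFDeriv ℝ n h v‖ := by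
      refine (setIntegral_eq_integral_of_forall_compl_eq_zero fun x hx => ?_).symm
      rw [iteratedFDeriv_eq_zero_of_notMem hK.isClosed h0 hx n, norm_zero]
    have h2 := norm_setIntegral_le_of_norm_le_const (μ := volume) (s := K)
      (f := fun v => ‖iteratedFDeriv ℝ n h v‖) (C := c) hK.measure_lt_top
      (fun x hx => by rw [norm_norm]; exact hc n hn x hx)
    rw [h1, mul_comm]
    exact (le_abs_self _).trans h2
  have hpow : ∀ n ≤ N, ‖u‖ ^ n * ‖𝓕 h u‖ ≤ 2 ^ n * ((n + 1) * (volume.real K * c)) := by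
    intro n hn
    have h1 := Real.pow_mul_norm_iteratedFDeriv_fourier_le (K := 0) (N := N) (f := h)
      (by exact_mod_cast hh) (fun k n _ hn => hint k n (by exact_mod_cast hn)) (k := 0) (n := n)
      le_rfl (by exact_mod_cast hn) u
    rw [norm_iteratedFDeriv_zero] at h1
    refine h1.trans ?_
    simp only [pow_zero, CharP.cast_eq_zero, mul_zero, zero_add, one_mul, Finset.range_one,
      Finset.singleton_product, Finset.sum_map, Function.Embedding.coeFn_mk]
    gcongr
    calc ∑ x ∈ Finset.range (n + 1), ∫ v, ‖iteratedFDeriv ℝ x h v‖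
        ≤ ∑ x ∈ Finset.range (n + 1), volume.real K * c :=
          Finset.sum_le_sum fun i hi => hle i ((Nat.lt_succ_iff.1 (Finset.mem_range.1 hi)).trans hn)
      _ = _ := by simp
  have hv : 0 ≤ volume.real K * c := by positivity
  calc (1 + ‖u‖) ^ N * ‖𝓕 h u‖ ≤ 2 ^ N * (1 + ‖u‖ ^ N) * ‖𝓕 h u‖ := by
        gcongr
        exact one_add_pow_le N (norm_nonneg u)
    _ = 2 ^ N * (‖u‖ ^ 0 * ‖𝓕 h u‖ + ‖u‖ ^ N * ‖𝓕 h u‖) := by ring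
    _ ≤ 2 ^ N * (2 ^ 0 * (((0 : ℕ) + 1) * (volume.real K * c)) +
          2 ^ N * ((N + 1) * (volume.real K * c))) := by
        exact mul_le_mul_of_nonneg_left (add_le_add (hpow 0 (Nat.zero_le _)) (hpow N le_rfl))
          (by positivity)
    _ = _ := by
        push_cast
        ring

theorem fourierInv_apply_of_decay {N : ℕ} (hN : Module.finrank ℝ V < N) {h : V → ℂ}
    (hc : Continuous h) (hi : Integrable h) {C : ℝ}
    (hd : ∀ u, (1 + ‖u‖) ^ N * ‖𝓕 h u‖ ≤ C) :
    Integrable (𝓕 h) ∧ ∀ x, h x = ∫ u, Complex.exp (2 * Real.pi * Complex.I * (inner ℝ u x : ℝ)) *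
      𝓕 h u := by
  have h1 : Integrable (𝓕 h) := by
    refine ((integrable_one_add_norm (μ := volume) (E := V) (r := N)
      (by exact_mod_cast hN)).const_mul C).mono' ?_ ?_
    · exact (VectorFourier.fourierIntegral_continuous Real.continuous_fourierChar
        (by exact continuous_inner) hi).aestronglyMeasurable
    · filter_upwards with u
      rw [Real.rpow_neg (by positivity), Real.rpow_natCast, ← div_eq_mul_inv,
        le_div_iff₀ (by positivity), mul_comm]
      exact hd u
  refine ⟨h1, fun x => ?_⟩
  conv_lhs => rw [← hc.fourierInv_fourier_eq hi h1]
  rw [Real.fourierInv_eq']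
  congr 1
  funext u
  rw [smul_eq_mul]
  congr 2
  push_cast
  ring

end FourierDecay

end CubicalBL
end

noncomputable section
namespace CubicalBL

variable {m d : ℕ}

/-! ### A partition of unity subordinate to the Gaussian symbols -/

/-- The square of the Euclidean norm of the coordinates in the slots of `T`. -/
def sqPart (T : Finset (Fin m)) (η : BlockVec (Fin m) d) : ℝ := ∑ r ∈ T, ∑ q, η (r, q) ^ 2

theorem sqPart_nonneg (T : Finset (Fin m)) (η : BlockVec (Fin m) d) : 0 ≤ sqPart T η :=
  Finset.sum_nonneg fun _ _ => Finset.sum_nonneg fun _ _ => sq_nonneg _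

theorem contDiff_sqPart {n : WithTop ℕ∞} (T : Finset (Fin m)) :
    ContDiff ℝ n (sqPart T : BlockVec (Fin m) d → ℝ) := by
  unfold sqPart
  fun_prop

theorem sqPart_eq_zero {T : Finset (Fin m)} {η : BlockVec (Fin m) d}
    (h : ∀ r ∈ T, ∀ q, η (r, q) = 0) : sqPart T η = 0 :=
  Finset.sum_eq_zero fun r hr => Finset.sum_eq_zero fun q _ => by
    rw [h r hr q, zero_pow two_ne_zero]

theorem apply_eq_zero_of_sqPart {T : Finset (Fin m)} {η : BlockVec (Fin m) d}
    (h : sqPart T η = 0) {r : Fin m} (hr : r ∈ T) (q : Fin d) : η (r, q) = 0 := by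
  have h1 := (Finset.sum_eq_zero_iff_of_nonneg
    (fun r _ => Finset.sum_nonneg fun q _ => sq_nonneg (η (r, q)))).1 h r hr
  have h2 := (Finset.sum_eq_zero_iff_of_nonneg fun q _ => sq_nonneg (η (r, q))).1 h1 q
    (Finset.mem_univ q)
  exact pow_eq_zero_iff two_ne_zero |>.1 h2

/-- The indices of the Gaussian kernels in the slots outside `S`. -/
def slots (d : ℕ) (S : Finset (Fin m)) : Finset (Fin m × Fin d × Fin d) :=
  Finset.univ.filter fun p => p.1 ∉ S

/-- The sum of the squares of the Gaussian symbols of the slots outside `S`. -/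
def symbSq (S : Finset (Fin m)) (A : Matrix (Fin m) (Fin m) ℝ) (η : BlockVec (Fin m) d) : ℝ :=
  ∑ p ∈ slots d S, symb A p.1 p.2.1 p.2.2 η ^ 2

/-- If all symbols vanish at `η`, then for each slot `i ∉ S` either `η_i = 0` or `(Aᵀη)_i = 0`. Such
an `η` yields a vector in the left kernel of one of the mixed matrices, which are invertible, so the
part of `η` outside `S` is zero. -/
theorem Admissible.symbSq_pos {S : Finset (Fin m)} {ε R : ℝ} (hε : 0 < ε)
    {A : Matrix (Fin m) (Fin m) ℝ} (hA : Admissible S ε R A) {η : BlockVec (Fin m) d}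
    (hη : sqPart Sᶜ η ≠ 0) : 0 < symbSq S A η := by
  refine lt_of_le_of_ne (Finset.sum_nonneg fun _ _ => sq_nonneg _) fun h => hη ?_
  have h0 : ∀ i ∉ S, ∀ k₁ k₂, η (i, k₁) * blockAct A.transpose η (i, k₂) = 0 := by
    intro i hi k₁ k₂
    have h1 := (Finset.sum_eq_zero_iff_of_nonneg fun p _ => sq_nonneg _).1 h.symm (i, k₁, k₂)
      (by simp [slots, hi])
    have h2 := pow_eq_zero_iff two_ne_zero |>.1 h1
    simpa [symb, Real.pi_ne_zero, Real.exp_ne_zero] using h2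
  refine sqPart_eq_zero fun i hi q => ?_
  by_contra hne
  -- `J` marks the slots outside `S` where `η` does not vanish; there `Aᵀη` must vanish, and the
  -- mixed matrix takes the column from `A`.
  set J : Cube m := fun r => decide (r ∉ S ∧ ∃ k, η (r, k) ≠ 0) with hJ
  have hdet : (pairMat A * (projMat J).transpose).det ≠ 0 := by
    have := hA.det J
    exact abs_pos.1 (hε.trans_le this)
  -- In the columns marked by `J` the product is `(Aᵀη)_s`: rows in `S` contribute nothing, being
  -- rows of `-I`, nor do the slots where `η` is zero. In the other columns it is `v s = 0`.
  set v : Fin m → ℝ := fun r => if J r then η (r, q) else 0 with hv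
  have hv0 : Matrix.vecMul v (pairMat A * (projMat J).transpose) = 0 := by
    funext s
    simp only [Matrix.vecMul, dotProduct, pairMat_mul_projMat, Pi.zero_apply]
    by_cases hs : J s
    · have hs' : s ∉ S ∧ ∃ k, η (s, k) ≠ 0 := by simpa [hJ] using hs
      obtain ⟨hsS, k, hk⟩ := hs'
      have h1 := (mul_eq_zero.1 (h0 s hsS k q)).resolve_left hk
      rw [blockAct_apply] at h1
      rw [← h1]
      refine Finset.sum_congr rfl fun r _ => ?_
      simp only [hs, if_true, Matrix.transpose_apply, hv]
      by_cases hr : J r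
      · simp [hr, mul_comm]
      · rw [if_neg hr, zero_mul]
        by_cases hrS : r ∈ S
        · have hrs : r ≠ s := fun h => hsS (h ▸ hrS)
          rw [hA.row r hrS, Matrix.neg_apply, Matrix.one_apply_ne hrs, neg_zero, zero_mul]
        · have : η (r, q) = 0 := by
            by_contra hc
            exact hr (by simp only [hJ, decide_eq_true_eq]; exact ⟨hrS, q, hc⟩)
          rw [this, mul_zero]
    · refine Finset.sum_eq_zero fun r _ => ?_
      simp only [hs, hv]
      by_cases hrs : r = s
      · subst hrs
        simp [hs]
      · simp [hrs]
  have h2 := Matrix.eq_zero_of_vecMul_eq_zero hdet hv0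
  have h3 := congrFun h2 i
  have h4 : J i = true := by
    simp only [hJ, decide_eq_true_eq]
    exact ⟨by simpa using hi, q, hne⟩
  simp only [hv, h4, if_true, Pi.zero_apply] at h3
  exact hne h3

/-- The coefficient of the symbol with index `p` in the expansion of the constant one. -/
def weight (S : Finset (Fin m)) (A : Matrix (Fin m) (Fin m) ℝ) (p : Fin m × Fin d × Fin d)
    (η : BlockVec (Fin m) d) : ℝ := symb A p.1 p.2.1 p.2.2 η / symbSq S A η

theorem Admissible.sum_weight_mul_symb {S : Finset (Fin m)} {ε R : ℝ} (hε : 0 < ε)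
    {A : Matrix (Fin m) (Fin m) ℝ} (hA : Admissible S ε R A) {η : BlockVec (Fin m) d}
    (hη : sqPart Sᶜ η ≠ 0) :
    ∑ p ∈ slots d S, weight S A p η * symb A p.1 p.2.1 p.2.2 η = 1 := by
  have h := hA.symbSq_pos hε hη
  calc _ = (∑ p ∈ slots d S, symb A p.1 p.2.1 p.2.2 η ^ 2) / symbSq S A η := by
        rw [Finset.sum_div]
        exact Finset.sum_congr rfl fun p _ => by rw [weight]; ring
    _ = 1 := div_self h.ne'

theorem contDiff_symb {n : WithTop ℕ∞} (i : Fin m) (k₁ k₂ : Fin d) :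
    ContDiff ℝ n (fun x : (Fin m → Fin m → ℝ) × BlockVec (Fin m) d =>
      symb (Matrix.of x.1) i k₁ k₂ x.2) := by
  unfold symb
  exact contDiff_const.mul ((contDiff_coord_mul_blockAct i k₁ k₂).mul
    (Real.contDiff_exp.comp (contDiff_const.mul contDiff_quadNorm)))

theorem contDiff_symbSq {n : WithTop ℕ∞} (S : Finset (Fin m)) :
    ContDiff ℝ n (fun x : (Fin m → Fin m → ℝ) × BlockVec (Fin m) d =>
      symbSq S (Matrix.of x.1) x.2) := by
  unfold symbSq
  exact ContDiff.sum fun p _ => (contDiff_symb p.1 p.2.1 p.2.2).pow 2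

/-- `Admissible` consists of closed conditions, with `ε ≤ |det|` not strict, and bounds the entries.
-/
theorem isCompact_admissible (S : Finset (Fin m)) (ε R : ℝ) :
    IsCompact {a : Fin m → Fin m → ℝ | Admissible S ε R (Matrix.of a)} := by
  refine (isCompact_entry_le R).of_isClosed_subset ?_ fun a ha => ha.entry
  have h : {a : Fin m → Fin m → ℝ | Admissible S ε R (Matrix.of a)} =
      (⋂ j : Cube m, {a | ε ≤ |(pairMat (Matrix.of a) * (projMat j).transpose).det|}) ∩
      ((⋂ r, ⋂ s, {a | |a r s| ≤ R}) ∩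
      (⋂ r, ⋂ s, {a | r ∈ S → a r s = (-1 : Matrix (Fin m) (Fin m) ℝ) r s})) := by
    ext a
    simp only [mem_inter_iff, mem_iInter, mem_ofPred_eq]
    exact ⟨fun h => ⟨h.det, h.entry, fun r s hr => h.row r hr s⟩,
      fun h => ⟨h.1, h.2.1, fun r hr s => h.2.2 r s hr⟩⟩
  rw [h]
  refine IsClosed.inter (isClosed_iInter fun j => ?_) (IsClosed.inter
    (isClosed_iInter fun r => isClosed_iInter fun s => ?_)
    (isClosed_iInter fun r => isClosed_iInter fun s => ?_))
  · refine isClosed_le continuous_const (continuous_abs.comp (Continuous.matrix_det ?_))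
    refine continuous_matrix fun r s => ?_
    simp only [pairMat_mul_projMat]
    split_ifs <;> fun_prop
  · exact isClosed_le (by fun_prop) continuous_const
  · by_cases hr : r ∈ S
    · simp only [hr, forall_const]
      exact isClosed_eq (by fun_prop) continuous_const
    · simp [hr]

/-- The denominator `symbSq` is positive on the compact product of the admissible matrices and `K`,
so the derivatives are bounded uniformly in `A`. -/
theorem exists_norm_iteratedFDeriv_weight_le (S : Finset (Fin m)) {ε : ℝ} (hε : 0 < ε) (R : ℝ)
    (N : ℕ) {ρ : BlockVec (Fin m) d → ℝ} (hρ : ContDiff ℝ N ρ) {K : Set (BlockVec (Fin m) d)}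
    (hK : IsCompact K) (hKS : ∀ η ∈ K, sqPart Sᶜ η ≠ 0) :
    ∃ C : ℝ, 0 ≤ C ∧ ∀ A, Admissible S ε R A → ∀ p ∈ slots d S, ∀ η ∈ K, ∀ n ≤ N,
      ‖iteratedFDeriv ℝ n (fun η => ((ρ η * weight S A p η : ℝ) : ℂ)) η‖ ≤ C := by
  have h : ∀ p : Fin m × Fin d × Fin d, ∃ C : ℝ, 0 ≤ C ∧ ∀ A, Admissible S ε R A →
      ∀ η ∈ K, ∀ n ≤ N,
      ‖iteratedFDeriv ℝ n (fun η => ((ρ η * weight S A p η : ℝ) : ℂ)) η‖ ≤ C := by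
    intro p
    have hU : IsOpen {x : (Fin m → Fin m → ℝ) × BlockVec (Fin m) d |
        symbSq S (Matrix.of x.1) x.2 ≠ 0} :=
      isOpen_ne_fun (contDiff_symbSq (n := 0) S).continuous continuous_const
    obtain ⟨C, hC0, hC⟩ := exists_norm_iteratedFDeriv_section_le (N := N)
      (f := fun x : (Fin m → Fin m → ℝ) × BlockVec (Fin m) d =>
        ((ρ x.2 * weight S (Matrix.of x.1) p x.2 : ℝ) : ℂ)) hU
      (Complex.ofRealCLM.contDiff.comp_contDiffOn (ContDiffOn.mul
        (hρ.comp contDiff_snd).contDiffOn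
        (ContDiffOn.div (contDiff_symb p.1 p.2.1 p.2.2).contDiffOn (contDiff_symbSq S).contDiffOn
          fun x hx => hx)))
      ((isCompact_admissible S ε R).prod hK)
      (by
        rintro ⟨a, η⟩ ⟨ha, hη⟩
        exact (Admissible.symbSq_pos hε ha (hKS η hη)).ne')
    exact ⟨C, hC0, fun A hA η hη n hn => hC A η ⟨hA, hη⟩ n hn⟩
  choose C hC0 hC using h
  refine ⟨∑ p, C p, Finset.sum_nonneg fun p _ => hC0 p, fun A hA p _ η hη n hn => ?_⟩
  exact (hC p A hA η hη n hn).trans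
    (Finset.single_le_sum (f := C) (fun p _ => hC0 p) (Finset.mem_univ p))

theorem exists_fourier_weight_le (S : Finset (Fin m)) {ε : ℝ} (hε : 0 < ε) (R : ℝ)
    (N : ℕ) {ρ : BlockVec (Fin m) d → ℝ} (hρ : ContDiff ℝ N ρ) {K : Set (BlockVec (Fin m) d)}
    (hK : IsCompact K) (hKS : ∀ η ∈ K, sqPart Sᶜ η ≠ 0) (hρK : ∀ η ∉ K, ρ η = 0) :
    ∃ C : ℝ, 0 ≤ C ∧ ∀ A, Admissible S ε R A → ∀ p ∈ slots d S,
      ∀ (f : BlockVec (Fin m) d → ℂ) (c : ℝ), 0 ≤ c →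
      ContDiffOn ℝ N f {η | sqPart Sᶜ η ≠ 0} →
      (∀ n ≤ N, ∀ η ∈ K, ‖iteratedFDeriv ℝ n f η‖ ≤ c) →
      (Continuous fun η => f η * ((ρ η * weight S A p η : ℝ) : ℂ)) ∧
      (Integrable fun η => f η * ((ρ η * weight S A p η : ℝ) : ℂ)) ∧
      ∀ u, (1 + ‖u‖) ^ N * ‖𝓕 (fun η => f η * ((ρ η * weight S A p η : ℝ) : ℂ)) u‖ ≤ C * c := by
  obtain ⟨C, hC0, hC⟩ := exists_norm_iteratedFDeriv_weight_le S hε R N hρ hK hKS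
  refine ⟨2 ^ N * (1 + 2 ^ N * (N + 1)) * (volume.real K * (2 ^ N * C)), by positivity,
    fun A hA p hp f c hc hf hfc => ?_⟩
  set U : Set (BlockVec (Fin m) d) := {η | sqPart Sᶜ η ≠ 0} with hU
  have hUo : IsOpen U := isOpen_ne_fun (contDiff_sqPart (n := 0) Sᶜ).continuous continuous_const
  have hg : ContDiffOn ℝ N (fun η => ((ρ η * weight S A p η : ℝ) : ℂ)) U := by
    refine Complex.ofRealCLM.contDiff.comp_contDiffOn (ContDiffOn.mul hρ.contDiffOn ?_)
    have hpr : ContDiff ℝ N fun η : BlockVec (Fin m) d => ((A, η) : (Fin m → Fin m → ℝ) × _) :=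
      contDiff_const.prodMk contDiff_id
    exact ContDiffOn.div ((contDiff_symb p.1 p.2.1 p.2.2).comp hpr).contDiffOn
      ((contDiff_symbSq S).comp hpr).contDiffOn fun η hη => (hA.symbSq_pos hε hη).ne'
  have h0 : ∀ η ∉ K, f η * ((ρ η * weight S A p η : ℝ) : ℂ) = 0 := by
    intro η hη
    rw [hρK η hη, zero_mul, Complex.ofReal_zero, mul_zero]
  have hh := contDiff_of_contDiffOn_of_eq_zero hK.isClosed hUo (fun η hη => hKS η hη)
    (hf.mul hg) h0
  have hcs : HasCompactSupport fun η => f η * ((ρ η * weight S A p η : ℝ) : ℂ) :=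
    HasCompactSupport.intro hK h0
  refine ⟨hh.continuous, hh.continuous.integrable_of_hasCompactSupport hcs, fun u => ?_⟩
  refine (one_add_pow_mul_norm_fourier_le hK hh h0 (c := 2 ^ N * (c * C)) (fun n hn η hη =>
    norm_iteratedFDeriv_mul_le_of_le hUo hf hg (hKS η hη) (fun n hn => hfc n hn η hη)
      (fun n hn => hC A hA p hp η hη n hn) hn) (by positivity) u).trans (le_of_eq ?_)
  ring

theorem abs_symb_le (A : Matrix (Fin m) (Fin m) ℝ) (i : Fin m) (k₁ k₂ : Fin d)
    (ξ : BlockVec (Fin m) d) : |symb A i k₁ k₂ ξ| ≤ 2 * Real.pi ^ 2 := by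
  have h3 := abs_apply_le_norm ξ (i, k₁)
  have h4 := abs_apply_le_norm (blockAct A.transpose ξ) (i, k₂)
  have h5 := mul_le_mul h3 h4 (abs_nonneg _) (norm_nonneg _)
  set x := ‖ξ‖ ^ 2 + ‖blockAct A.transpose ξ‖ ^ 2 with hx
  have hx0 : 0 ≤ x := by positivity
  have h6 : 2 * (|ξ (i, k₁)| * |blockAct A.transpose ξ (i, k₂)|) ≤ x := by
    nlinarith [sq_nonneg (‖ξ‖ - ‖blockAct A.transpose ξ‖)]
  have h7 : x * Real.exp (-Real.pi * x) ≤ 1 := by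
    have h8 := Real.add_one_le_exp (Real.pi * x)
    have h9 : x ≤ Real.exp (Real.pi * x) := by nlinarith [Real.pi_gt_three]
    rw [neg_mul, Real.exp_neg, ← div_eq_mul_inv]
    exact (div_le_one (Real.exp_pos _)).2 h9
  rw [symb, abs_mul, abs_neg, abs_of_pos (by positivity : 0 < 4 * Real.pi ^ 2), abs_mul, abs_mul,
    Real.abs_exp]
  calc 4 * Real.pi ^ 2 * (|ξ (i, k₁)| * |blockAct A.transpose ξ (i, k₂)| *
        Real.exp (-Real.pi * x))
      = 2 * Real.pi ^ 2 * (2 * (|ξ (i, k₁)| * |blockAct A.transpose ξ (i, k₂)|) *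
        Real.exp (-Real.pi * x)) := by ring
    _ ≤ 2 * Real.pi ^ 2 * (x * Real.exp (-Real.pi * x)) := by gcongr
    _ ≤ 2 * Real.pi ^ 2 * 1 := by gcongr
    _ = _ := mul_one _

/-- Fubini: a Gaussian symbol times the character with frequency `u` pairs to the oscillation with
shift `u`. -/
theorem pairing_fourier_mul_symb (A : Matrix (Fin m) (Fin m) ℝ)
    (F : Cube m → 𝓢(BlockVec (Fin m) d, ℝ)) (i : Fin m) (k₁ k₂ : Fin d) (t : ℝ)
    {H : BlockVec (Fin m) d → ℂ} (hH : Integrable H) :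
    pairing (fun ξ => (∫ u, Complex.exp (2 * Real.pi * Complex.I * (inner ℝ u (t • ξ) : ℝ)) *
      H u) * symb A i k₁ k₂ (t • ξ)) A F = ∫ u, H u * osc A F i k₁ k₂ t u := by
  have h1 : Integrable fun ξ => (symb A i k₁ k₂ (t • ξ) : ℂ) * invPush A F ξ := by
    refine (invPush A F).integrable.bdd_mul (c := 2 * Real.pi ^ 2) ?_ ?_
    · exact (Complex.continuous_ofReal.comp ((continuous_symb A i k₁ k₂).comp
        (continuous_const_smul t))).aestronglyMeasurable
    · filter_upwards with ξ
      rw [Complex.norm_real]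
      exact abs_symb_le A i k₁ k₂ _
  have h2 : Integrable (fun p : BlockVec (Fin m) d × BlockVec (Fin m) d =>
      Complex.exp (2 * Real.pi * Complex.I * (inner ℝ p.2 (t • p.1) : ℝ)) *
      ((symb A i k₁ k₂ (t • p.1) * invPush A F p.1) * H p.2)) (volume.prod volume) := by
    refine (h1.mul_prod hH).bdd_mul (c := 1) ?_ ?_
    · exact Continuous.aestronglyMeasurable (by fun_prop)
    · filter_upwards with p
      rw [show 2 * Real.pi * Complex.I * ((inner ℝ p.2 (t • p.1) : ℝ) : ℂ) =
        ((2 * Real.pi * inner ℝ p.2 (t • p.1) : ℝ) : ℂ) * Complex.I by push_cast; ring,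
        Complex.norm_exp_ofReal_mul_I]
  have h3 := integral_integral_swap (f := fun ξ u : BlockVec (Fin m) d =>
      Complex.exp (2 * Real.pi * Complex.I * (inner ℝ u (t • ξ) : ℝ)) *
      ((symb A i k₁ k₂ (t • ξ) * invPush A F ξ) * H u)) h2
  unfold osc pairing
  calc _ = ∫ ξ, ∫ u, Complex.exp (2 * Real.pi * Complex.I * (inner ℝ u (t • ξ) : ℝ)) *
      ((symb A i k₁ k₂ (t • ξ) * invPush A F ξ) * H u) := by
        congr 1
        funext ξ
        rw [mul_assoc, ← integral_mul_const]
        congr 1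
        funext u
        ring
    _ = _ := h3
    _ = _ := by
        congr 1
        funext u
        rw [← integral_const_mul]
        congr 1
        funext ξ
        ring

theorem measurable_osc (A : Matrix (Fin m) (Fin m) ℝ) (F : Cube m → 𝓢(BlockVec (Fin m) d, ℝ))
    (i : Fin m) (k₁ k₂ : Fin d) :
    Measurable fun x : ℝ × BlockVec (Fin m) d => osc A F i k₁ k₂ x.1 x.2 := by
  unfold osc pairing
  refine StronglyMeasurable.measurable ?_
  refine StronglyMeasurable.integral_prod_right' (f := fun y :
    (ℝ × BlockVec (Fin m) d) × BlockVec (Fin m) d => (symb A i k₁ k₂ (y.1.1 • y.2) : ℂ) *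
    Complex.exp (2 * Real.pi * Complex.I * (inner ℝ y.1.2 (y.1.1 • y.2) : ℝ)) *
      invPush A F y.2) ?_
  refine Continuous.stronglyMeasurable ?_
  have h1 : Continuous fun y : (ℝ × BlockVec (Fin m) d) × BlockVec (Fin m) d =>
      symb A i k₁ k₂ (y.1.1 • y.2) := (continuous_symb A i k₁ k₂).comp (by fun_prop)
  have h2 := (invPush A F).continuous
  fun_prop

/-- Insert `1 = ∑ weight · symb` on the support of `ρ` and write each coefficient `f ρ weight` as a
Fourier integral, which converges absolutely since the decay `N` exceeds the dimension `m d`. -/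
theorem norm_pairing_localized_le {S : Finset (Fin m)} {ε : ℝ} (hε : 0 < ε)
    {A : Matrix (Fin m) (Fin m) ℝ} {R : ℝ} (hA : Admissible S ε R A)
    (F : Cube m → 𝓢(BlockVec (Fin m) d, ℝ)) {f : BlockVec (Fin m) d → ℂ}
    {ρ : BlockVec (Fin m) d → ℝ} (hρ : ∀ η, sqPart Sᶜ η = 0 → ρ η = 0) {N : ℕ}
    (hN : m * d < N) {C : ℝ} (h : ∀ p ∈ slots d S,
      (Continuous fun η => f η * ((ρ η * weight S A p η : ℝ) : ℂ)) ∧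
      (Integrable fun η => f η * ((ρ η * weight S A p η : ℝ) : ℂ)) ∧
      ∀ u, (1 + ‖u‖) ^ N * ‖𝓕 (fun η => f η * ((ρ η * weight S A p η : ℝ) : ℂ)) u‖ ≤ C)
    (t : ℝ) :
    ‖pairing (fun ξ => f (t • ξ) * ρ (t • ξ)) A F‖ₑ ≤
      ∑ p ∈ slots d S, ∫⁻ u, ENNReal.ofReal (C * ((1 + ‖u‖) ^ N)⁻¹) *
        ‖osc A F p.1 p.2.1 p.2.2 t u‖ₑ := by
  set g : Fin m × Fin d × Fin d → BlockVec (Fin m) d → ℂ := fun p η =>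
    f η * ((ρ η * weight S A p η : ℝ) : ℂ) with hg
  have hfin : Module.finrank ℝ (BlockVec (Fin m) d) < N := by
    simpa using hN
  have hgF : ∀ p ∈ slots d S, Integrable (𝓕 (g p)) ∧ ∀ x, g p x =
      ∫ u, Complex.exp (2 * Real.pi * Complex.I * (inner ℝ u x : ℝ)) * 𝓕 (g p) u := fun p hp =>
    fourierInv_apply_of_decay hfin (h p hp).1 (h p hp).2.1 (h p hp).2.2
  have hgb : ∀ p ∈ slots d S, ∃ B, ∀ η, ‖g p η‖ ≤ B := by
    intro p hp
    refine ⟨∫ u, ‖𝓕 (g p) u‖, fun η => ?_⟩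
    rw [(hgF p hp).2 η]
    refine (norm_integral_le_integral_norm _).trans (le_of_eq ?_)
    congr 1
    funext u
    rw [norm_mul, show 2 * Real.pi * Complex.I * ((inner ℝ u η : ℝ) : ℂ) =
        ((2 * Real.pi * inner ℝ u η : ℝ) : ℂ) * Complex.I by push_cast; ring,
        Complex.norm_exp_ofReal_mul_I, one_mul]
  have hint : ∀ p ∈ slots d S, Integrable fun ξ =>
      g p (t • ξ) * symb A p.1 p.2.1 p.2.2 (t • ξ) * invPush A F ξ := by
    intro p hp
    obtain ⟨B, hB⟩ := hgb p hp
    refine (invPush A F).integrable.bdd_mul (c := B * (2 * Real.pi ^ 2)) ?_ ?_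
    · have h1 : Continuous (g p) := (h p hp).1
      have h2 := continuous_symb A p.1 p.2.1 p.2.2
      exact Continuous.aestronglyMeasurable (by fun_prop)
    · filter_upwards with ξ
      rw [norm_mul, Complex.norm_real]
      exact mul_le_mul (hB _) (abs_symb_le A _ _ _ _) (norm_nonneg _)
        ((norm_nonneg _).trans (hB 0))
  have heq : pairing (fun ξ => f (t • ξ) * ρ (t • ξ)) A F =
      ∑ p ∈ slots d S, ∫ u, 𝓕 (g p) u * osc A F p.1 p.2.1 p.2.2 t u := by
    calc pairing (fun ξ => f (t • ξ) * ρ (t • ξ)) A F = ∫ ξ, ∑ p ∈ slots d S,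
          g p (t • ξ) * symb A p.1 p.2.1 p.2.2 (t • ξ) * invPush A F ξ := by
          rw [pairing]
          congr 1
          funext ξ
          rw [← Finset.sum_mul]
          congr 1
          by_cases h0 : sqPart Sᶜ (t • ξ) = 0
          · simp [hg, hρ _ h0]
          · have h1 := hA.sum_weight_mul_symb (d := d) hε h0
            calc _ = f (t • ξ) * ρ (t • ξ) * ((∑ p ∈ slots d S, weight S A p (t • ξ) *
                  symb A p.1 p.2.1 p.2.2 (t • ξ) : ℝ) : ℂ) := by
                  rw [h1, Complex.ofReal_one, mul_one]
              _ = _ := by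
                  rw [Complex.ofReal_sum, Finset.mul_sum]
                  refine Finset.sum_congr rfl fun p _ => ?_
                  simp only [hg]
                  push_cast
                  ring
      _ = ∑ p ∈ slots d S, pairing (fun ξ => (∫ u, Complex.exp (2 * Real.pi * Complex.I *
            (inner ℝ u (t • ξ) : ℝ)) * 𝓕 (g p) u) * symb A p.1 p.2.1 p.2.2 (t • ξ)) A F := by
          rw [integral_finsetSum _ hint]
          refine Finset.sum_congr rfl fun p hp => ?_
          simp only [← (hgF p hp).2]
          rfl
      _ = _ := Finset.sum_congr rfl fun p hp =>
          pairing_fourier_mul_symb A F p.1 p.2.1 p.2.2 t (hgF p hp).1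
  rw [heq]
  refine (enorm_sum_le _ _).trans (Finset.sum_le_sum fun p hp => ?_)
  refine (enorm_integral_le_lintegral_enorm _).trans (lintegral_mono fun u => ?_)
  rw [enorm_mul]
  gcongr
  rw [← ofReal_norm]
  refine ENNReal.ofReal_le_ofReal ?_
  rw [← div_eq_mul_inv, le_div_iff₀ (by positivity), mul_comm]
  exact (h p hp).2.2 u

/-- The square function estimate controls families of localized multipliers. -/
theorem SquareBound.lintegral_pairing_le {S : Finset (Fin m)} (h : SquareBound d S) (hm : 1 ≤ m)
    (hd : 1 ≤ d) {ε R : ℝ} (hε : 0 < ε) (hR : 1 ≤ R) {ρ : BlockVec (Fin m) d → ℝ}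
    (hρ : ContDiff ℝ (3 * d * m - 1 : ℕ) ρ) {K : Set (BlockVec (Fin m) d)}
    (hK : IsCompact K) (hKS : ∀ η ∈ K, sqPart Sᶜ η ≠ 0) (hρK : ∀ η ∉ K, ρ η = 0) :
    ∃ C : ℝ, 0 ≤ C ∧ ∀ (A : Matrix (Fin m) (Fin m) ℝ) (F : Cube m → 𝓢(BlockVec (Fin m) d, ℝ))
      (f : ℝ → BlockVec (Fin m) d → ℂ) (c : ℝ), Admissible S ε R A → SymTuple S F → 0 ≤ c →
      (∀ t, 0 < t → ContDiffOn ℝ (3 * d * m - 1 : ℕ) (f t) {η | sqPart Sᶜ η ≠ 0}) →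
      (∀ t, 0 < t → ∀ n ≤ 3 * d * m - 1, ∀ η ∈ K, ‖iteratedFDeriv ℝ n (f t) η‖ ≤ c) →
      ∫⁻ t in Ioi (0 : ℝ), ‖pairing (fun ξ => f t (t • ξ) * ρ (t • ξ)) A F‖ₑ *
        ENNReal.ofReal t⁻¹ ≤ ENNReal.ofReal (C * c) := by
  set N : ℕ := 3 * d * m - 1 with hN
  obtain ⟨C₁, hC₁0, hC₁⟩ := exists_fourier_weight_le S hε R N hρ hK hKS hρK
  obtain ⟨C₂, hC₂0, hC₂⟩ := h ε R hε hR
  set e : ℕ := 2 * d * (m - 1) with he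
  -- Integrability in `u` of decay `N` against growth `2d(m-1)` in dimension `dm`. Here `3dm - 1 -
  -- 2d(m-1) = dm + 2d - 1`, which leaves `2d - 1 ≥ 1` to spare.
  have hNe : m * d + e < N := by
    obtain ⟨m', rfl⟩ : ∃ m', m = m' + 1 := ⟨m - 1, by omega⟩
    simp only [hN, he, Nat.add_sub_cancel]
    have : 3 * d * (m' + 1) = (m' + 1) * d + 2 * d * m' + 2 * d := by ring
    omega
  set w : BlockVec (Fin m) d → ℝ := fun u => ((1 + ‖u‖) ^ N)⁻¹ * (1 + ‖u‖) ^ e with hw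
  have hwi : Integrable w := by
    refine (integrable_one_add_norm (μ := volume) (E := BlockVec (Fin m) d) (r := (N - e : ℕ))
      ?_).congr ?_
    · rw [Nat.cast_lt]
      simp only [finrank_euclideanSpace, Fintype.card_prod, Fintype.card_fin]
      omega
    · filter_upwards with u
      rw [Real.rpow_neg (by positivity), Real.rpow_natCast, hw]
      have h1 : (1 + ‖u‖) ^ N = (1 + ‖u‖) ^ (N - e) * (1 + ‖u‖) ^ e := by
        rw [← pow_add]
        congr 1
        omega
      have h2 : (0 : ℝ) < 1 + ‖u‖ := by positivity
      simp only
      rw [h1]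
      field_simp
  have hw0 : ∀ u, 0 ≤ w u := fun u => by positivity
  refine ⟨(slots d S).card * (C₁ * C₂ * ∫ u, w u), by
    have : 0 ≤ ∫ u, w u := integral_nonneg fun u => hw0 u
    positivity, fun A F f c hA hF hc hf hfc => ?_⟩
  have hmeas : ∀ p : Fin m × Fin d × Fin d, Measurable
      fun x : ℝ × BlockVec (Fin m) d => ENNReal.ofReal (C₁ * c * ((1 + ‖x.2‖) ^ N)⁻¹) *
        ‖osc A F p.1 p.2.1 p.2.2 x.1 x.2‖ₑ * ENNReal.ofReal x.1⁻¹ := by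
    intro p
    have h1 := measurable_osc A F p.1 p.2.1 p.2.2
    fun_prop
  calc ∫⁻ t in Ioi (0 : ℝ), ‖pairing (fun ξ => f t (t • ξ) * ρ (t • ξ)) A F‖ₑ *
        ENNReal.ofReal t⁻¹
      ≤ ∫⁻ t in Ioi (0 : ℝ), ∑ p ∈ slots d S, ∫⁻ u : BlockVec (Fin m) d,
          ENNReal.ofReal (C₁ * c * ((1 + ‖u‖) ^ N)⁻¹) * ‖osc A F p.1 p.2.1 p.2.2 t u‖ₑ *
            ENNReal.ofReal t⁻¹ := by
        refine setLIntegral_mono' measurableSet_Ioi fun t ht => ?_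
        have h1 := norm_pairing_localized_le hε hA F (f := f t) (ρ := ρ) (N := N)
          (C := C₁ * c) (fun η hη => hρK η fun hηK => hKS η hηK hη) (by omega)
          (fun p hp => hC₁ A hA p hp (f t) c hc (hf t ht) (hfc t ht)) t
        refine (mul_le_mul_left h1 _).trans (le_of_eq ?_)
        rw [Finset.sum_mul]
        refine Finset.sum_congr rfl fun p _ => ?_
        rw [lintegral_mul_const' _ _ ENNReal.ofReal_ne_top]
    _ = ∑ p ∈ slots d S, ∫⁻ u : BlockVec (Fin m) d, ∫⁻ t in Ioi (0 : ℝ),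
          ENNReal.ofReal (C₁ * c * ((1 + ‖u‖) ^ N)⁻¹) * ‖osc A F p.1 p.2.1 p.2.2 t u‖ₑ *
            ENNReal.ofReal t⁻¹ := by
        rw [lintegral_finsetSum _ fun p _ => (hmeas p).lintegral_prod_right']
        refine Finset.sum_congr rfl fun p _ => ?_
        exact lintegral_lintegral_swap (hmeas p).aemeasurable
    _ ≤ ∑ p ∈ slots d S, ENNReal.ofReal (C₁ * C₂ * c * ∫ u, w u) := by
        refine Finset.sum_le_sum fun p hp => ?_
        rw [← integral_const_mul, ofReal_integral_eq_lintegral_ofReal (hwi.const_mul _)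
          (Filter.Eventually.of_forall fun u => mul_nonneg (by positivity) (hw0 u))]
        refine lintegral_mono fun u => ?_
        simp only [mul_assoc (ENNReal.ofReal _)]
        rw [lintegral_const_mul' _ _ ENNReal.ofReal_ne_top]
        refine (mul_le_mul_right (hC₂ A F p.1 p.2.1 p.2.2 u (by simpa [slots] using hp) hA hF)
          _).trans (le_of_eq ?_)
        rw [← ENNReal.ofReal_mul (by positivity)]
        congr 1
        simp only [hw]
        ring
    _ = _ := by
        rw [Finset.sum_const, nsmul_eq_mul, ← ENNReal.ofReal_natCast,
          ← ENNReal.ofReal_mul (by positivity)]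
        congr 1
        ring

end CubicalBL
end

noncomputable section
namespace CubicalBL

variable {m d : ℕ}

/-! ### Cutoff functions -/

/-- A smooth cutoff, equal to one on `(-∞, 1]` and to zero on `[2, ∞)`. -/
def cutoff (s : ℝ) : ℝ := Real.smoothTransition (2 - s)

theorem contDiff_cutoff {n : ℕ} : ContDiff ℝ n cutoff :=
  Real.smoothTransition.contDiff.comp (by fun_prop)

theorem continuous_cutoff : Continuous cutoff := (contDiff_cutoff (n := 0)).continuous

theorem cutoff_of_le {s : ℝ} (h : s ≤ 1) : cutoff s = 1 :=
  Real.smoothTransition.one_of_one_le (by linarith)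

theorem cutoff_of_ge {s : ℝ} (h : 2 ≤ s) : cutoff s = 0 :=
  Real.smoothTransition.zero_of_nonpos (by linarith)

theorem cutoff_nonneg (s : ℝ) : 0 ≤ cutoff s := Real.smoothTransition.nonneg _

theorem antitone_cutoff : Antitone cutoff := fun _ _ h =>
  Real.smoothTransition.monotone (by linarith)

/-- A smooth bump on `[1/4, 2]`. -/
def annulus (s : ℝ) : ℝ := cutoff s - cutoff (4 * s)

theorem contDiff_annulus {n : ℕ} : ContDiff ℝ n annulus :=
  contDiff_cutoff.sub (contDiff_cutoff.comp (by fun_prop))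

theorem continuous_annulus : Continuous annulus := (contDiff_annulus (n := 0)).continuous

theorem annulus_of_le {s : ℝ} (h : s ≤ 1 / 4) : annulus s = 0 := by
  rw [annulus, cutoff_of_le (by linarith), cutoff_of_le (by linarith), sub_self]

theorem annulus_of_ge {s : ℝ} (h : 2 ≤ s) : annulus s = 0 := by
  rw [annulus, cutoff_of_ge h, cutoff_of_ge (by linarith), sub_self]

theorem annulus_nonneg (s : ℝ) : 0 ≤ annulus s := by
  rcases le_total 0 s with h | h
  · exact sub_nonneg.2 (antitone_cutoff (by linarith))
  · rw [annulus_of_le (by linarith)]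

/-- The integral of the bump over the scales. -/
def scaleMass : ℝ := ∫ t in Ioi (0 : ℝ), annulus (t ^ 2) * t⁻¹

theorem integrableOn_annulus_sq_mul_inv :
    IntegrableOn (fun t : ℝ => annulus (t ^ 2) * t⁻¹) (Ioi 0) := by
  refine IntegrableOn.of_forall_sdiff_eq_zero (s := Icc (1 / 2) 2) ?_ measurableSet_Ioi ?_
  · refine ContinuousOn.integrableOn_compact isCompact_Icc (ContinuousOn.mul ?_ ?_)
    · exact (continuous_annulus.comp (by fun_prop)).continuousOn
    · exact continuousOn_inv₀.mono fun t ht => by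
        have := ht.1
        simp only [mem_compl_iff, mem_singleton_iff]
        linarith
  · rintro t ⟨ht, ht'⟩
    have h0 : (0 : ℝ) < t := ht
    rw [mem_Icc, not_and_or, not_le, not_le] at ht'
    rcases ht' with h | h
    · rw [annulus_of_le (by nlinarith), zero_mul]
    · rw [annulus_of_ge (by nlinarith), zero_mul]

/-- For `3/4 ≤ t ≤ 1` one has `t² ≤ 1` and `4t² ≥ 9/4 ≥ 2`, so the bump equals one there. -/
theorem scaleMass_pos : 0 < scaleMass := by
  have h1 : ∫ t in Icc (3 / 4 : ℝ) 1, (1 : ℝ) ≤ ∫ t in Icc (3 / 4 : ℝ) 1, annulus (t ^ 2) * t⁻¹ := by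
    refine setIntegral_mono_on (by simp) (integrableOn_annulus_sq_mul_inv.mono_set fun t ht =>
      lt_of_lt_of_le (by norm_num) ht.1) measurableSet_Icc fun t ht => ?_
    have ht0 : 0 < t := lt_of_lt_of_le (by norm_num) ht.1
    rw [annulus, cutoff_of_le (by nlinarith [ht.2]), cutoff_of_ge (by nlinarith [ht.1]), sub_zero,
      one_mul]
    exact (one_le_inv₀ ht0).2 ht.2
  have h2 : ∫ t in Icc (3 / 4 : ℝ) 1, annulus (t ^ 2) * t⁻¹ ≤ scaleMass := by
    refine setIntegral_mono_set integrableOn_annulus_sq_mul_inv ?_ ?_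
    · filter_upwards [ae_restrict_mem measurableSet_Ioi] with t ht
      exact mul_nonneg (annulus_nonneg _) (inv_nonneg.2 (le_of_lt ht))
    · exact Filter.Eventually.of_forall fun t ht => lt_of_lt_of_le (by norm_num) ht.1
  have h3 : ∫ t in Icc (3 / 4 : ℝ) 1, (1 : ℝ) = 1 / 4 := by
    simp
    norm_num
  linarith

/-- The measure `dt/t` is invariant under `t ↦ √Y t`. -/
theorem lintegral_annulus {Y : ℝ} (hY : 0 < Y) :
    ∫⁻ t in Ioi (0 : ℝ), ENNReal.ofReal (annulus (t ^ 2 * Y) * |t|⁻¹) =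
      ENNReal.ofReal scaleMass := by
  have hs : 0 < Real.sqrt Y := Real.sqrt_pos.2 hY
  have h1 : ∀ t ∈ Ioi (0 : ℝ), annulus (t ^ 2 * Y) * |t|⁻¹ =
      Real.sqrt Y * (annulus ((Real.sqrt Y * t) ^ 2) * (Real.sqrt Y * t)⁻¹) := by
    intro t ht
    have ht0 : (0 : ℝ) < t := ht
    rw [mul_pow, Real.sq_sqrt hY.le, abs_of_pos ht0, mul_comm Y]
    field_simp
  have h2 := integral_comp_mul_left_Ioi (fun t : ℝ => annulus (t ^ 2) * t⁻¹) 0 hs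
  have h3 : IntegrableOn (fun t : ℝ => annulus (t ^ 2 * Y) * |t|⁻¹) (Ioi 0) := by
    refine IntegrableOn.congr_fun (Integrable.const_mul ?_ (Real.sqrt Y))
      (fun t ht => (h1 t ht).symm) measurableSet_Ioi
    have := (integrableOn_Ioi_comp_mul_left_iff (fun t : ℝ => annulus (t ^ 2) * t⁻¹) 0 hs).2
      (by rw [mul_zero]; exact integrableOn_annulus_sq_mul_inv)
    exact this
  rw [← ofReal_integral_eq_lintegral_ofReal h3 (Filter.Eventually.of_forall fun t =>
    mul_nonneg (annulus_nonneg _) (inv_nonneg.2 (abs_nonneg _))),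
    setIntegral_congr_fun measurableSet_Ioi h1, integral_const_mul, h2, mul_zero, smul_eq_mul,
    mul_inv_cancel_left₀ hs.ne', scaleMass]

/-- The radial factor of the cone with index `k`. -/
def coneFactor (k : ℕ) (s : ℝ) : ℝ := if k = 0 then cutoff s else annulus (s * (4 ^ k)⁻¹)

theorem coneFactor_nonneg (k : ℕ) (s : ℝ) : 0 ≤ coneFactor k s := by
  unfold coneFactor
  split_ifs
  · exact cutoff_nonneg _
  · exact annulus_nonneg _

/-- The sum telescopes: the partial sums are `cutoff (s / 4^n)`, and these tend to `cutoff 0 = 1`.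
-/
theorem hasSum_coneFactor (s : ℝ) : HasSum (fun k => coneFactor k s) 1 := by
  rw [hasSum_iff_tendsto_nat_of_nonneg fun k => coneFactor_nonneg k s]
  have h1 : ∀ n : ℕ, ∑ k ∈ Finset.range (n + 1), coneFactor k s = cutoff (s * (4 ^ n)⁻¹) := by
    intro n
    induction n with
    | zero => simp [coneFactor]
    | succ n ih =>
      rw [Finset.sum_range_succ, ih, coneFactor, if_neg (Nat.succ_ne_zero n), annulus,
        show 4 * (s * (4 ^ (n + 1))⁻¹) = s * (4 ^ n)⁻¹ by rw [pow_succ]; field_simp]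
      ring
  rw [← Filter.tendsto_add_atTop_iff_nat 1]
  simp only [h1]
  have h2 : Filter.Tendsto (fun n : ℕ => s * ((4 : ℝ) ^ n)⁻¹) Filter.atTop (nhds (s * 0)) := by
    refine Filter.Tendsto.const_mul _ ?_
    simp only [← inv_pow]
    exact tendsto_pow_atTop_nhds_zero_of_lt_one (by norm_num) (by norm_num)
  have h3 := (continuous_cutoff.tendsto (s * 0)).comp h2
  rw [mul_zero, cutoff_of_le (by norm_num)] at h3
  exact h3

/-- The localization of the frequency to the cone with index `k` at scale `t`. -/
def coneFun (S : Finset (Fin m)) (x : ℕ × ℝ) (ξ : BlockVec (Fin m) d) : ℝ :=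
  annulus (x.2 ^ 2 * sqPart Sᶜ ξ) * coneFactor x.1 (x.2 ^ 2 * sqPart S ξ)

theorem coneFun_nonneg (S : Finset (Fin m)) (x : ℕ × ℝ) (ξ : BlockVec (Fin m) d) :
    0 ≤ coneFun S x ξ := mul_nonneg (annulus_nonneg _) (coneFactor_nonneg _ _)

theorem measurable_coneFun (S : Finset (Fin m)) :
    Measurable fun z : (ℕ × ℝ) × BlockVec (Fin m) d => coneFun S z.1 z.2 := by
  have h1 := (contDiff_sqPart (m := m) (d := d) (n := 0) S).continuous.measurable
  have h2 := (contDiff_sqPart (m := m) (d := d) (n := 0) Sᶜ).continuous.measurable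
  have h3 := continuous_annulus.measurable
  have h4 := continuous_cutoff.measurable
  unfold coneFun coneFactor
  refine Measurable.mul (by fun_prop) (Measurable.ite ?_ (by fun_prop) ?_)
  · exact (measurableSet_singleton (0 : ℕ)).preimage (by fun_prop)
  · refine h3.comp (Measurable.mul (by fun_prop) (Measurable.inv ?_))
    exact measurable_const.pow (by fun_prop)

/-- Summing over the cones leaves the bump in `t²|ξ''|²`, whose scale integral does not depend on
`ξ`, except that nothing remains where `ξ'' = 0`. -/
theorem lintegral_coneFun (S : Finset (Fin m)) (ξ : BlockVec (Fin m) d) :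
    ∫⁻ x, ENNReal.ofReal (coneFun S x ξ * |x.2|⁻¹)
      ∂((Measure.count : Measure ℕ).prod (volume.restrict (Ioi (0 : ℝ)))) =
      if sqPart Sᶜ ξ = 0 then 0 else ENNReal.ofReal scaleMass := by
  have hm : Measurable fun x : ℕ × ℝ => ENNReal.ofReal (coneFun S x ξ * |x.2|⁻¹) := by
    have h := (measurable_coneFun S).comp (measurable_prodMk_right (y := ξ))
    exact (h.mul (by fun_prop)).ennreal_ofReal
  rw [lintegral_prod_symm _ hm.aemeasurable]
  have h1 : ∀ t : ℝ, ∫⁻ k, ENNReal.ofReal (coneFun S (k, t) ξ * |t|⁻¹) ∂Measure.count =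
      ENNReal.ofReal (annulus (t ^ 2 * sqPart Sᶜ ξ) * |t|⁻¹) := by
    intro t
    rw [lintegral_count]
    have h2 := ((hasSum_coneFactor (t ^ 2 * sqPart S ξ)).mul_left
      (annulus (t ^ 2 * sqPart Sᶜ ξ))).mul_right |t|⁻¹
    rw [mul_one] at h2
    rw [← h2.tsum_eq, ENNReal.ofReal_tsum_of_nonneg _ h2.summable]
    · rfl
    · exact fun k => mul_nonneg (mul_nonneg (annulus_nonneg _) (coneFactor_nonneg _ _))
        (inv_nonneg.2 (abs_nonneg _))
  simp only [h1]
  split_ifs with h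
  · simp [h, annulus_of_le]
  · exact lintegral_annulus (lt_of_le_of_ne (sqPart_nonneg _ _) (Ne.symm h))

/-- The localization to an isotropic piece of a cone. -/
def conePiece (S : Finset (Fin m)) (k : ℕ) (η : BlockVec (Fin m) d) : ℝ :=
  annulus (sqPart Sᶜ η) * if k = 0 then cutoff (sqPart S η) else annulus (sqPart S η)

/-- The dilation factors that turn the cone with index `k` into an isotropic region. -/
def coneScale (S : Finset (Fin m)) (k : ℕ) (r : Fin m) : ℝ := if r ∈ S then (2 ^ k)⁻¹ else 1

theorem coneScale_pos (S : Finset (Fin m)) (k : ℕ) (r : Fin m) : 0 < coneScale S k r := by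
  unfold coneScale
  split_ifs <;> positivity

theorem sqPart_smul_coneScale (S : Finset (Fin m)) (k : ℕ) (t : ℝ) (ξ : BlockVec (Fin m) d) :
    sqPart S (t • blockAct (Matrix.diagonal (coneScale S k)) ξ) =
      t ^ 2 * sqPart S ξ * (4 ^ k)⁻¹ := by
  unfold sqPart
  simp only [Finset.mul_sum, Finset.sum_mul]
  refine Finset.sum_congr rfl fun r hr => Finset.sum_congr rfl fun q _ => ?_
  rw [PiLp.smul_apply, blockAct_diagonal, coneScale, if_pos hr, smul_eq_mul, mul_pow, mul_pow,
    show (4 : ℝ) = 2 ^ 2 by norm_num, ← pow_mul, ← inv_pow, ← inv_pow, ← pow_mul, mul_comm 2 k]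
  ring

theorem sqPart_compl_smul_coneScale (S : Finset (Fin m)) (k : ℕ) (t : ℝ)
    (ξ : BlockVec (Fin m) d) :
    sqPart Sᶜ (t • blockAct (Matrix.diagonal (coneScale S k)) ξ) = t ^ 2 * sqPart Sᶜ ξ := by
  unfold sqPart
  simp only [Finset.mul_sum]
  refine Finset.sum_congr rfl fun r hr => Finset.sum_congr rfl fun q _ => ?_
  rw [PiLp.smul_apply, blockAct_diagonal, coneScale, if_neg (by simpa using hr), smul_eq_mul,
    one_mul, mul_pow]

/-- After the dilation all cones with `k ≥ 1` have the same localization, so finitely many constants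
serve all `k`. -/
theorem coneFun_eq (S : Finset (Fin m)) (k : ℕ) (t : ℝ) (ξ : BlockVec (Fin m) d) :
    coneFun S (k, t) ξ =
      conePiece S k (t • blockAct (Matrix.diagonal (coneScale S k)) ξ) := by
  rw [coneFun, conePiece, sqPart_smul_coneScale, sqPart_compl_smul_coneScale, coneFactor]
  split_ifs with h
  · subst h
    simp
  · rfl

/-- The region `1/4 ≤ |η''|² ≤ 2`, `c ≤ |η'|² ≤ 2`. -/
def coneRegion (d : ℕ) (S : Finset (Fin m)) (c : ℝ) : Set (BlockVec (Fin m) d) :=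
  {η | sqPart Sᶜ η ∈ Icc (1 / 4) 2 ∧ sqPart S η ∈ Icc c 2}

theorem sqPart_add_sqPart_compl (S : Finset (Fin m)) (η : BlockVec (Fin m) d) :
    sqPart S η + sqPart Sᶜ η = ‖η‖ ^ 2 := by
  rw [EuclideanSpace.norm_sq_eq, Fintype.sum_prod_type, sqPart, sqPart,
    Finset.sum_add_sum_compl S fun r => ∑ q, η (r, q) ^ 2]
  simp

theorem isCompact_coneRegion (S : Finset (Fin m)) (c : ℝ) : IsCompact (coneRegion d S c) := by
  refine (isCompact_closedBall (0 : BlockVec (Fin m) d) 2).of_isClosed_subset ?_ ?_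
  · exact (isClosed_Icc.preimage (contDiff_sqPart (n := 0) Sᶜ).continuous).inter
      (isClosed_Icc.preimage (contDiff_sqPart (n := 0) S).continuous)
  · intro η hη
    have h := sqPart_add_sqPart_compl S η
    have h1 := hη.1.2
    have h2 := hη.2.2
    rw [mem_closedBall_zero_iff]
    exact le_of_sq_le_sq (by linarith) (by norm_num)

theorem sqPart_compl_ne_zero_of_mem {S : Finset (Fin m)} {c : ℝ} {η : BlockVec (Fin m) d}
    (hη : η ∈ coneRegion d S c) : sqPart Sᶜ η ≠ 0 := by
  have := hη.1.1
  intro h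
  rw [h] at this
  norm_num at this

theorem contDiff_conePiece (S : Finset (Fin m)) (k : ℕ) {n : ℕ} :
    ContDiff ℝ n (conePiece S k : BlockVec (Fin m) d → ℝ) := by
  unfold conePiece
  refine (contDiff_annulus.comp (contDiff_sqPart Sᶜ)).mul ?_
  split_ifs
  · exact contDiff_cutoff.comp (contDiff_sqPart S)
  · exact contDiff_annulus.comp (contDiff_sqPart S)

theorem conePiece_eq_zero (S : Finset (Fin m)) (k : ℕ) {η : BlockVec (Fin m) d}
    (hη : η ∉ coneRegion d S (if k = 0 then 0 else 1 / 4)) : conePiece S k η = 0 := by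
  unfold conePiece
  by_contra h
  obtain ⟨h1, h2⟩ := mul_ne_zero_iff.1 h
  refine hη ⟨⟨?_, ?_⟩, ⟨?_, ?_⟩⟩
  · exact le_of_not_gt fun h => h1 (annulus_of_le h.le)
  · exact le_of_not_gt fun h => h1 (annulus_of_ge h.le)
  · split_ifs at h2 ⊢ with hk
    · exact sqPart_nonneg _ _
    · exact le_of_not_gt fun h => h2 (annulus_of_le h.le)
  · split_ifs at h2 with hk
    · exact le_of_not_gt fun h => h2 (cutoff_of_ge h.le)
    · exact le_of_not_gt fun h => h2 (annulus_of_ge h.le)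

end CubicalBL
end

noncomputable section
namespace CubicalBL

variable {m d : ℕ}

/-! ### Symbols on thin cones -/

theorem IsSymbol.comp_smul {E F : Type} [NormedAddCommGroup E] [NormedSpace ℝ E]
    [NormedAddCommGroup F] [NormedSpace ℝ F] {N : ℕ} {B : ℝ} {f : E → F} (h : IsSymbol N B f)
    (hB : 0 ≤ B) {c : ℝ} (hc : 0 < c) : IsSymbol N B fun ξ => f (c • ξ) := by
  refine ⟨h.contDiffOn.comp (by fun_prop) fun ξ hξ => by simpa [hc.ne'] using hξ,
    fun n hn ξ hξ => ?_⟩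
  have hcξ : c • ξ ≠ 0 := smul_ne_zero hc.ne' hξ
  have h1 := norm_iteratedFDeriv_comp_add_clm_le (c • ContinuousLinearMap.id ℝ E) 0
    isOpen_compl_singleton h.contDiffOn (x := ξ) (by simpa [hc.ne'] using hξ) hn
  have h2 : ∀ x : E, 0 + (c • ContinuousLinearMap.id ℝ E) x = c • x := fun x => by simp
  simp only [h2] at h1
  have h3 : ‖c • ContinuousLinearMap.id ℝ E‖ ≤ c := by
    rw [norm_smul, Real.norm_of_nonneg hc.le]
    exact mul_le_of_le_one_right hc.le ContinuousLinearMap.norm_id_le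
  have hξ' : 0 < ‖ξ‖ := norm_pos_iff.2 hξ
  calc _ ≤ _ := h1
    _ ≤ B * (‖c • ξ‖ ^ n)⁻¹ * c ^ n := by
        gcongr
        exact h.bound n hn _ hcξ
    _ = B * (‖ξ‖ ^ n)⁻¹ := by
        rw [norm_smul, Real.norm_of_nonneg hc.le, mul_pow]
        field_simp

/-- The projection of block vectors to the slots in `S`. -/
def slotProj (d : ℕ) (S : Finset (Fin m)) : BlockVec (Fin m) d →L[ℝ] BlockVec (Fin m) d :=
  blockAct (Matrix.diagonal fun r => if r ∈ S then 1 else 0)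

theorem slotProj_apply (S : Finset (Fin m)) (η : BlockVec (Fin m) d) (r : Fin m) (q : Fin d) :
    slotProj d S η (r, q) = if r ∈ S then η (r, q) else 0 := by
  rw [slotProj, blockAct_diagonal]
  split_ifs <;> simp

/-- The linear map that multiplies the slots outside `S` with `s`. -/
def shrink (S : Finset (Fin m)) (s : ℝ) (η : BlockVec (Fin m) d) : BlockVec (Fin m) d :=
  slotProj d S η + s • slotProj d Sᶜ η

theorem shrink_apply (S : Finset (Fin m)) (s : ℝ) (η : BlockVec (Fin m) d) (r : Fin m)
    (q : Fin d) : shrink S s η (r, q) = if r ∈ S then η (r, q) else s * η (r, q) := by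
  rw [shrink, PiLp.add_apply, PiLp.smul_apply, slotProj_apply, slotProj_apply]
  by_cases h : r ∈ S <;> simp [h]

theorem shrink_one (S : Finset (Fin m)) (η : BlockVec (Fin m) d) : shrink S 1 η = η := by
  ext ⟨r, q⟩
  simp [shrink_apply]

theorem contDiff_shrink {n : WithTop ℕ∞} (S : Finset (Fin m)) :
    ContDiff ℝ n fun x : ℝ × BlockVec (Fin m) d => shrink S x.1 x.2 := by
  unfold shrink
  fun_prop

theorem shrink_ne_zero {S : Finset (Fin m)} {s : ℝ} {η : BlockVec (Fin m) d}
    (h : sqPart S η ≠ 0) : shrink S s η ≠ 0 := by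
  refine fun h0 => h (sqPart_eq_zero fun r hr q => ?_)
  have h1 := shrink_apply S s η r q
  rw [h0, if_pos hr] at h1
  simpa using h1.symm

theorem shrink_ne_zero_of_pos {S : Finset (Fin m)} {s : ℝ} (hs : 0 < s) {η : BlockVec (Fin m) d}
    (h : η ≠ 0) : shrink S s η ≠ 0 := by
  refine fun h0 => h ?_
  ext ⟨r, q⟩
  have h1 := shrink_apply S s η r q
  rw [h0] at h1
  split_ifs at h1 with hr
  · simpa using h1.symm
  · simpa [hs.ne'] using h1.symm

theorem sqPart_shrink (S : Finset (Fin m)) (s : ℝ) (η : BlockVec (Fin m) d) :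
    sqPart S (shrink S s η) = sqPart S η := by
  unfold sqPart
  refine Finset.sum_congr rfl fun r hr => Finset.sum_congr rfl fun q _ => ?_
  rw [shrink_apply, if_pos hr]

theorem half_le_norm_of_sqPart {T : Finset (Fin m)} {η : BlockVec (Fin m) d}
    (h : 1 / 4 ≤ sqPart T η) : 1 / 2 ≤ ‖η‖ := by
  have h1 := sqPart_add_sqPart_compl T η
  have h2 := sqPart_nonneg Tᶜ η
  exact le_of_sq_le_sq (by linarith) (norm_nonneg _)

theorem inv_pow_le_two_pow {x : ℝ} (h : 1 / 2 ≤ x) {n N : ℕ} (hn : n ≤ N) :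
    (x ^ n)⁻¹ ≤ 2 ^ N := by
  have hx : 0 < x := by linarith
  calc (x ^ n)⁻¹ = (x⁻¹) ^ n := (inv_pow x n).symm
    _ ≤ 2 ^ n := by
        gcongr
        rw [inv_le_comm₀ hx (by norm_num)]
        linarith
    _ ≤ 2 ^ N := pow_le_pow_right₀ (by norm_num) hn

/-- On this region the component in `S` has length at least `1/2` and is not affected by `shrink`,
so the argument of `g` stays away from the origin even for `s = 0`. The chain rule then bounds the
derivatives jointly in `s` and `η`. -/
theorem exists_norm_iteratedFDeriv_comp_shrink_le (d : ℕ) (S : Finset (Fin m)) (N : ℕ) :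
    ∃ C : ℝ, 0 ≤ C ∧ ∀ g : BlockVec (Fin m) d → ℂ, IsSymbol N 1 g →
      ∀ s ∈ Icc (0 : ℝ) 1, ∀ η ∈ coneRegion d S (1 / 4), ∀ n ≤ N,
      ‖iteratedFDeriv ℝ n (fun x : ℝ × BlockVec (Fin m) d => g (shrink S x.1 x.2)) (s, η)‖ ≤ C := by
  have hQ : ∀ i : ℕ, ∃ D : ℝ, ∀ x ∈ Icc (0 : ℝ) 1 ×ˢ coneRegion d S (1 / 4),
      ‖iteratedFDeriv ℝ i (fun x : ℝ × BlockVec (Fin m) d => shrink S x.1 x.2) x‖ ≤ D := fun i =>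
    (isCompact_Icc.prod (isCompact_coneRegion S _)).exists_bound_of_continuousOn
      ((contDiff_shrink (n := i) S).continuous_iteratedFDeriv le_rfl).continuousOn
  choose D hD using hQ
  set D₀ : ℝ := 1 + ∑ i ∈ Finset.range (N + 1), |D i| with hD₀
  have hD₀1 : 1 ≤ D₀ := by
    have : 0 ≤ ∑ i ∈ Finset.range (N + 1), |D i| := Finset.sum_nonneg fun _ _ => abs_nonneg _
    linarith
  refine ⟨N.factorial * 2 ^ N * D₀ ^ N, by positivity, fun g hg s hs η hη n hn => ?_⟩
  set O : Set (ℝ × BlockVec (Fin m) d) := {x | sqPart S x.2 ≠ 0} with hO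
  have hOo : IsOpen O := isOpen_ne_fun
    ((contDiff_sqPart (n := 0) S).continuous.comp continuous_snd) continuous_const
  have hx : (s, η) ∈ O := by
    have := hη.2.1
    intro h
    rw [h] at this
    norm_num at this
  have h1 := norm_iteratedFDerivWithin_comp_le (N := N) (n := n) hg.contDiffOn
    (contDiff_shrink (m := m) (d := d) S).contDiffOn (by exact_mod_cast hn)
    isOpen_compl_singleton.uniqueDiffOn hOo.uniqueDiffOn
    (fun x hx => shrink_ne_zero hx) hx (C := 2 ^ N) (D := D₀) (fun i hi => ?_) (fun i hi1 hi => ?_)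
  · rw [iteratedFDerivWithin_of_isOpen n hOo hx] at h1
    refine h1.trans ?_
    gcongr
  · have hne : shrink S s η ≠ 0 := shrink_ne_zero hx
    rw [iteratedFDerivWithin_of_isOpen i isOpen_compl_singleton hne]
    refine (hg.bound i (hi.trans hn) _ hne).trans ?_
    rw [one_mul]
    refine inv_pow_le_two_pow (half_le_norm_of_sqPart (T := S) ?_) (hi.trans hn)
    rw [sqPart_shrink]
    exact hη.2.1
  · rw [iteratedFDerivWithin_of_isOpen i hOo hx]
    have h2 := hD i (s, η) ⟨hs, hη⟩
    refine h2.trans ?_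
    calc D i ≤ |D i| := le_abs_self _
      _ ≤ ∑ i ∈ Finset.range (N + 1), |D i| := Finset.single_le_sum (f := fun i => |D i|)
          (fun _ _ => abs_nonneg _) (Finset.mem_range.2 (by omega))
      _ ≤ D₀ := by linarith
      _ = D₀ ^ 1 := (pow_one _).symm
      _ ≤ D₀ ^ i := pow_le_pow_right₀ hD₀1 hi1

theorem norm_compContinuousLinearMap_inr_le {E F G : Type} [NormedAddCommGroup E]
    [NormedSpace ℝ E] [NormedAddCommGroup F] [NormedSpace ℝ F] [NormedAddCommGroup G]
    [NormedSpace ℝ G] {n : ℕ} (L : ContinuousMultilinearMap ℝ (fun _ : Fin n => E × G) F) :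
    ‖L.compContinuousLinearMap fun _ => ContinuousLinearMap.inr ℝ E G‖ ≤ ‖L‖ := by
  refine (ContinuousMultilinearMap.norm_compContinuousLinearMap_le _ _).trans ?_
  refine mul_le_of_le_one_right (norm_nonneg _) ?_
  exact Finset.prod_le_one (fun _ _ => norm_nonneg _)
    fun _ _ => ContinuousLinearMap.norm_inr_le_one ℝ E G

/-- On a thin cone, a symbol that vanishes on its axis is small. -/
theorem exists_norm_iteratedFDeriv_shrink_le (d : ℕ) (S : Finset (Fin m)) (N : ℕ) :
    ∃ C : ℝ, 0 ≤ C ∧ ∀ g : BlockVec (Fin m) d → ℂ, IsSymbol (N + 1) 1 g →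
      (∀ ξ, ξ ≠ 0 → (∀ k ∉ S, ∀ q, ξ (k, q) = 0) → g ξ = 0) →
      ∀ s ∈ Icc (0 : ℝ) 1, ∀ η ∈ coneRegion d S (1 / 4), ∀ n ≤ N,
      ‖iteratedFDeriv ℝ n (fun η => g (shrink S s η)) η‖ ≤ C * s := by
  obtain ⟨C, hC0, hC⟩ := exists_norm_iteratedFDeriv_comp_shrink_le d S (N + 1)
  refine ⟨C, hC0, fun g hg hg0 s hs η hη n hn => ?_⟩
  set G : ℝ × BlockVec (Fin m) d → ℂ := fun x => g (shrink S x.1 x.2) with hG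
  set O : Set (ℝ × BlockVec (Fin m) d) := {x | sqPart S x.2 ≠ 0} with hO
  have hOo : IsOpen O := isOpen_ne_fun
    ((contDiff_sqPart (n := 0) S).continuous.comp continuous_snd) continuous_const
  have hGc : ContDiffOn ℝ (N + 1 : ℕ) G O :=
    hg.contDiffOn.comp (contDiff_shrink S).contDiffOn fun x hx => shrink_ne_zero hx
  have hη0 : sqPart S η ≠ 0 := by
    have := hη.2.1
    intro h
    rw [h] at this
    norm_num at this
  have hsec : ∀ s : ℝ, iteratedFDeriv ℝ n (fun η => g (shrink S s η)) η =
      (iteratedFDeriv ℝ n G (s, η)).compContinuousLinearMap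
        fun _ => ContinuousLinearMap.inr ℝ ℝ (BlockVec (Fin m) d) := by
    intro s
    have h2 : ∀ ξ : BlockVec (Fin m) d, ((s, (0 : BlockVec (Fin m) d)) : ℝ × _) +
        ContinuousLinearMap.inr ℝ ℝ (BlockVec (Fin m) d) ξ = (s, ξ) := by
      intro ξ
      simp
    have h1 := iteratedFDeriv_comp_add_clm (ContinuousLinearMap.inr ℝ ℝ (BlockVec (Fin m) d))
      (s, 0) hOo hGc (x := η) (by rw [h2]; exact hη0) (hn.trans (Nat.le_succ N))
    simp only [h2] at h1
    exact h1
  -- For `s = 0` the argument lies on the axis, where `g` vanishes; this holds for all points near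
  -- `η`, so the derivatives vanish too.
  have hzero : iteratedFDeriv ℝ n (fun η => g (shrink S 0 η)) η = 0 := by
    have h1 : (fun η => g (shrink S 0 η)) =ᶠ[nhds η] fun _ => (0 : ℂ) := by
      have h2 : ∀ᶠ η' in nhds η, sqPart S η' ≠ 0 :=
        (contDiff_sqPart (n := 0) S).continuous.continuousAt.eventually_ne hη0
      filter_upwards [h2] with η' hη'
      refine hg0 _ (shrink_ne_zero hη') fun k hk q => ?_
      rw [shrink_apply, if_neg hk, zero_mul]
    rw [(h1.iteratedFDeriv ℝ n).eq_of_nhds]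
    exact congrFun iteratedFDeriv_fun_zero η
  -- The mean value inequality in `s` gains the factor `s` and costs one derivative, hence `N + 1`
  -- in the hypothesis.
  have hdiff : ‖iteratedFDeriv ℝ n G (s, η) - iteratedFDeriv ℝ n G (0, η)‖ ≤ C * s := by
    have hseg : ∀ x ∈ Icc (0 : ℝ) 1 ×ˢ ({η} : Set (BlockVec (Fin m) d)), x ∈ O ∧
        ‖fderiv ℝ (iteratedFDeriv ℝ n G) x‖ ≤ C := by
      rintro ⟨a, b⟩ ⟨ha, hb⟩
      rw [mem_singleton_iff] at hb
      simp only at hb ha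
      subst hb
      refine ⟨hη0, ?_⟩
      rw [norm_fderiv_iteratedFDeriv]
      exact hC g hg a ha _ hη _ (by omega)
    have h1 := (((convex_Icc (0 : ℝ) 1).prod (convex_singleton η))).norm_image_sub_le_of_norm_fderiv_le
      (𝕜 := ℝ) (f := iteratedFDeriv ℝ n G) (C := C) (x := (0, η)) (y := (s, η))
      (fun x hx => ?_) (fun x hx => (hseg x hx).2) ⟨⟨le_rfl, zero_le_one⟩, rfl⟩ ⟨hs, rfl⟩
    · refine h1.trans (le_of_eq ?_)
      rw [Prod.mk_sub_mk, sub_self, sub_zero, Prod.norm_mk, norm_zero, Real.norm_of_nonneg hs.1,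
        max_eq_left hs.1]
    · refine (hGc.contDiffAt (hOo.mem_nhds (hseg x hx).1)).differentiableAt_iteratedFDeriv ?_
      exact_mod_cast Nat.lt_succ_of_le hn
  have hsub : iteratedFDeriv ℝ n (fun η => g (shrink S s η)) η =
      (iteratedFDeriv ℝ n G (s, η) - iteratedFDeriv ℝ n G (0, η)).compContinuousLinearMap
        fun _ => ContinuousLinearMap.inr ℝ ℝ (BlockVec (Fin m) d) := by
    rw [← sub_zero (iteratedFDeriv ℝ n (fun η => g (shrink S s η)) η), ← hzero, hsec, hsec]
    ext v
    simp
  rw [hsub]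
  exact (norm_compContinuousLinearMap_inr_le _).trans hdiff

theorem shrink_smul_coneScale (S : Finset (Fin m)) (k : ℕ) (t : ℝ) (ξ : BlockVec (Fin m) d) :
    shrink S (2 ^ k)⁻¹ (t • blockAct (Matrix.diagonal (coneScale S k)) ξ) =
      (t * (2 ^ k)⁻¹) • ξ := by
  ext ⟨r, q⟩
  rw [shrink_apply, PiLp.smul_apply, PiLp.smul_apply, blockAct_diagonal, coneScale, smul_eq_mul,
    smul_eq_mul]
  split_ifs <;> ring

end CubicalBL
end

noncomputable section
namespace CubicalBL

variable {m d : ℕ}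

/-! ### The cone decomposition -/

/-- The dilation carries the cone to an isotropic region. The symbol is written as `shrink` followed
by an isotropic dilation, since only the latter preserves the symbol estimates. -/
theorem pairing_mul_coneFun (S : Finset (Fin m)) (A : Matrix (Fin m) (Fin m) ℝ)
    (F : Cube m → 𝓢(BlockVec (Fin m) d, ℝ)) (M : BlockVec (Fin m) d → ℂ) (k : ℕ) {t : ℝ}
    (ht : 0 < t) :
    pairing (fun ξ => M ξ * coneFun S (k, t) ξ) A F =
      pairing (fun ξ => M ((t * (2 ^ k)⁻¹)⁻¹ • shrink S (2 ^ k)⁻¹ (t • ξ)) *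
        conePiece S k (t • ξ)) (scaleMat (coneScale S k) A)
        (scaleTuple (coneScale S k) (coneScale_pos S k) F) := by
  rw [pairing_scaleTuple (coneScale S k) (coneScale_pos S k) (fun ξ =>
    M ((t * (2 ^ k)⁻¹)⁻¹ • shrink S (2 ^ k)⁻¹ (t • ξ)) * conePiece S k (t • ξ))]
  congr 1
  funext ξ
  have h : t * (2 ^ k)⁻¹ ≠ 0 := by positivity
  rw [shrink_smul_coneScale, coneFun_eq, smul_smul, inv_mul_cancel₀ h, one_smul]

theorem Admissible.scaleMat_coneScale {S : Finset (Fin m)} {ε R : ℝ}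
    {A : Matrix (Fin m) (Fin m) ℝ} (hA : Admissible S ε R A) (k : ℕ) :
    Admissible S ε R (CubicalBL.scaleMat (coneScale S k) A) := by
  refine hA.scaleMat (coneScale_pos S k) fun r hr s => ?_
  rw [coneScale, coneScale, if_neg hr]
  split_ifs
  · exact inv_le_one_of_one_le₀ (one_le_pow₀ (by norm_num))
  · exact le_rfl

/-- The estimate for localized multipliers applies to the rescaled data. For `k = 0` the plain
symbol estimates suffice; for `k ≥ 1` the vanishing on the axis, with `s = 2^{-k}`, yields the decay
that makes the cones summable. -/
theorem SquareBound.lintegral_cone_le {S : Finset (Fin m)} (h : SquareBound d S) (hm : 1 ≤ m)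
    (hd : 1 ≤ d) {ε R : ℝ} (hε : 0 < ε) (hR : 1 ≤ R) :
    ∃ C : ℝ, 0 ≤ C ∧ ∀ (A : Matrix (Fin m) (Fin m) ℝ) (F : Cube m → 𝓢(BlockVec (Fin m) d, ℝ))
      (M : BlockVec (Fin m) d → ℂ), Admissible S ε R A → SymTuple S F →
      IsSymbol (3 * d * m) 1 M →
      (∀ ξ, ξ ≠ 0 → (∀ k ∉ S, ∀ q, ξ (k, q) = 0) → M ξ = 0) → ∀ k : ℕ,
      ∫⁻ t in Ioi (0 : ℝ), ‖pairing (fun ξ => M ξ * coneFun S (k, t) ξ) A F‖ₑ *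
        ENNReal.ofReal t⁻¹ ≤ ENNReal.ofReal (C * (2 ^ k)⁻¹) := by
  set N : ℕ := 3 * d * m - 1 with hN
  -- One of the `3dm` derivatives is reserved for the mean value inequality on thin cones.
  have hN1 : 3 * d * m = N + 1 := by
    have : 0 < 3 * d * m := by positivity
    omega
  obtain ⟨C₀, hC₀0, hC₀⟩ := h.lintegral_pairing_le hm hd hε hR (ρ := conePiece S 0)
    (contDiff_conePiece S 0) (isCompact_coneRegion S 0) (fun η => sqPart_compl_ne_zero_of_mem)
    (fun η hη => conePiece_eq_zero S 0 (by simpa using hη))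
  obtain ⟨C₁, hC₁0, hC₁⟩ := h.lintegral_pairing_le hm hd hε hR (ρ := conePiece S 1)
    (contDiff_conePiece S 1) (isCompact_coneRegion S (1 / 4))
    (fun η => sqPart_compl_ne_zero_of_mem) (fun η hη => conePiece_eq_zero S 1 (by simpa using hη))
  obtain ⟨D, hD0, hD⟩ := exists_norm_iteratedFDeriv_shrink_le d S N
  refine ⟨C₀ * 2 ^ N + C₁ * D, by positivity, fun A F M hA hF hM hM0 k => ?_⟩
  set s : ℝ := (2 ^ k)⁻¹ with hs
  have hs0 : 0 < s := by positivity
  have hs1 : s ≤ 1 := inv_le_one_of_one_le₀ (one_le_pow₀ (by norm_num))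
  set f : ℝ → BlockVec (Fin m) d → ℂ := fun t η => M ((t * s)⁻¹ • shrink S s η) with hf
  have hg : ∀ t : ℝ, 0 < t → IsSymbol (N + 1) 1 fun ξ => M ((t * s)⁻¹ • ξ) := fun t ht =>
    (hN1 ▸ hM).comp_smul zero_le_one (by positivity)
  have hfc : ∀ t : ℝ, 0 < t → ContDiffOn ℝ N (f t) {η | sqPart Sᶜ η ≠ 0} := by
    intro t ht
    refine ((hg t ht).contDiffOn.of_le (by exact_mod_cast Nat.le_succ N)).comp
      (t := {0}ᶜ) (g := fun ξ => M ((t * s)⁻¹ • ξ)) (f := fun η => shrink S s η) ?_ ?_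
    · exact ((contDiff_shrink S).comp (contDiff_const.prodMk contDiff_id)).contDiffOn
    · intro η hη
      refine shrink_ne_zero_of_pos hs0 fun h0 => hη ?_
      rw [h0]
      exact sqPart_eq_zero fun _ _ _ => rfl
  have hpair : ∫⁻ t in Ioi (0 : ℝ), ‖pairing (fun ξ => M ξ * coneFun S (k, t) ξ) A F‖ₑ *
        ENNReal.ofReal t⁻¹ = ∫⁻ t in Ioi (0 : ℝ), ‖pairing (fun ξ => f t (t • ξ) *
        conePiece S k (t • ξ)) (scaleMat (coneScale S k) A)
        (scaleTuple (coneScale S k) (coneScale_pos S k) F)‖ₑ * ENNReal.ofReal t⁻¹ := by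
    refine setLIntegral_congr_fun measurableSet_Ioi fun t ht => ?_
    simp only [pairing_mul_coneFun S A F M k ht]
    rfl
  rw [hpair]
  rcases Nat.eq_zero_or_pos k with hk | hk
  · subst hk
    have hs' : s = 1 := by simp [hs]
    refine (hC₀ _ _ f (2 ^ N) (hA.scaleMat_coneScale 0) (hF.scaleTuple _ _) (by positivity) hfc
      fun t ht n hn η hη => ?_).trans (ENNReal.ofReal_le_ofReal ?_)
    · have hη1 := half_le_norm_of_sqPart hη.1.1
      have h1 := (hg t ht).bound n (hn.trans (Nat.le_succ N)) η
        (norm_pos_iff.1 (lt_of_lt_of_le (by norm_num) hη1))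
      have h2 : f t = fun ξ => M ((t * s)⁻¹ • ξ) := by
        funext ξ
        simp only [hf, hs', shrink_one]
      rw [h2]
      rw [one_mul] at h1
      exact h1.trans (inv_pow_le_two_pow hη1 hn)
    · rw [hs', mul_one]
      linarith [mul_nonneg hC₁0 hD0]
  · have hk1 : (conePiece S k : BlockVec (Fin m) d → ℝ) = conePiece S 1 := by
      funext η
      simp [conePiece, hk.ne']
    rw [hk1]
    refine (hC₁ _ _ f (D * s) (hA.scaleMat_coneScale k) (hF.scaleTuple _ _) (by positivity) hfc
      fun t ht n hn η hη => ?_).trans (ENNReal.ofReal_le_ofReal ?_)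
    · refine hD _ (hg t ht) (fun ξ hξ h0 => ?_) s ⟨hs0.le, hs1⟩ η hη n hn
      refine hM0 _ (smul_ne_zero (by positivity) hξ) fun r hr q => ?_
      rw [PiLp.smul_apply, h0 r hr q, smul_zero]
    · have : 0 ≤ C₀ * 2 ^ N * s := by positivity
      rw [add_mul, mul_assoc C₁]
      linarith

theorem IsSymbol.norm_le {N : ℕ} {B : ℝ} {M : BlockVec (Fin m) d → ℂ} (hM : IsSymbol N B M)
    {ξ : BlockVec (Fin m) d} (hξ : ξ ≠ 0) : ‖M ξ‖ ≤ B := by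
  have h := hM.bound 0 (Nat.zero_le _) ξ hξ
  rwa [norm_iteratedFDeriv_zero, pow_zero, inv_one, mul_one] at h

theorem IsSymbol.measurable {N : ℕ} {B : ℝ} {M : BlockVec (Fin m) d → ℂ} (hM : IsSymbol N B M) :
    Measurable M :=
  measurable_of_continuousOn_compl_singleton 0 hM.contDiffOn.continuousOn

/-- The measure on the cones and scales. -/
def coneMeasure : Measure (ℕ × ℝ) := Measure.count.prod (volume.restrict (Ioi 0))

instance : SFinite coneMeasure := by
  unfold coneMeasure
  infer_instance

theorem integral_coneFun (S : Finset (Fin m)) (ξ : BlockVec (Fin m) d) :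
    ∫ x, coneFun S x ξ * |x.2|⁻¹ ∂coneMeasure = if sqPart Sᶜ ξ = 0 then 0 else scaleMass := by
  rw [integral_eq_lintegral_of_nonneg_ae (Filter.Eventually.of_forall fun x =>
      mul_nonneg (coneFun_nonneg S x ξ) (inv_nonneg.2 (abs_nonneg _))) ?_, coneMeasure,
    lintegral_coneFun]
  · split_ifs
    · simp
    · exact ENNReal.toReal_ofReal scaleMass_pos.le
  · have h := (measurable_coneFun S).comp (measurable_prodMk_right (y := ξ))
    exact (h.mul (by fun_prop)).aestronglyMeasurable

theorem integrable_coneFun_mul (S : Finset (Fin m)) {φ : BlockVec (Fin m) d → ℂ}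
    (hφ : Integrable φ) :
    Integrable (fun z : (ℕ × ℝ) × BlockVec (Fin m) d =>
      ((coneFun S z.1 z.2 * |z.1.2|⁻¹ : ℝ) : ℂ) * φ z.2) (coneMeasure.prod volume) := by
  have hm : AEStronglyMeasurable (fun z : (ℕ × ℝ) × BlockVec (Fin m) d =>
      ((coneFun S z.1 z.2 * |z.1.2|⁻¹ : ℝ) : ℂ) * φ z.2) (coneMeasure.prod volume) := by
    refine AEStronglyMeasurable.mul (Measurable.aestronglyMeasurable ?_)
      hφ.aestronglyMeasurable.comp_snd
    have := measurable_coneFun (d := d) S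
    fun_prop
  refine ⟨hm, ?_⟩
  rw [hasFiniteIntegral_iff_enorm, lintegral_prod_symm _ hm.enorm]
  calc ∫⁻ ξ, ∫⁻ x, ‖((coneFun S x ξ * |x.2|⁻¹ : ℝ) : ℂ) * φ ξ‖ₑ ∂coneMeasure
      ≤ ∫⁻ ξ, ENNReal.ofReal scaleMass * ‖φ ξ‖ₑ := by
        refine lintegral_mono fun ξ => ?_
        simp only [enorm_mul ((coneFun S _ ξ * |_|⁻¹ : ℝ) : ℂ)]
        rw [lintegral_mul_const' _ _ enorm_ne_top]
        gcongr
        have h1 : ∀ x : ℕ × ℝ, ‖((coneFun S x ξ * |x.2|⁻¹ : ℝ) : ℂ)‖ₑ =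
            ENNReal.ofReal (coneFun S x ξ * |x.2|⁻¹) := fun x => by
          rw [enorm_complex_ofReal, Real.enorm_of_nonneg
            (mul_nonneg (coneFun_nonneg S x ξ) (inv_nonneg.2 (abs_nonneg _)))]
        simp only [h1]
        rw [coneMeasure, lintegral_coneFun]
        split_ifs <;> simp
    _ < ∞ := by
        rw [lintegral_const_mul' _ _ ENNReal.ofReal_ne_top]
        exact ENNReal.mul_lt_top ENNReal.ofReal_lt_top hφ.hasFiniteIntegral

/-- The cone functions integrate to `scaleMass` where `ξ'' ≠ 0`, and `M` vanishes elsewhere off the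
origin, so they reproduce a multiple of the pairing with `M`. Summing `C 2^{-k}` gives `2C`. -/
theorem SquareBound.symbolBound {S : Finset (Fin m)} (h : SquareBound d S) (hm : 1 ≤ m)
    (hd : 1 ≤ d) : SymbolBound d S := by
  intro ε R hε hR
  obtain ⟨C, hC0, hC⟩ := h.lintegral_cone_le hm hd hε hR
  have hnt : Nontrivial (BlockVec (Fin m) d) := by
    have : Nonempty (Fin m × Fin d) := ⟨⟨0, hm⟩, ⟨0, hd⟩⟩
    infer_instance
  have key : ∀ (A : Matrix (Fin m) (Fin m) ℝ) (F : Cube m → 𝓢(BlockVec (Fin m) d, ℝ))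
      (M : BlockVec (Fin m) d → ℂ), Admissible S ε R A → SymTuple S F →
      IsSymbol (3 * d * m) 1 M →
      (∀ ξ, ξ ≠ 0 → (∀ k ∉ S, ∀ q, ξ (k, q) = 0) → M ξ = 0) →
      ‖pairing M A F‖ ≤ 2 * C / scaleMass := by
    intro A F M hA hF hM hM0
    -- Nothing is assumed about `M` at the origin, which is a null set because `m` and `d` are
    -- positive.
    have hne : ∀ᵐ ξ : BlockVec (Fin m) d, ξ ≠ 0 := by
      simp [ae_iff]
    have hφ : Integrable fun ξ => M ξ * invPush A F ξ := by
      refine (invPush A F).integrable.bdd_mul (c := 1) hM.measurable.aestronglyMeasurable ?_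
      filter_upwards [hne] with ξ hξ using hM.norm_le hξ
    have hint := integrable_coneFun_mul S hφ
    have hswap := integral_integral_swap (f := fun (x : ℕ × ℝ) (ξ : BlockVec (Fin m) d) =>
      ((coneFun S x ξ * |x.2|⁻¹ : ℝ) : ℂ) * (M ξ * invPush A F ξ)) hint
    have hleft : ∀ x : ℕ × ℝ, ∫ ξ, ((coneFun S x ξ * |x.2|⁻¹ : ℝ) : ℂ) *
        (M ξ * invPush A F ξ) = pairing (fun ξ => M ξ * coneFun S x ξ) A F * (|x.2|⁻¹ : ℝ) := by
      intro x
      rw [pairing, ← integral_mul_const]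
      congr 1
      funext ξ
      push_cast
      ring
    have hright : ∫ ξ, ∫ x, ((coneFun S x ξ * |x.2|⁻¹ : ℝ) : ℂ) * (M ξ * invPush A F ξ)
        ∂coneMeasure = scaleMass * pairing M A F := by
      rw [pairing, ← integral_const_mul]
      refine integral_congr_ae ?_
      filter_upwards [hne] with ξ hξ
      rw [integral_mul_const, integral_complex_ofReal, integral_coneFun]
      split_ifs with h0
      · rw [hM0 ξ hξ fun k hk q => apply_eq_zero_of_sqPart h0 (by simpa using hk) q]
        simp
      · rfl
    have hmeas : AEMeasurable (fun x : ℕ × ℝ =>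
        ‖pairing (fun ξ => M ξ * coneFun S x ξ) A F * (|x.2|⁻¹ : ℝ)‖ₑ) coneMeasure := by
      have := hint.integral_prod_left.aestronglyMeasurable.enorm
      simp only [hleft] at this
      exact this
    have hle : ‖(scaleMass : ℂ) * pairing M A F‖ₑ ≤ ENNReal.ofReal (2 * C) := by
      rw [← hright, ← hswap]
      simp only [hleft]
      refine (enorm_integral_le_lintegral_enorm _).trans ?_
      rw [coneMeasure, lintegral_prod _ hmeas, lintegral_count]
      calc _ ≤ ∑' k : ℕ, ENNReal.ofReal (C * (2 ^ k)⁻¹) := by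
            refine ENNReal.tsum_le_tsum fun k => (le_of_eq ?_).trans (hC A F M hA hF hM hM0 k)
            refine setLIntegral_congr_fun measurableSet_Ioi fun t ht => ?_
            have ht0 : (0 : ℝ) < t := ht
            simp only
            rw [enorm_mul, enorm_complex_ofReal, abs_of_pos ht0,
              Real.enorm_of_nonneg (inv_nonneg.2 ht0.le)]
        _ = ENNReal.ofReal (2 * C) := by
            have hs : HasSum (fun k : ℕ => C * ((2 : ℝ) ^ k)⁻¹) (C * 2) := by
              have := hasSum_geometric_two.mul_left C
              simpa [one_div, inv_pow] using this
            rw [← ENNReal.ofReal_tsum_of_nonneg (fun k => by positivity) hs.summable, hs.tsum_eq,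
              mul_comm]
    rw [← ofReal_norm, ENNReal.ofReal_le_ofReal_iff (by positivity), norm_mul, Complex.norm_real,
      Real.norm_of_nonneg scaleMass_pos.le] at hle
    rw [le_div_iff₀ scaleMass_pos, mul_comm]
    exact hle
  refine ⟨2 * C / scaleMass, by have := scaleMass_pos; positivity,
    fun A F M B hA hF hB hM hM0 => ?_⟩
  have h1 := key A F (fun ξ => B⁻¹ • M ξ) hA hF ?_ fun ξ hξ h0 => by
    rw [hM0 ξ hξ h0, smul_zero]
  · have h2 : pairing (fun ξ => B⁻¹ • M ξ) A F = (B⁻¹ : ℝ) * pairing M A F := by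
      rw [pairing, pairing, ← integral_const_mul]
      congr 1
      funext ξ
      rw [Complex.real_smul]
      ring
    rw [h2, norm_mul, Complex.norm_real, Real.norm_of_nonneg (inv_nonneg.2 hB.le),
      inv_mul_le_iff₀ hB] at h1
    rw [mul_comm]
    exact h1
  · have h3 := hM.const_smul B⁻¹
    rwa [abs_of_pos (inv_pos.2 hB), inv_mul_cancel₀ hB.ne'] at h3

end CubicalBL
end

noncomputable section
namespace CubicalBL

variable {m d : ℕ}

/-! ### The induction over the slots -/

/-- Induction on the number of slots outside `S`. When `S` contains all slots, there is no slot left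
to test, `SquareBound` is vacuous, and no separate base case is needed. -/
theorem symbolBound (hm : 1 ≤ m) (hd : 1 ≤ d) (S : Finset (Fin m)) : SymbolBound d S := by
  induction hn : Sᶜ.card using Nat.strong_induction_on generalizing S with
  | _ n ih =>
    refine (squareBound_of_symbolBound fun i hi => ih _ ?_ (insert i S) rfl).symbolBound hm hd
    rw [← hn]
    refine Finset.card_lt_card (Finset.ssubset_iff_of_subset ?_ |>.2 ⟨i, by simpa using hi, by simp⟩)
    exact Finset.compl_subset_compl.2 (Finset.subset_insert i S)

theorem squareBound (hm : 1 ≤ m) (hd : 1 ≤ d) (S : Finset (Fin m)) : SquareBound d S :=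
  squareBound_of_symbolBound fun i _ => symbolBound hm hd (insert i S)

/-! ### Coordinate derivatives -/

/-- Expand each argument in the standard basis; this gives `card ι ^ n` terms, whose coefficients
are at most the product of the norms. -/
theorem norm_le_of_apply_single_le {ι : Type} [Fintype ι] [DecidableEq ι] {n : ℕ}
    (L : ContinuousMultilinearMap ℝ (fun _ : Fin n => EuclideanSpace ℝ ι) ℂ) {b : ℝ}
    (hb0 : 0 ≤ b) (hb : ∀ q : Fin n → ι, ‖L fun r => EuclideanSpace.single (q r) 1‖ ≤ b) :
    ‖L‖ ≤ Fintype.card ι ^ n * b := by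
  refine ContinuousMultilinearMap.opNorm_le_bound (by positivity) fun v => ?_
  have h1 : v = fun r => ∑ i, v r i • EuclideanSpace.single i (1 : ℝ) := by
    funext r
    ext j
    simp [Pi.single_apply]
  have h2 : L v = ∑ q : Fin n → ι, (∏ r, v r (q r)) •
      L fun r => EuclideanSpace.single (q r) 1 := by
    conv_lhs => rw [h1]
    have h3 := L.toMultilinearMap.map_sum
      (fun (r : Fin n) (i : ι) => v r i • EuclideanSpace.single i (1 : ℝ))
    refine h3.trans (Finset.sum_congr rfl fun q _ => ?_)
    exact L.toMultilinearMap.map_smul_univ _ _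
  rw [h2]
  calc _ ≤ ∑ q : Fin n → ι, (∏ r, ‖v r‖) * b := by
        refine (norm_sum_le _ _).trans (Finset.sum_le_sum fun q _ => ?_)
        rw [norm_smul, norm_prod]
        refine mul_le_mul ?_ (hb q) (norm_nonneg _) (by positivity)
        exact Finset.prod_le_prod (fun _ _ => norm_nonneg _) fun r _ =>
          abs_apply_le_norm (v r) (q r)
    _ = _ := by
        rw [Finset.sum_const, Finset.card_univ, Fintype.card_fun, Fintype.card_fin, nsmul_eq_mul]
        push_cast
        ring

theorem SymbolEstimates.isSymbol {ι : Type} [Fintype ι] [DecidableEq ι] {N : ℕ}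
    {M : EuclideanSpace ℝ ι → ℂ} (h : SymbolEstimates N M) (hι : 1 ≤ Fintype.card ι) :
    IsSymbol N (Fintype.card ι ^ N : ℕ) M := by
  refine ⟨h.1, fun n hn ξ hξ => ?_⟩
  refine (norm_le_of_apply_single_le _ (by positivity) fun q => h.2 n hn q ξ hξ).trans ?_
  gcongr
  exact_mod_cast Nat.pow_le_pow_right hι hn

/-! ### The multiplier of the square function -/

theorem squareIntegrand_eq (A : Matrix (Fin m) (Fin m) ℝ) (i : Fin m) (k₁ k₂ : Fin d)
    (u : BlockVec (Fin m) d) (c : ℝ → ℂ) (ξ : BlockVec (Fin m) d) (t : ℝ) :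
    squareIntegrand A i k₁ k₂ u c ξ t =
      c t * Complex.exp (2 * Real.pi * Complex.I * (inner ℝ u (t • ξ) : ℝ)) *
        ((symb A i k₁ k₂ (t • ξ) * t⁻¹ : ℝ) : ℂ) := by
  rw [squareIntegrand, fourier_gaussianDeriv]
  push_cast
  rw [div_eq_mul_inv]
  ring

theorem norm_exp_inner (u η : BlockVec (Fin m) d) :
    ‖Complex.exp (2 * Real.pi * Complex.I * (inner ℝ u η : ℝ))‖ = 1 := by
  rw [show 2 * Real.pi * Complex.I * ((inner ℝ u η : ℝ) : ℂ) =
    ((2 * Real.pi * inner ℝ u η : ℝ) : ℂ) * Complex.I by push_cast; ring,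
    Complex.norm_exp_ofReal_mul_I]

theorem integrableOn_squareIntegrand {c : ℝ → ℂ}
    (hcm : AEStronglyMeasurable c (volume.restrict (Ioi 0)))
    (hc : ∀ᵐ t ∂(volume.restrict (Ioi (0 : ℝ))), ‖c t‖ ≤ 1)
    (A : Matrix (Fin m) (Fin m) ℝ) (i : Fin m) (k₁ k₂ : Fin d)
    (u ξ : BlockVec (Fin m) d) : IntegrableOn (squareIntegrand A i k₁ k₂ u c ξ) (Ioi 0) := by
  have h : squareIntegrand A i k₁ k₂ u c ξ = fun t =>
      c t * Complex.exp (2 * Real.pi * Complex.I * (inner ℝ u (t • ξ) : ℝ)) *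
        ((symb A i k₁ k₂ (t • ξ) * t⁻¹ : ℝ) : ℂ) :=
    funext fun t => squareIntegrand_eq A i k₁ k₂ u c ξ t
  rw [h]
  refine Integrable.bdd_mul (c := 1) (integrableOn_symb_smul_mul_inv A i k₁ k₂ ξ).ofReal ?_ ?_
  · exact hcm.mul (Continuous.aestronglyMeasurable (by fun_prop))
  · filter_upwards [hc] with t ht
    rwa [norm_mul, norm_exp_inner, mul_one]

theorem norm_squareMultiplier_le {c : ℝ → ℂ}
    (hc : ∀ᵐ t ∂(volume.restrict (Ioi (0 : ℝ))), ‖c t‖ ≤ 1)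
    (A : Matrix (Fin m) (Fin m) ℝ) (i : Fin m) (k₁ k₂ : Fin d)
    (u ξ : BlockVec (Fin m) d) : ‖squareMultiplier A i k₁ k₂ u c ξ‖ ≤ Real.pi := by
  have h : ‖squareMultiplier A i k₁ k₂ u c ξ‖ₑ ≤ ENNReal.ofReal Real.pi := by
    refine (enorm_integral_le_lintegral_enorm _).trans (le_trans (lintegral_mono_ae ?_)
      (lintegral_symb_smul_mul_inv_le A i k₁ k₂ ξ))
    filter_upwards [hc] with t ht
    rw [squareIntegrand_eq, enorm_mul, enorm_complex_ofReal]
    refine mul_le_of_le_one_left (by positivity) ?_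
    rw [← ofReal_norm, norm_mul, norm_exp_inner, mul_one]
    exact ENNReal.ofReal_le_one.2 ht
  rw [← ofReal_norm] at h
  exact (ENNReal.ofReal_le_ofReal_iff Real.pi_pos.le).1 h

theorem aestronglyMeasurable_squareMultiplier {c : ℝ → ℂ}
    (hcm : AEStronglyMeasurable c (volume.restrict (Ioi 0)))
    (A : Matrix (Fin m) (Fin m) ℝ) (i : Fin m)
    (k₁ k₂ : Fin d) (u : BlockVec (Fin m) d) :
    AEStronglyMeasurable (squareMultiplier A i k₁ k₂ u c) := by
  unfold squareMultiplier
  simp only [squareIntegrand_eq]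
  refine AEStronglyMeasurable.integral_prod_right' (f := fun x : BlockVec (Fin m) d × ℝ =>
    c x.2 * Complex.exp (2 * Real.pi * Complex.I * (inner ℝ u (x.2 • x.1) : ℝ)) *
        ((symb A i k₁ k₂ (x.2 • x.1) * x.2⁻¹ : ℝ) : ℂ)) ?_
  refine (hcm.comp_snd.mul (Continuous.aestronglyMeasurable (by fun_prop))).mul
    (Measurable.aestronglyMeasurable ?_)
  have h1 : Measurable (fun p : BlockVec (Fin m) d × ℝ => symb A i k₁ k₂ (p.2 • p.1)) :=
    ((continuous_symb A i k₁ k₂).comp (by fun_prop)).measurable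
  exact Complex.measurable_ofReal.comp (h1.mul measurable_snd.inv)

/-- Fubini, with `c` and the character bounded by one. The function `c` then only multiplies the
oscillations, so absolute integrability over the scales suffices. -/
theorem pairing_squareMultiplier {c : ℝ → ℂ}
    (hcm : AEStronglyMeasurable c (volume.restrict (Ioi 0)))
    (hc : ∀ᵐ t ∂(volume.restrict (Ioi (0 : ℝ))), ‖c t‖ ≤ 1)
    (A : Matrix (Fin m) (Fin m) ℝ)
    (F : Cube m → 𝓢(BlockVec (Fin m) d, ℝ)) (i : Fin m) (k₁ k₂ : Fin d)
    (u : BlockVec (Fin m) d) : pairing (squareMultiplier A i k₁ k₂ u c) A F =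
      ∫ t in Ioi (0 : ℝ), c t * (osc A F i k₁ k₂ t u * (t⁻¹ : ℝ)) := by
  have h1 : Integrable (fun p : ℝ × BlockVec (Fin m) d =>
      c p.1 * Complex.exp (2 * Real.pi * Complex.I * (inner ℝ u (p.1 • p.2) : ℝ)) *
      (((symb A i k₁ k₂ (p.1 • p.2) * p.1⁻¹ : ℝ) : ℂ) * invPush A F p.2))
      ((volume.restrict (Ioi 0)).prod volume) := by
    refine (integrable_symb_smul_mul_inv_prod A i k₁ k₂ (invPush A F).integrable).bdd_mul
      (c := 1) ?_ ?_
    · exact hcm.comp_fst.mul (Continuous.aestronglyMeasurable (by fun_prop))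
    · filter_upwards [Measure.quasiMeasurePreserving_fst.ae hc] with p hp
      rwa [norm_mul, norm_exp_inner, mul_one]
  have h2 := integral_integral_swap (f := fun (t : ℝ) (ξ : BlockVec (Fin m) d) =>
      c t * Complex.exp (2 * Real.pi * Complex.I * (inner ℝ u (t • ξ) : ℝ)) *
      (((symb A i k₁ k₂ (t • ξ) * t⁻¹ : ℝ) : ℂ) * invPush A F ξ)) h1
  rw [pairing]
  calc _ = _ := by
        congr 1
        funext ξ
        rw [squareMultiplier, ← integral_mul_const]
        congr 1
        funext t
        rw [squareIntegrand_eq, mul_assoc]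
    _ = _ := h2.symm
    _ = _ := by
        congr 1
        funext t
        rw [osc, pairing, ← integral_mul_const, ← integral_const_mul]
        congr 1
        funext ξ
        push_cast
        ring

theorem norm_pairing_squareMultiplier_le {c : ℝ → ℂ}
    (hcm : AEStronglyMeasurable c (volume.restrict (Ioi 0)))
    (hc : ∀ᵐ t ∂(volume.restrict (Ioi (0 : ℝ))), ‖c t‖ ≤ 1)
    (A : Matrix (Fin m) (Fin m) ℝ)
    (F : Cube m → 𝓢(BlockVec (Fin m) d, ℝ)) (i : Fin m) (k₁ k₂ : Fin d)
    (u : BlockVec (Fin m) d) {B : ℝ} (hB0 : 0 ≤ B)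
    (hB : ∫⁻ t in Ioi (0 : ℝ), ‖osc A F i k₁ k₂ t u‖ₑ * ENNReal.ofReal t⁻¹ ≤ ENNReal.ofReal B) :
    ‖pairing (squareMultiplier A i k₁ k₂ u c) A F‖ ≤ B := by
  have h : ‖pairing (squareMultiplier A i k₁ k₂ u c) A F‖ₑ ≤ ENNReal.ofReal B := by
    rw [pairing_squareMultiplier hcm hc]
    refine (enorm_integral_le_lintegral_enorm _).trans (le_trans (lintegral_mono_ae ?_) hB)
    filter_upwards [hc, ae_restrict_mem measurableSet_Ioi] with t ht ht0
    rw [enorm_mul, enorm_mul, enorm_complex_ofReal,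
      Real.enorm_of_nonneg (inv_nonneg.2 (le_of_lt ht0))]
    refine mul_le_of_le_one_left (by positivity) ?_
    rw [← ofReal_norm]
    exact ENNReal.ofReal_le_one.2 ht
  rw [← ofReal_norm] at h
  exact (ENNReal.ofReal_le_ofReal_iff hB0).1 h

/-- A bounded measurable function is the Fourier transform of a tempered distribution. -/
theorem exists_isMultiplier {M : BlockVec (Fin m) d → ℂ} (hM : AEStronglyMeasurable M) {B : ℝ}
    (hB : ∀ ξ, ‖M ξ‖ ≤ B) : ∃ K : 𝓢'(BlockVec (Fin m) d, ℂ), IsMultiplier K M := by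
  have hL : MemLp M ∞ volume := memLp_top_of_bound hM B (Filter.Eventually.of_forall hB)
  refine ⟨𝓕⁻ (Lp.toTemperedDistribution (hL.toLp M)), fun φ => ⟨?_, ?_⟩⟩
  · exact φ.integrable.bdd_mul hM (Filter.Eventually.of_forall hB)
  · rw [FourierTransform.fourier_fourierInv_eq, Lp.toTemperedDistribution_apply]
    refine integral_congr_ae ?_
    filter_upwards [hL.coeFn_toLp] with ξ hξ
    rw [hξ, smul_eq_mul, mul_comm]

/-! ### Hypotheses of the theorem -/

theorem abs_le_hsNorm (A : Matrix (Fin m) (Fin m) ℝ) (r s : Fin m) : |A r s| ≤ hsNorm A := by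
  unfold hsNorm
  refine Real.abs_le_sqrt ?_
  calc A r s ^ 2 ≤ ∑ j, A r j ^ 2 := Finset.single_le_sum (f := fun j => A r j ^ 2)
        (fun _ _ => sq_nonneg _) (Finset.mem_univ s)
    _ ≤ _ := Finset.single_le_sum (f := fun i => ∑ j, A i j ^ 2)
        (fun _ _ => Finset.sum_nonneg fun _ _ => sq_nonneg _) (Finset.mem_univ r)

theorem lintegral_pow_of_eLpNorm_eq_one {f : BlockVec (Fin m) d → ℝ}
    (h : eLpNorm f ((2 : ℝ≥0∞) ^ m) volume = 1) : ∫⁻ x, ‖f x‖ₑ ^ (2 ^ m) = 1 := by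
  have h2 : ((2 : ℝ≥0∞) ^ m).toReal = ((2 ^ m : ℕ) : ℝ) := by
    rw [ENNReal.toReal_pow]
    push_cast
    rfl
  rw [eLpNorm_eq_lintegral_rpow_enorm_toReal (by positivity) (by simp), h2] at h
  simp only [ENNReal.rpow_natCast] at h
  have h3 := congrArg (fun x : ℝ≥0∞ => x ^ ((2 ^ m : ℕ) : ℝ)) h
  simp only [ENNReal.one_rpow] at h3
  rwa [← ENNReal.rpow_mul, one_div_mul_cancel (by positivity), ENNReal.rpow_one] at h3

end CubicalBL
end

/-! ### The theorem -/

open CubicalBL in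
theorem lemma2p2 (m d l : ℕ) (hm : 1 ≤ m) (hd : 1 ≤ d) (hl : l ≤ m)
    (ε : ℝ) (hε0 : 0 < ε) (hε1 : ε < 1) :
    ∃ C : ℝ, ∀ (A : Matrix (Fin m) (Fin m) ℝ) (F : Cube m → 𝓢(BlockVec (Fin m) d, ℝ)),
      (∀ j : Cube m, ε < |(pairMat A * (projMat j).transpose).det|) →
      hsNorm A ≤ ε⁻¹ →
      (∀ r : Fin m, (r : ℕ) < l → ∀ s : Fin m, A r s = (-1 : Matrix (Fin m) (Fin m) ℝ) r s) →
      (∀ i : Fin m, (i : ℕ) < l → ∀ j : Cube m, F j = F (j.reflect i)) →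
      (∀ j : Cube m, eLpNorm (F j) ((2 : ℝ≥0∞) ^ m) volume = 1) →
      -- part (1)
      (∀ (K : 𝓢'(BlockVec (Fin m) d, ℂ)) (M : BlockVec (Fin m) d → ℂ),
        IsMultiplier K M →
        SymbolEstimates (3 * d * m) M →
        (∀ ξ : BlockVec (Fin m) d, ξ ≠ 0 →
          (∀ k : Fin m, l ≤ (k : ℕ) → ∀ q : Fin d, ξ (k, q) = 0) → M ξ = 0) →
        ‖form K A F‖ ≤ C) ∧
      -- part (2)
      (∀ (i : Fin m) (k₁ k₂ : Fin d) (u : BlockVec (Fin m) d) (c : ℝ → ℂ),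
        l ≤ (i : ℕ) →
        AEStronglyMeasurable c (volume.restrict (Ioi 0)) →
        eLpNorm c ∞ (volume.restrict (Ioi 0)) = 1 →
        (∀ ξ, IntegrableOn (squareIntegrand A i k₁ k₂ u c ξ) (Ioi 0)) ∧
        (∃ K : 𝓢'(BlockVec (Fin m) d, ℂ), IsMultiplier K (squareMultiplier A i k₁ k₂ u c)) ∧
        ∀ K : 𝓢'(BlockVec (Fin m) d, ℂ), IsMultiplier K (squareMultiplier A i k₁ k₂ u c) →
          ‖form K A F‖ ≤ C * (1 + ‖u‖) ^ (2 * d * (m - 1))) := by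
  have hε1' : 1 ≤ ε⁻¹ := (one_le_inv₀ hε0).2 hε1.le
  set S : Finset (Fin m) := Finset.univ.filter fun r => (r : ℕ) < l with hS
  obtain ⟨C₁, hC₁0, hC₁⟩ := symbolBound hm hd S ε ε⁻¹ hε0 hε1'
  obtain ⟨C₂, hC₂0, hC₂⟩ := squareBound hm hd S ε ε⁻¹ hε0 hε1'
  -- The passage from coordinate derivatives to differentials of order up to `3dm` costs at most
  -- this factor.
  set B : ℝ := ((Fintype.card (Fin m × Fin d) ^ (3 * d * m) : ℕ) : ℝ) with hB
  have hcard : 1 ≤ Fintype.card (Fin m × Fin d) := by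
    simp only [Fintype.card_prod, Fintype.card_fin]
    exact Nat.mul_pos hm hd
  have hB0 : 0 < B := by
    rw [hB, Nat.cast_pos]
    exact Nat.pow_pos hcard
  -- One constant for both parts: each summand is nonnegative and bounds one of them.
  refine ⟨C₁ * B + C₂, fun A F hdet hHS hrow hsymm hnorm => ?_⟩
  have hA : Admissible S ε ε⁻¹ A := by
    refine ⟨fun j => (hdet j).le, fun r s => (abs_le_hsNorm A r s).trans hHS, fun r hr s => ?_⟩
    exact hrow r (by simpa [hS] using hr) s
  have hF : SymTuple S F := by
    refine ⟨fun i hi j => hsymm i (by simpa [hS] using hi) j, fun j => ?_⟩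
    exact (lintegral_pow_of_eLpNorm_eq_one (hnorm j)).le
  refine ⟨fun K M hK hM hM0 => ?_, fun i k₁ k₂ u c hi hcm hc => ?_⟩
  · rw [form_eq_pairing hK]
    have h := hC₁ A F M B hA hF hB0 (hM.isSymbol hcard) fun ξ hξ h0 =>
      hM0 ξ hξ fun k hk q => h0 k (by simpa [hS] using hk) q
    linarith
  · have hc1 : ∀ᵐ t ∂(volume.restrict (Ioi (0 : ℝ))), ‖c t‖ ≤ 1 := by
      rw [eLpNorm_exponent_top] at hc
      have h := ae_le_eLpNormEssSup (f := c) (μ := volume.restrict (Ioi (0 : ℝ)))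
      rw [hc] at h
      filter_upwards [h] with t ht
      rwa [← ofReal_norm, ENNReal.ofReal_le_one] at ht
    refine ⟨fun ξ => integrableOn_squareIntegrand hcm hc1 A i k₁ k₂ u ξ,
      exists_isMultiplier (aestronglyMeasurable_squareMultiplier hcm A i k₁ k₂ u)
        (norm_squareMultiplier_le hc1 A i k₁ k₂ u), fun K hK => ?_⟩
    rw [form_eq_pairing hK]
    have h := norm_pairing_squareMultiplier_le hcm hc1 A F i k₁ k₂ u (by positivity)
      (hC₂ A F i k₁ k₂ u (by simpa [hS] using hi) hA hF)
    refine h.trans ?_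
    gcongr
    have := mul_nonneg hC₁0 hB0.le
    linarith
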